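/- Let $(M,g)$ be an oriented smooth Riemannian manifold of dimension $n$ (without boundary), let $\nabla$ be its Levi-Civita connection, with curvature $R(X,Y)=[\nabla_X,\nabla_Y]-\nabla_{[X,Y]}$, and let $SO(M)$ be its bundle of oriented orthonormal frames. Let $G\subset SO(n)$ be a closed subgroup with Lie algebra $\mathfrak g\subset\mathfrak{so}(n)$, and let $\mathfrak{so}(n)=\mathfrak g\oplus\mathfrak g^{\perp}$, where $\mathfrak g^{\perp}$ is the orthogonal complement of $\mathfrak g$ with respect to the $\mathrm{Ad}$-invariant inner product $\langle A,B\rangle=-\mathrm{tr}(AB)$ on $\mathfrak{so}(n)$ (a negative multiple of the Killing form if $n\ge 3$). Suppose that $M$ carries a $G$-structure, that is, a smooth reduction $P\subset SO(M)$ of $SO(M)$ to the structure group $G$. Let $\omega=\omega_{\mathfrak g}+\omega_{\mathfrak g^{\perp}}$ be the decomposition on $P$ of the connection form $\omega$ of $\nabla$, and let $\nabla^G$ be the connection on $TM$ defined by $\omega_{\mathfrak g}$. The intrinsic torsion of the $G$-structure is the $(1,2)$-tensor $$\xi_XY=\nabla^G_XY-\nabla_XY,$$ and we put $\xi^{\rm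 alt}_XY=\tfrac12(\xi_XY-\xi_YX)$ and $\xi^{\rm sym}_XY=\tfrac12(\xi_XY+\xi_YX)$. For a skew-symmetric endomorphism $A$ of $T_xM$ let $A_{\mathfrak g^{\perp}}$ be its component in the fibre at $x$ of $\mathfrak g^{\perp}(TM)=P\times_{\mathrm{Ad}(G)}\mathfrak g^{\perp}\subset\mathfrak{so}(TM)$, that is, the endomorphism whose matrix in a frame of $P_x$ is the $\mathfrak g^\perp$-component of the matrix of $A$ in that frame. With an orthonormal basis $(e_i)$ of $T_xM$, set $$\chi=\sum_i\xi_{e_i}e_i,\qquad s_{\mathfrak g^{\perp}}=\sum_{i,j}g\big(R(e_i,e_j)_{\mathfrak g^{\perp}}e_j,e_i\big),\qquad s^{\rm alt}_{\mathfrak g^{\perp}}=\sum_{i,j}g\big([\xi_{e_i},\xi_{e_j}]_{\mathfrak g^{\perp}}e_j,e_i\big),$$ and $|T|^2=\sum_{i,j}|T_{e_i}e_j|^2$ for a $(1,2)$-tensor $T$. Then $\chi$ is a smooth vector field on $M$ and $$\operatorname{div}\chi=\tfrac12\,s^{\rm alt}_{\mathfrak g^{\perp}}-\tfrac12\,s_{\mathfrak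 g^{\perp}}+|\chi|^2+|\xi^{\rm alt}|^2-|\xi^{\rm sym}|^2,$$ where $\operatorname{div}\chi=\sum_i g(\nabla_{e_i}\chi,e_i)$. If moreover $M$ is closed, then, for the Riemannian volume, the functions $s_{\mathfrak g^{\perp}}-s^{\rm alt}_{\mathfrak g^{\perp}}$ and $|\chi|^2+|\xi^{\rm alt}|^2-|\xi^{\rm sym}|^2$ are integrable and $$\tfrac12\int_M\big(s_{\mathfrak g^{\perp}}-s^{\rm alt}_{\mathfrak g^{\perp}}\big)\,\mathrm{vol}=\int_M\big(|\chi|^2+|\xi^{\rm alt}|^2-|\xi^{\rm sym}|^2\big)\,\mathrm{vol}.$$ -/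

import Mathlib

open Bundle Manifold
open scoped ContDiff

section LeviCivita

variable {n : ℕ} {M : Type*} [TopologicalSpace M] [ChartedSpace (EuclideanSpace ℝ (Fin n)) M]

instance finiteDimensional_tangentSpace (x : M) : FiniteDimensional ℝ (TangentSpace (𝓡 n) x) :=
  inferInstanceAs (FiniteDimensional ℝ (EuclideanSpace ℝ (Fin n)))

variable [IsManifold (𝓡 n) ∞ M]

/-- The vector field `X` is differentiable at `x`. -/
abbrev DiffFieldAt (X : Π x : M, TangentSpace (𝓡 n) x) (x : M) : Prop :=
  MDifferentiableAt (𝓡 n) (𝓡 n).tangent (fun y => (⟨y, X y⟩ : TangentBundle (𝓡 n) M)) x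

theorem diffFieldAt_extend {x : M} (v : TangentSpace (𝓡 n) x) :
    DiffFieldAt (FiberBundle.extend (EuclideanSpace ℝ (Fin n)) v) x :=
  FiberBundle.mdifferentiableAt_extend (𝓡 n) (EuclideanSpace ℝ (Fin n)) v

variable [RiemannianBundle (fun x : M => TangentSpace (𝓡 n) x)]

/-- Half the right-hand side of the Koszul formula. -/
noncomputable def koszul (X Y Z : Π x : M, TangentSpace (𝓡 n) x) (x : M) : ℝ :=
  (1 / 2 : ℝ) *
    (mvfderiv (𝓡 n) (fun y => inner ℝ (Y y) (Z y)) x (X x)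
      + mvfderiv (𝓡 n) (fun y => inner ℝ (X y) (Z y)) x (Y x)
      - mvfderiv (𝓡 n) (fun y => inner ℝ (X y) (Y y)) x (Z x)
      + inner ℝ (VectorField.mlieBracket (𝓡 n) X Y x) (Z x)
      - inner ℝ (VectorField.mlieBracket (𝓡 n) X Z x) (Y x)
      - inner ℝ (VectorField.mlieBracket (𝓡 n) Y Z x) (X x))

variable [IsContMDiffRiemannianBundle (𝓡 n) ∞ (EuclideanSpace ℝ (Fin n))
    (fun x : M => TangentSpace (𝓡 n) x)]

theorem mdiffAt_inner {X Y : Π x : M, TangentSpace (𝓡 n) x} {x : M} (hX : DiffFieldAt X x)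
    (hY : DiffFieldAt Y x) : MDifferentiableAt (𝓡 n) 𝓘(ℝ, ℝ) (fun y => inner ℝ (X y) (Y y)) x := by
  have : IsContMDiffRiemannianBundle (𝓡 n) 1 (EuclideanSpace ℝ (Fin n))
    (fun x : M => TangentSpace (𝓡 n) x) :=
      IsContMDiffRiemannianBundle.of_le (n := ∞) (by exact_mod_cast le_top)
  exact hX.inner_bundle hY

theorem mvfderiv_inner_smul_left {X Y : Π x : M, TangentSpace (𝓡 n) x} {f : M → ℝ} {x : M}
    (hf : MDifferentiableAt (𝓡 n) 𝓘(ℝ, ℝ) f x) (hX : DiffFieldAt X x) (hY : DiffFieldAt Y x)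
    (v : TangentSpace (𝓡 n) x) :
    mvfderiv (𝓡 n) (fun y => inner ℝ ((f • X) y) (Y y)) x v
      = f x * mvfderiv (𝓡 n) (fun y => inner ℝ (X y) (Y y)) x v
        + mvfderiv (𝓡 n) f x v * inner ℝ (X x) (Y x) := by
  have h : (fun y => (inner ℝ ((f • X) y) (Y y) : ℝ)) = f * (fun y => inner ℝ (X y) (Y y)) := by
    ext y; simp [real_inner_smul_left]
  rw [h, mvfderiv_mul hf (mdiffAt_inner hX hY)]
  simp; ring

theorem mvfderiv_inner_smul_right {X Y : Π x : M, TangentSpace (𝓡 n) x} {f : M → ℝ} {x : M}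
    (hf : MDifferentiableAt (𝓡 n) 𝓘(ℝ, ℝ) f x) (hX : DiffFieldAt X x) (hY : DiffFieldAt Y x)
    (v : TangentSpace (𝓡 n) x) :
    mvfderiv (𝓡 n) (fun y => inner ℝ (X y) ((f • Y) y)) x v
      = f x * mvfderiv (𝓡 n) (fun y => inner ℝ (X y) (Y y)) x v
        + mvfderiv (𝓡 n) f x v * inner ℝ (X x) (Y x) := by
  have h : (fun y => (inner ℝ (X y) ((f • Y) y) : ℝ)) = f * (fun y => inner ℝ (X y) (Y y)) := by
    ext y; simp [real_inner_smul_right]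
  rw [h, mvfderiv_mul hf (mdiffAt_inner hX hY)]
  simp; ring

theorem mvfderiv_inner_add_left {X X' Y : Π x : M, TangentSpace (𝓡 n) x} {x : M}
    (hX : DiffFieldAt X x) (hX' : DiffFieldAt X' x) (hY : DiffFieldAt Y x)
    (v : TangentSpace (𝓡 n) x) :
    mvfderiv (𝓡 n) (fun y => inner ℝ ((X + X') y) (Y y)) x v
      = mvfderiv (𝓡 n) (fun y => inner ℝ (X y) (Y y)) x v
        + mvfderiv (𝓡 n) (fun y => inner ℝ (X' y) (Y y)) x v := by
  have h : (fun y => (inner ℝ ((X + X') y) (Y y) : ℝ))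
      = (fun y => inner ℝ (X y) (Y y)) + (fun y => inner ℝ (X' y) (Y y)) := by
    ext y; simp [inner_add_left]
  rw [h, mvfderiv_add (mdiffAt_inner hX hY) (mdiffAt_inner hX' hY)]
  simp

theorem mvfderiv_inner_add_right {X Y Y' : Π x : M, TangentSpace (𝓡 n) x} {x : M}
    (hX : DiffFieldAt X x) (hY : DiffFieldAt Y x) (hY' : DiffFieldAt Y' x)
    (v : TangentSpace (𝓡 n) x) :
    mvfderiv (𝓡 n) (fun y => inner ℝ (X y) ((Y + Y') y)) x v
      = mvfderiv (𝓡 n) (fun y => inner ℝ (X y) (Y y)) x v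
        + mvfderiv (𝓡 n) (fun y => inner ℝ (X y) (Y' y)) x v := by
  have h : (fun y => (inner ℝ (X y) ((Y + Y') y) : ℝ))
      = (fun y => inner ℝ (X y) (Y y)) + (fun y => inner ℝ (X y) (Y' y)) := by
    ext y; simp [inner_add_right]
  rw [h, mvfderiv_add (mdiffAt_inner hX hY) (mdiffAt_inner hX hY')]
  simp

open VectorField in
theorem koszul_tensorial_left {Y Z : Π x : M, TangentSpace (𝓡 n) x} {x : M}
    (hY : DiffFieldAt Y x) (hZ : DiffFieldAt Z x) :
    TensorialAt (𝓡 n) (EuclideanSpace ℝ (Fin n)) (fun X => koszul X Y Z x) x where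
  smul {f X} hf hX := by
    simp only [koszul, mvfderiv_inner_smul_left hf hX hZ, mvfderiv_inner_smul_left hf hX hY]
    simp only [mlieBracket_smul_left hf hX, Pi.smul_apply', map_smul, inner_add_left,
      real_inner_smul_left, real_inner_smul_right, smul_eq_mul, neg_smul, inner_neg_left]
    ring
  add {X X'} hX hX' := by
    simp only [koszul, mvfderiv_inner_add_left hX hX' hZ, mvfderiv_inner_add_left hX hX' hY]
    simp only [mlieBracket_add_left hX hX', Pi.add_apply, map_add, inner_add_left,
      inner_add_right]
    ring

open VectorField in
theorem koszul_tensorial_right {X Y : Π x : M, TangentSpace (𝓡 n) x} {x : M}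
    (hX : DiffFieldAt X x) (hY : DiffFieldAt Y x) :
    TensorialAt (𝓡 n) (EuclideanSpace ℝ (Fin n)) (fun Z => koszul X Y Z x) x where
  smul {f Z} hf hZ := by
    simp only [koszul, mvfderiv_inner_smul_right hf hX hZ, mvfderiv_inner_smul_right hf hY hZ]
    simp only [mlieBracket_smul_right hf hZ, Pi.smul_apply', map_smul, inner_add_left,
      real_inner_smul_left, real_inner_smul_right, smul_eq_mul]
    rw [real_inner_comm (X x) (Z x), real_inner_comm (Y x) (Z x)]
    ring
  add {Z Z'} hZ hZ' := by
    simp only [koszul, mvfderiv_inner_add_right hX hZ hZ', mvfderiv_inner_add_right hY hZ hZ']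
    simp only [mlieBracket_add_right hZ hZ', Pi.add_apply, map_add, inner_add_left,
      inner_add_right]
    ring

open Classical in
/-- The operator `Y ↦ ∇Y` determined by the Koszul formula `g(∇_u Y, w) = koszul u Y w` (with the
value `0` at points where `Y` is not differentiable). -/
noncomputable def leviCivitaFun (Y : Π x : M, TangentSpace (𝓡 n) x) (x : M) :
    TangentSpace (𝓡 n) x →L[ℝ] TangentSpace (𝓡 n) x :=
  if hY : DiffFieldAt Y x then
    LinearMap.toContinuousLinearMap
      { toFun := fun u => (InnerProductSpace.toDual ℝ (TangentSpace (𝓡 n) x)).symm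
          (TensorialAt.mkHom₂ (I := 𝓡 n) (F := EuclideanSpace ℝ (Fin n))
            (F' := EuclideanSpace ℝ (Fin n)) (fun X Z => koszul X Y Z x) x
            (fun _ hZ => koszul_tensorial_left hY hZ) (fun _ hX => koszul_tensorial_right hX hY) u)
        map_add' := by intro u v; simp
        map_smul' := by intro c u; simp }
  else 0

theorem inner_leviCivitaFun {X Y Z : Π x : M, TangentSpace (𝓡 n) x} {x : M}
    (hX : DiffFieldAt X x) (hY : DiffFieldAt Y x) (hZ : DiffFieldAt Z x) :
    inner ℝ (leviCivitaFun Y x (X x)) (Z x) = koszul X Y Z x := by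
  rw [leviCivitaFun, dif_pos hY]
  simp only [LinearMap.coe_toContinuousLinearMap', LinearMap.coe_mk, AddHom.coe_mk,
    InnerProductSpace.toDual_symm_apply]
  exact TensorialAt.mkHom₂_apply _ _ hX hZ

open VectorField in
theorem koszul_add {X Y Y' Z : Π x : M, TangentSpace (𝓡 n) x} {x : M}
    (hX : DiffFieldAt X x) (hY : DiffFieldAt Y x) (hY' : DiffFieldAt Y' x)
    (hZ : DiffFieldAt Z x) :
    koszul X (Y + Y') Z x = koszul X Y Z x + koszul X Y' Z x := by
  simp only [koszul, mvfderiv_inner_add_left hY hY' hZ, mvfderiv_inner_add_right hX hY hY']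
  simp only [mlieBracket_add_left hY hY', mlieBracket_add_right hY hY', Pi.add_apply, map_add,
    inner_add_left, inner_add_right]
  ring

open VectorField in
theorem koszul_smul {X Y Z : Π x : M, TangentSpace (𝓡 n) x} {f : M → ℝ} {x : M}
    (hX : DiffFieldAt X x) (hY : DiffFieldAt Y x) (hf : MDifferentiableAt (𝓡 n) 𝓘(ℝ, ℝ) f x)
    (hZ : DiffFieldAt Z x) :
    koszul X (f • Y) Z x
      = f x * koszul X Y Z x + mvfderiv (𝓡 n) f x (X x) * inner ℝ (Y x) (Z x) := by
  simp only [koszul, mvfderiv_inner_smul_left hf hY hZ, mvfderiv_inner_smul_right hf hX hY]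
  simp only [mlieBracket_smul_left hf hY, mlieBracket_smul_right hf hY, Pi.smul_apply', map_smul,
    inner_add_left, real_inner_smul_left, real_inner_smul_right, smul_eq_mul]
  rw [real_inner_comm (X x) (Y x)]
  ring

theorem inner_leviCivitaFun' {Y : Π x : M, TangentSpace (𝓡 n) x} {x : M}
    (hY : DiffFieldAt Y x) (u w : TangentSpace (𝓡 n) x) :
    inner ℝ (leviCivitaFun Y x u) w
      = koszul (FiberBundle.extend (EuclideanSpace ℝ (Fin n)) u) Y
          (FiberBundle.extend (EuclideanSpace ℝ (Fin n)) w) x := by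
  rw [← inner_leviCivitaFun (diffFieldAt_extend u) hY (diffFieldAt_extend w)]
  simp

variable (n M) in
/-- The Levi-Civita connection `∇` of the Riemannian metric of `M`, given by the Koszul formula.
In `leviCivita n M Y x u`, the argument `u` is the direction: this is `(∇_u Y)(x)`. -/
noncomputable def leviCivita :
    CovariantDerivative (𝓡 n) (EuclideanSpace ℝ (Fin n)) (fun x : M => TangentSpace (𝓡 n) x) where
  toFun := leviCivitaFun
  isCovariantDerivativeOnUniv :=
    { add := by
        intro Y Y' x hY hY' _
        ext1 u
        refine ext_inner_right ℝ fun w => ?_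
        have h : DiffFieldAt (Y + Y') x := mdifferentiableAt_add_section hY hY'
        rw [add_apply, inner_add_left, inner_leviCivitaFun' h,
          inner_leviCivitaFun' hY, inner_leviCivitaFun' hY',
          koszul_add (diffFieldAt_extend u) hY hY' (diffFieldAt_extend w)]
      leibniz := by
        intro Y f x hY hf _
        ext1 u
        refine ext_inner_right ℝ fun w => ?_
        have h : DiffFieldAt (f • Y) x := hf.smul_section hY
        rw [inner_leviCivitaFun' h,
          koszul_smul (diffFieldAt_extend u) hY hf (diffFieldAt_extend w)]
        simp [inner_add_left, real_inner_smul_left, inner_leviCivitaFun' hY] }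

theorem inner_leviCivita {X Y Z : Π x : M, TangentSpace (𝓡 n) x} {x : M}
    (hX : DiffFieldAt X x) (hY : DiffFieldAt Y x) (hZ : DiffFieldAt Z x) :
    inner ℝ (leviCivita n M Y x (X x)) (Z x) = koszul X Y Z x :=
  inner_leviCivitaFun hX hY hZ

theorem leviCivita_torsion : (leviCivita n M).torsion = 0 := by
  rw [CovariantDerivative.torsion_eq_zero_iff]
  intro X Y x hX hY
  refine ext_inner_right ℝ fun w => ?_
  have hw := diffFieldAt_extend w
  have h1 := inner_leviCivita hX hY hw
  have h2 := inner_leviCivita hY hX hw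
  rw [FiberBundle.extend_apply_self] at h1 h2
  rw [inner_sub_left, h1, h2]
  simp only [koszul, FiberBundle.extend_apply_self]
  rw [VectorField.mlieBracket_swap_apply (V := Y) (W := X), inner_neg_left]
  simp only [real_inner_comm]
  ring

theorem leviCivita_metric {X Y Z : Π x : M, TangentSpace (𝓡 n) x} {x : M}
    (hX : DiffFieldAt X x) (hY : DiffFieldAt Y x) (hZ : DiffFieldAt Z x) :
    mvfderiv (𝓡 n) (fun y => inner ℝ (Y y) (Z y)) x (X x)
      = inner ℝ (leviCivita n M Y x (X x)) (Z x) + inner ℝ (Y x) (leviCivita n M Z x (X x)) := by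
  rw [real_inner_comm _ (Y x), inner_leviCivita hX hY hZ, inner_leviCivita hX hZ hY]
  simp only [koszul]
  rw [VectorField.mlieBracket_swap_apply (V := Z) (W := Y), inner_neg_left]
  simp only [real_inner_comm]
  ring

/-- The Riemann curvature `R(u,v)w`, with `R(X,Y) = [∇_X, ∇_Y] - ∇_[X,Y]`, computed with smooth
local extensions of `u, v, w` (on which it does not depend). -/
noncomputable def riemannCurvature (x : M) (u v w : TangentSpace (𝓡 n) x) :
    TangentSpace (𝓡 n) x :=
  let U : Π y : M, TangentSpace (𝓡 n) y := FiberBundle.extend (EuclideanSpace ℝ (Fin n)) u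
  let V : Π y : M, TangentSpace (𝓡 n) y := FiberBundle.extend (EuclideanSpace ℝ (Fin n)) v
  let W : Π y : M, TangentSpace (𝓡 n) y := FiberBundle.extend (EuclideanSpace ℝ (Fin n)) w
  leviCivita n M (fun y => leviCivita n M W y (V y)) x u
    - leviCivita n M (fun y => leviCivita n M W y (U y)) x v
    - leviCivita n M W x (VectorField.mlieBracket (𝓡 n) U V x)

/-- The divergence `div X = tr(u ↦ ∇_u X)` of a vector field. -/
noncomputable def divergence (X : Π x : M, TangentSpace (𝓡 n) x) (x : M) : ℝ :=
  LinearMap.trace ℝ (TangentSpace (𝓡 n) x)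
    (leviCivita n M X x : TangentSpace (𝓡 n) x →ₗ[ℝ] TangentSpace (𝓡 n) x)

end LeviCivita

section Volume

open MeasureTheory

variable {n : ℕ} {M : Type*} [TopologicalSpace M] [ChartedSpace (EuclideanSpace ℝ (Fin n)) M]
  [IsManifold (𝓡 n) ∞ M] [RiemannianBundle (fun x : M => TangentSpace (𝓡 n) x)]

/-- The coordinate vector field `∂_i` of the chart `φ` at `x`, at the point `φ⁻¹(y)`. -/
noncomputable def coordField (x : M) (y : EuclideanSpace ℝ (Fin n)) (i : Fin n) :
    TangentSpace (𝓡 n) ((extChartAt (𝓡 n) x).symm y) :=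
  mfderiv (𝓡 n) (𝓡 n) (extChartAt (𝓡 n) x).symm y (EuclideanSpace.single i (1 : ℝ))

/-- The Gram matrix `g_ij = g(∂_i, ∂_j)` at `φ⁻¹(y)`, for the chart `φ` at `x`. -/
noncomputable def gramMatrix (x : M) (y : EuclideanSpace ℝ (Fin n)) : Matrix (Fin n) (Fin n) ℝ :=
  Matrix.of fun i j => inner ℝ (coordField x y i) (coordField x y j)

variable [MeasurableSpace M]

/-- The measure `√(det g_ij) dy` of the chart domain at `x`, as a measure on `M` (which vanishes
outside the chart domain). -/
noncomputable def chartVolume (x : M) : Measure M :=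
  (((volume : Measure (EuclideanSpace ℝ (Fin n))).restrict
      (extChartAt (𝓡 n) x).target).withDensity
    fun y => ENNReal.ofReal √(gramMatrix x y).det).map (extChartAt (𝓡 n) x).symm

variable (n M) in
/-- The Riemannian volume measure of `M`. The measures `√(det g_ij) dy` of any two charts agree on
the intersection of the chart domains, and their supremum is the measure that restricts to
`√(det g_ij) dy` on each chart domain. -/
noncomputable def riemannianVolume : Measure M := ⨆ x : M, chartVolume (n := n) x

end Volume


section StructureGroup

variable {n : ℕ}

/-- The Lie algebra `𝔤 ⊆ 𝔰𝔬(n)` of a closed subgroup `G` of `SO(n)`, as the tangent space of `G`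
at `1`: all velocities `γ'(0)` of curves `γ` in `G` with `γ(0) = 1`. -/
def lieAlgebraOf (G : Subgroup (Matrix.specialOrthogonalGroup (Fin n) ℝ)) :
    Submodule ℝ (Matrix (Fin n) (Fin n) ℝ) where
  carrier := {A | ∃ γ : ℝ → Matrix.specialOrthogonalGroup (Fin n) ℝ,
    (∀ t, γ t ∈ G) ∧ γ 0 = 1 ∧
      ∀ i j, HasDerivAt (fun t => (γ t : Matrix (Fin n) (Fin n) ℝ) i j) (A i j) 0}
  zero_mem' := ⟨fun _ => 1, fun _ => G.one_mem, rfl, fun i j => by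
    simpa using hasDerivAt_const (0 : ℝ) ((1 : Matrix (Fin n) (Fin n) ℝ) i j)⟩
  add_mem' := by
    rintro A B ⟨γ, hγ, hγ0, hγA⟩ ⟨δ, hδ, hδ0, hδB⟩
    refine ⟨fun t => γ t * δ t, fun t => G.mul_mem (hγ t) (hδ t), by simp [hγ0, hδ0],
      fun i j => ?_⟩
    have h := HasDerivAt.fun_sum (u := Finset.univ)
      (fun k _ => (hγA i k).fun_mul (hδB k j))
    simpa [Matrix.mul_apply, hγ0, hδ0, Matrix.one_apply, Finset.sum_add_distrib] using h
  smul_mem' := by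
    rintro c A ⟨γ, hγ, hγ0, hγA⟩
    refine ⟨fun t => γ (c * t), fun t => hγ _, by simp [hγ0], fun i j => ?_⟩
    have h1 : HasDerivAt (fun t : ℝ => c * t) c 0 := by
      simpa using (hasDerivAt_id (0 : ℝ)).const_mul c
    have h2 : HasDerivAt (fun t => (γ t : Matrix (Fin n) (Fin n) ℝ) i j) (A i j) (c * 0) := by
      simpa using hγA i j
    simpa [mul_comm, Function.comp_def] using h2.comp (0 : ℝ) h1

/-- The inner product `tr(Aᵀ B)` of matrices. On `𝔰𝔬(n)` it is `-tr(A B)`, a negative multiple of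
the Killing form `(n - 2) tr(A B)` when `n ≥ 3`. -/
def traceForm (n : ℕ) : LinearMap.BilinForm ℝ (Matrix (Fin n) (Fin n) ℝ) :=
  LinearMap.mk₂ ℝ (fun A B => (A.transpose * B).trace)
    (by intro A A' B; simp [Matrix.add_mul])
    (by intro c A B; simp)
    (by intro A B B'; simp [Matrix.mul_add])
    (by intro c A B; simp)

theorem isCompl_traceForm_orthogonal (W : Submodule ℝ (Matrix (Fin n) (Fin n) ℝ)) :
    IsCompl W ((traceForm n).orthogonal W) := by
  have hsymm : ∀ A B, traceForm n A B = traceForm n B A := by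
    intro A B
    simp only [traceForm, LinearMap.mk₂_apply]
    rw [← Matrix.trace_transpose, Matrix.transpose_mul, Matrix.transpose_transpose]
  have hpos : ∀ A, traceForm n A A = 0 → A = 0 := by
    intro A hA
    have h : (A.conjTranspose * A).trace = 0 := by
      simpa [traceForm, Matrix.conjTranspose_eq_transpose_of_trivial] using hA
    exact Matrix.trace_conjTranspose_mul_self_eq_zero_iff.mp h
  refine (LinearMap.BilinForm.isCompl_orthogonal_iff_disjoint
    (fun A B h => by rw [hsymm]; exact h)).mpr ?_
  rw [Submodule.disjoint_def]
  exact fun A hA hA' => hpos A (hA' A hA)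

/-- The `𝔤`-component `A_𝔤` of a matrix. -/
noncomputable def liePart (G : Subgroup (Matrix.specialOrthogonalGroup (Fin n) ℝ)) :
    Matrix (Fin n) (Fin n) ℝ →ₗ[ℝ] Matrix (Fin n) (Fin n) ℝ :=
  (lieAlgebraOf G).projection _ (isCompl_traceForm_orthogonal (lieAlgebraOf G))

/-- The `𝔤^⊥`-component `A_𝔤⊥ = A - A_𝔤` of a matrix `A ∈ 𝔰𝔬(n) = 𝔤 ⊕ 𝔤^⊥`. -/
noncomputable def lieOrthPart (G : Subgroup (Matrix.specialOrthogonalGroup (Fin n) ℝ)) :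
    Matrix (Fin n) (Fin n) ℝ →ₗ[ℝ] Matrix (Fin n) (Fin n) ℝ :=
  LinearMap.id - liePart G

end StructureGroup

section GStructure

variable {n : ℕ} {M : Type*} [TopologicalSpace M] [ChartedSpace (EuclideanSpace ℝ (Fin n)) M]

/-- The family `e` is a basis of `V` which is positive for the orientation `o`. -/
def IsPositiveFrame {V : Type*} [AddCommGroup V] [Module ℝ V] (o : Orientation ℝ V (Fin n))
    (e : Fin n → V) : Prop :=
  ∃ b : Module.Basis (Fin n) ℝ V, ⇑b = e ∧ b.orientation = o

variable (n M) in
/-- An orientation of `M`: an orientation of each tangent space, such that locally there are smooth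
positive frames. -/
structure TangentOrientation [IsManifold (𝓡 n) ∞ M] where
  orientation : ∀ x : M, Orientation ℝ (TangentSpace (𝓡 n) x) (Fin n)
  exists_frame : ∀ x : M, ∃ U : Set M, IsOpen U ∧ x ∈ U ∧
    ∃ s : Fin n → Π y : M, TangentSpace (𝓡 n) y,
      (∀ i, ContMDiffOn (𝓡 n) (𝓡 n).tangent ∞ (fun y => (⟨y, s i y⟩ : TangentBundle (𝓡 n) M)) U) ∧
      ∀ y ∈ U, IsPositiveFrame (orientation y) (fun i => s i y)

variable [IsManifold (𝓡 n) ∞ M] [RiemannianBundle (fun x : M => TangentSpace (𝓡 n) x)]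

/-- A `G`-structure on the oriented Riemannian manifold `M`, for `G ⊆ SO(n)`: a reduction
`P ⊆ SO(M)` of the bundle of oriented orthonormal frames to the structure group `G`. Here
`frames x` is the fibre of `P` over `x`, which is one orbit of the right action
`(e · a)_j = ∑ i, a_ij e_i` of `G` on frames, and `P` has smooth local sections. -/
structure GStructure (o : TangentOrientation n M)
    (G : Subgroup (Matrix.specialOrthogonalGroup (Fin n) ℝ)) where
  frames : ∀ x : M, Set (Fin n → TangentSpace (𝓡 n) x)
  orthonormal : ∀ x, ∀ e ∈ frames x, Orthonormal ℝ e
  positive : ∀ x, ∀ e ∈ frames x, IsPositiveFrame (o.orientation x) e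
  mem_frames_iff : ∀ x, ∀ e ∈ frames x, ∀ e' : Fin n → TangentSpace (𝓡 n) x,
    e' ∈ frames x ↔ ∃ a ∈ G, ∀ j, e' j = ∑ i, (a : Matrix (Fin n) (Fin n) ℝ) i j • e i
  exists_section : ∀ x : M, ∃ U : Set M, IsOpen U ∧ x ∈ U ∧
    ∃ s : Fin n → Π y : M, TangentSpace (𝓡 n) y,
      (∀ i, ContMDiffOn (𝓡 n) (𝓡 n).tangent ∞ (fun y => (⟨y, s i y⟩ : TangentBundle (𝓡 n) M)) U) ∧
      ∀ y ∈ U, (fun i => s i y) ∈ frames y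

namespace GStructure

variable {o : TangentOrientation n M} {G : Subgroup (Matrix.specialOrthogonalGroup (Fin n) ℝ)}
  (P : GStructure o G)

/-- A neighbourhood of `x` over which `P.localFrame x` is a section of `P`. -/
def nhd (x : M) : Set M := (P.exists_section x).choose

theorem isOpen_nhd (x : M) : IsOpen (P.nhd x) := (P.exists_section x).choose_spec.1

theorem mem_nhd (x : M) : x ∈ P.nhd x := (P.exists_section x).choose_spec.2.1

/-- A smooth local section `s = (s_1, …, s_n)` of `P` near `x`. -/
noncomputable def localFrame (x : M) : Fin n → Π y : M, TangentSpace (𝓡 n) y :=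
  (P.exists_section x).choose_spec.2.2.choose

theorem contMDiffOn_localFrame (x : M) (i : Fin n) :
    ContMDiffOn (𝓡 n) (𝓡 n).tangent ∞
      (fun y => (⟨y, P.localFrame x i y⟩ : TangentBundle (𝓡 n) M)) (P.nhd x) :=
  (P.exists_section x).choose_spec.2.2.choose_spec.1 i

theorem localFrame_mem (x y : M) (hy : y ∈ P.nhd x) :
    (fun i => P.localFrame x i y) ∈ P.frames y :=
  (P.exists_section x).choose_spec.2.2.choose_spec.2 y hy

theorem diffFieldAt_localFrame (x : M) (i : Fin n) : DiffFieldAt (P.localFrame x i) x :=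
  ((P.contMDiffOn_localFrame x i).contMDiffAt
    ((P.isOpen_nhd x).mem_nhds (P.mem_nhd x))).mdifferentiableAt (by simp)

theorem sum_inner_localFrame (x : M) (v : TangentSpace (𝓡 n) x) :
    ∑ i, (inner ℝ (P.localFrame x i x) v : ℝ) • P.localFrame x i x = v := by
  have hmem := P.localFrame_mem x x (P.mem_nhd x)
  have hon := P.orthonormal x _ hmem
  obtain ⟨b, hb, -⟩ := P.positive x _ hmem
  have h := (OrthonormalBasis.mk hon (by rw [← hb]; exact b.span_eq.ge)).sum_repr' v
  simpa using h

variable [IsContMDiffRiemannianBundle (𝓡 n) ∞ (EuclideanSpace ℝ (Fin n))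
    (fun x : M => TangentSpace (𝓡 n) x)]

/-- The connection form `ω` of the Levi-Civita connection in the local section of `P` near `x`,
evaluated at `u ∈ T_x M`: `∇_u s_j = ∑ i, ω(u)_ij s_i`. -/
noncomputable def connectionForm (x : M) :
    TangentSpace (𝓡 n) x →ₗ[ℝ] Matrix (Fin n) (Fin n) ℝ where
  toFun u := Matrix.of fun i j =>
    inner ℝ (P.localFrame x i x) (leviCivita n M (P.localFrame x j) x u)
  map_add' u v := by ext i j; simp [inner_add_right]
  map_smul' c u := by ext i j; simp [real_inner_smul_right]

/-- The connection `∇^G` with connection form `ω_𝔤`: for `Y = ∑ j, Y_j s_j`,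
`∇^G_u Y = ∑ i, (dY_i(u) + ∑ j, ω_𝔤(u)_ij Y_j) s_i`. -/
noncomputable def connection :
    CovariantDerivative (𝓡 n) (EuclideanSpace ℝ (Fin n))
      (fun x : M => TangentSpace (𝓡 n) x) where
  toFun Y x := LinearMap.toContinuousLinearMap
    { toFun := fun u => ∑ i,
        (mvfderiv (𝓡 n) (fun y => (inner ℝ (P.localFrame x i y) (Y y) : ℝ)) x u
          + ∑ j, liePart G (P.connectionForm x u) i j * inner ℝ (P.localFrame x j x) (Y x))
          • P.localFrame x i x
      map_add' := by
        intro u v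
        simp only [map_add, Matrix.add_apply, add_mul, Finset.sum_add_distrib, add_smul]
        abel
      map_smul' := by
        intro c u
        simp only [map_smul, Matrix.smul_apply, smul_eq_mul, mul_assoc, ← Finset.mul_sum,
          ← mul_add, mul_smul, ← Finset.smul_sum, RingHom.id_apply] }
  isCovariantDerivativeOnUniv :=
    { add := by
        intro Y Y' x hY hY' _
        ext1 u
        simp only [LinearMap.coe_toContinuousLinearMap', LinearMap.coe_mk, AddHom.coe_mk,
          add_apply, mvfderiv_inner_add_right (P.diffFieldAt_localFrame x _) hY hY']
        simp only [Pi.add_apply, inner_add_right, mul_add, Finset.sum_add_distrib, add_smul]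
        abel
      leibniz := by
        intro Y f x hY hf _
        ext1 u
        have h := P.sum_inner_localFrame x (Y x)
        simp only [LinearMap.coe_toContinuousLinearMap', LinearMap.coe_mk, AddHom.coe_mk,
          add_apply, smul_apply, ContinuousLinearMap.smulRight_apply,
          mvfderiv_inner_smul_right hf (P.diffFieldAt_localFrame x _) hY]
        conv_rhs => rw [← h]
        simp only [Pi.smul_apply', real_inner_smul_right, Finset.smul_sum, smul_smul]
        rw [← Finset.sum_add_distrib]
        refine Finset.sum_congr rfl fun i _ => ?_
        rw [← add_smul, mul_add, Finset.mul_sum]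
        simp only [h]
        rw [add_right_comm]
        congr 3
        exact Finset.sum_congr rfl fun j _ => by ring }

/-- The intrinsic torsion `ξ = ∇^G - ∇`; here `P.torsion x u v` is `ξ_u v`. -/
noncomputable def torsion (x : M) :
    TangentSpace (𝓡 n) x →L[ℝ] TangentSpace (𝓡 n) x →L[ℝ] TangentSpace (𝓡 n) x :=
  (P.connection.difference (leviCivita n M) x).flip

/-- `ξ^alt_u v = (ξ_u v - ξ_v u) / 2`. -/
noncomputable def torsionAlt (x : M) (u v : TangentSpace (𝓡 n) x) : TangentSpace (𝓡 n) x :=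
  (1 / 2 : ℝ) • (P.torsion x u v - P.torsion x v u)

/-- `ξ^sym_u v = (ξ_u v + ξ_v u) / 2`. -/
noncomputable def torsionSym (x : M) (u v : TangentSpace (𝓡 n) x) : TangentSpace (𝓡 n) x :=
  (1 / 2 : ℝ) • (P.torsion x u v + P.torsion x v u)

/-- The squared norm `|T|² = ∑ i j, |T(e_i, e_j)|²` of a `(1,2)`-tensor at `x`, for an orthonormal
basis `(e_i)` of `T_x M`. -/
noncomputable def tensorNormSq {x : M}
    (T : TangentSpace (𝓡 n) x → TangentSpace (𝓡 n) x → TangentSpace (𝓡 n) x) : ℝ :=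
  ∑ i, ∑ j, ‖T (stdOrthonormalBasis ℝ (TangentSpace (𝓡 n) x) i)
    (stdOrthonormalBasis ℝ (TangentSpace (𝓡 n) x) j)‖ ^ 2

/-- The characteristic vector field `χ = ∑ i, ξ_{e_i} e_i`. -/
noncomputable def charField (x : M) : TangentSpace (𝓡 n) x :=
  ∑ i, P.torsion x (stdOrthonormalBasis ℝ (TangentSpace (𝓡 n) x) i)
    (stdOrthonormalBasis ℝ (TangentSpace (𝓡 n) x) i)

/-- The `𝔤^⊥(TM)`-component `A_𝔤⊥` of a skew-symmetric endomorphism `A` of `T_x M`: the matrix of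
`A` in a frame of `P` is replaced by its `𝔤^⊥`-component. -/
noncomputable def orthPart (x : M) (A : TangentSpace (𝓡 n) x → TangentSpace (𝓡 n) x) :
    TangentSpace (𝓡 n) x →L[ℝ] TangentSpace (𝓡 n) x :=
  ∑ i, ∑ j, lieOrthPart G
      (Matrix.of fun k l => inner ℝ (P.localFrame x k x) (A (P.localFrame x l x))) i j •
    (innerSL ℝ (P.localFrame x j x)).smulRight (P.localFrame x i x)

/-- `s_𝔤⊥ = ∑ i j, g(R(e_i, e_j)_𝔤⊥ e_j, e_i)`. -/
noncomputable def scalarOrth (x : M) : ℝ :=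
  ∑ i, ∑ j,
    inner ℝ
      (P.orthPart x
        (riemannCurvature x (stdOrthonormalBasis ℝ (TangentSpace (𝓡 n) x) i)
          (stdOrthonormalBasis ℝ (TangentSpace (𝓡 n) x) j))
        (stdOrthonormalBasis ℝ (TangentSpace (𝓡 n) x) j))
      (stdOrthonormalBasis ℝ (TangentSpace (𝓡 n) x) i)

/-- The commutator `[ξ_u, ξ_v]`. -/
noncomputable def torsionBracket (x : M) (u v w : TangentSpace (𝓡 n) x) : TangentSpace (𝓡 n) x :=
  P.torsion x u (P.torsion x v w) - P.torsion x v (P.torsion x u w)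

/-- `s^alt_𝔤⊥ = ∑ i j, g([ξ_{e_i}, ξ_{e_j}]_𝔤⊥ e_j, e_i)`. -/
noncomputable def scalarOrthAlt (x : M) : ℝ :=
  ∑ i, ∑ j,
    inner ℝ
      (P.orthPart x
        (P.torsionBracket x (stdOrthonormalBasis ℝ (TangentSpace (𝓡 n) x) i)
          (stdOrthonormalBasis ℝ (TangentSpace (𝓡 n) x) j))
        (stdOrthonormalBasis ℝ (TangentSpace (𝓡 n) x) j))
      (stdOrthonormalBasis ℝ (TangentSpace (𝓡 n) x) i)

end GStructure

end GStructure

/-! Fix a local section `s` of `P`. Write `Γ_k` for the matrix of the Levi-Civita connection form on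
`s_k`, and split it as `Γ_k = B_k + A_k` with `B_k` in `𝔤` and `A_k` in `𝔤^⊥`. In this frame
`ξ_{s_k}` has matrix `-A_k` (`GStructure.inner_torsion_frame`), so the `c`-th component of `χ` is
`-∑ k, (A_k)_ck`. Hence `div χ` is minus the contraction `∑ k l, (s_k A_l)_kl` plus a term quadratic
in the connection matrices.

The same derivatives occur in the curvature matrix `s_k Γ_l - s_l Γ_k - Γ([s_k, s_l]) + [Γ_k, Γ_l]`
(`IsOrthoFrameOn.inner_curvatureField`). The projection to `𝔤^⊥` is constant in frames of `P`, so it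
commutes with differentiation; by skewness the two derivative terms contribute equally to `s_𝔤⊥`.
Since `[𝔤, 𝔤] ⊆ 𝔤` and `[𝔤, 𝔤^⊥] ⊆ 𝔤^⊥`, the `𝔤^⊥`-part of `[Γ_k, Γ_l]` consists of two mixed
brackets and `[A_k, A_l]_𝔤⊥` (`lieOrthPart_bracket`), and the last piece is what `s^alt_𝔤⊥`
contracts. By polarization `|ξ^alt|² - |ξ^sym|²` is `-∑ k l, g(ξ_{s_k} s_l, ξ_{s_l} s_k)`. The
remaining claim contains no derivatives and is the index computation `connection_sum_identity`.

All this needs one frame on a whole neighbourhood, whereas `∇^G` is defined at each point through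
the section chosen for that point. Independence of the section is
`GStructure.inner_connection_frame`: a change of section is a `G`-valued map `a`, the form `a⁻¹ da`
has values in `𝔤`, and `Ad(G)` respects the splitting.

The integral formula follows by integrating the pointwise one. The divergence theorem comes from
`√(det g) div X = ∑ i, ∂_i (√(det g) X^i)` in a chart (`chartDensity_mul_divergence`) and a
partition of unity; the supremum of the chart measures is shown to restrict to each of them. -/

set_option linter.unusedSectionVars false

/-! ### Smooth vector fields, their brackets, and derivatives of functions along them. -/

section SmoothFields

open VectorField

variable {n : ℕ} {M : Type*} [TopologicalSpace M] [ChartedSpace (EuclideanSpace ℝ (Fin n)) M]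
  [IsManifold (𝓡 n) ∞ M]

/-- The vector field `X` is smooth at `x`. -/
abbrev SmoothFieldAt (X : Π x : M, TangentSpace (𝓡 n) x) (x : M) : Prop :=
  ContMDiffAt (𝓡 n) (𝓡 n).tangent ∞ (fun y => (⟨y, X y⟩ : TangentBundle (𝓡 n) M)) x

/-- The real function `f` is smooth at `x`. -/
abbrev SmoothFnAt (f : M → ℝ) (x : M) : Prop := ContMDiffAt (𝓡 n) 𝓘(ℝ, ℝ) ∞ f x

theorem SmoothFieldAt.diffFieldAt {X : Π x : M, TangentSpace (𝓡 n) x} {x : M}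
    (hX : SmoothFieldAt X x) : DiffFieldAt X x :=
  hX.mdifferentiableAt (by simp)

theorem SmoothFieldAt.eventually_diffFieldAt {X : Π x : M, TangentSpace (𝓡 n) x} {x : M}
    (hX : SmoothFieldAt X x) : ∀ᶠ y in nhds x, DiffFieldAt X y := by
  -- Regularity at a point spreads to a neighbourhood only for finite order, so the order is lowered
  -- to 1 first.
  have h1 : ContMDiffAt (𝓡 n) (𝓡 n).tangent 1
    (fun y => (⟨y, X y⟩ : TangentBundle (𝓡 n) M)) x := hX.of_le (by exact_mod_cast le_top)
  filter_upwards [(contMDiffAt_iff_contMDiffAt_nhds (by simp)).mp h1] with y hy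
  exact hy.mdifferentiableAt (by simp)

theorem SmoothFnAt.mdifferentiableAt {f : M → ℝ} {x : M} (hf : SmoothFnAt (n := n) f x) :
    MDifferentiableAt (𝓡 n) 𝓘(ℝ, ℝ) f x :=
  ContMDiffAt.mdifferentiableAt hf (by simp)

theorem SmoothFnAt.eventually_mdifferentiableAt {f : M → ℝ} {x : M}
    (hf : SmoothFnAt (n := n) f x) : ∀ᶠ y in nhds x, MDifferentiableAt (𝓡 n) 𝓘(ℝ, ℝ) f y := by
  have h1 : ContMDiffAt (𝓡 n) 𝓘(ℝ, ℝ) 1 f x := ContMDiffAt.of_le hf (by exact_mod_cast le_top)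
  filter_upwards [(contMDiffAt_iff_contMDiffAt_nhds (by simp)).mp h1] with y hy
  exact hy.mdifferentiableAt (by simp)

theorem SmoothFieldAt.congr {X Y : Π x : M, TangentSpace (𝓡 n) x} {x : M}
    (hX : SmoothFieldAt X x) (h : ∀ᶠ y in nhds x, Y y = X y) : SmoothFieldAt Y x :=
  hX.congr_of_eventuallyEq (by filter_upwards [h] with y hy; rw [hy])

theorem smoothFieldAt_extend {x : M} (v : TangentSpace (𝓡 n) x) :
    SmoothFieldAt (FiberBundle.extend (EuclideanSpace ℝ (Fin n)) v) x :=
  FiberBundle.contMDiffAt_extend (𝓡 n) (EuclideanSpace ℝ (Fin n)) v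

theorem SmoothFieldAt.smul {f : M → ℝ} {X : Π x : M, TangentSpace (𝓡 n) x} {x : M}
    (hf : SmoothFnAt (n := n) f x) (hX : SmoothFieldAt X x) : SmoothFieldAt (f • X) x :=
  ContMDiffAt.smul_section hf hX

theorem SmoothFieldAt.add {X Y : Π x : M, TangentSpace (𝓡 n) x} {x : M}
    (hX : SmoothFieldAt X x) (hY : SmoothFieldAt Y x) : SmoothFieldAt (X + Y) x :=
  ContMDiffAt.add_section hX hY

theorem SmoothFieldAt.sub {X Y : Π x : M, TangentSpace (𝓡 n) x} {x : M}
    (hX : SmoothFieldAt X x) (hY : SmoothFieldAt Y x) : SmoothFieldAt (X - Y) x :=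
  ContMDiffAt.sub_section hX hY

theorem SmoothFieldAt.sum {ι : Type*} {s : Finset ι} {X : ι → Π x : M, TangentSpace (𝓡 n) x}
    {x : M} (hX : ∀ i ∈ s, SmoothFieldAt (X i) x) : SmoothFieldAt (∑ i ∈ s, X i) x := by
  have := ContMDiffAt.sum_section hX
  exact SmoothFieldAt.congr (X := fun y => ∑ i ∈ s, X i y) this
    (by filter_upwards with y; simp)

theorem two_le_infty : (2 : WithTop ℕ∞) ≤ ∞ := by
  exact ENat.LEInfty.out

theorem three_le_infty : (3 : WithTop ℕ∞) ≤ ∞ := by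
  exact ENat.LEInfty.out

theorem SmoothFieldAt.mlieBracket {X Y : Π x : M, TangentSpace (𝓡 n) x} {x : M}
    (hX : SmoothFieldAt X x) (hY : SmoothFieldAt Y x) :
    SmoothFieldAt (VectorField.mlieBracket (𝓡 n) X Y) x := by
  have : IsManifold (𝓡 n) (((⊤ : ℕ∞) : WithTop ℕ∞) + 1) M := by
    simpa using! (inferInstance : IsManifold (𝓡 n) ∞ M)
  have : IsManifold (𝓡 n) (minSmoothness ℝ 2) M :=
    IsManifold.of_le (n := ∞) (by simpa using two_le_infty)
  exact ContMDiffAt.mlieBracket_vectorField (n := ⊤) (m := ⊤) hX hY (by simp)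

variable [RiemannianBundle (fun x : M => TangentSpace (𝓡 n) x)]
  [IsContMDiffRiemannianBundle (𝓡 n) ∞ (EuclideanSpace ℝ (Fin n))
    (fun x : M => TangentSpace (𝓡 n) x)]

theorem SmoothFieldAt.inner {X Y : Π x : M, TangentSpace (𝓡 n) x} {x : M}
    (hX : SmoothFieldAt X x) (hY : SmoothFieldAt Y x) :
    SmoothFnAt (n := n) (fun y => Inner.inner ℝ (X y) (Y y)) x :=
  ContMDiffAt.inner_bundle hX hY

/-- The Leibniz rule `[Y, fZ] = f [Y, Z] + (Yf) Z` recovers `Yf` from brackets. Smoothness of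
brackets and the Jacobi identity thereby become statements about derivatives of functions. -/
theorem mvfderiv_apply_eq_bracket {f : M → ℝ} {Y Z : Π x : M, TangentSpace (𝓡 n) x} {x : M}
    (hf : MDifferentiableAt (𝓡 n) 𝓘(ℝ, ℝ) f x) (hZ : DiffFieldAt Z x) :
    mvfderiv (𝓡 n) f x (Y x) * inner ℝ (Z x) (Z x)
      = inner ℝ (mlieBracket (𝓡 n) Y (f • Z) x - f x • mlieBracket (𝓡 n) Y Z x) (Z x) := by
  rw [mlieBracket_smul_right hf hZ, add_sub_cancel_right, real_inner_smul_left]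

theorem eq_zero_of_dim_zero {x : M} (h : n = 0) (v : TangentSpace (𝓡 n) x) : v = 0 := by
  subst h
  exact (inferInstance : Subsingleton (EuclideanSpace ℝ (Fin 0))).elim _ _

theorem exists_tangent_ne_zero (h : n ≠ 0) (x : M) : ∃ v : TangentSpace (𝓡 n) x, v ≠ 0 := by
  have : Nonempty (Fin n) := ⟨⟨0, Nat.pos_of_ne_zero h⟩⟩
  exact @exists_ne (EuclideanSpace ℝ (Fin n)) _ 0

/-- Where `Z` does not vanish, `Yf` is the quotient of `g([Y, fZ] - f [Y, Z], Z)` by `g(Z, Z)`, both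
smooth. In dimension 0 no such `Z` exists and the derivative is zero. -/
theorem SmoothFnAt.mvfderiv_apply {f : M → ℝ} {Y : Π x : M, TangentSpace (𝓡 n) x} {x : M}
    (hf : SmoothFnAt (n := n) f x) (hY : SmoothFieldAt Y x) :
    SmoothFnAt (n := n) (fun y => mvfderiv (𝓡 n) f y (Y y)) x := by
  by_cases h0 : n = 0
  · refine (contMDiffAt_const (c := (0 : ℝ))).congr_of_eventuallyEq ?_
    filter_upwards with y
    rw [eq_zero_of_dim_zero h0 (Y y), map_zero]
  obtain ⟨v, hv⟩ := exists_tangent_ne_zero h0 x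
  set Z := FiberBundle.extend (EuclideanSpace ℝ (Fin n)) v
  have hZ : SmoothFieldAt Z x := smoothFieldAt_extend v
  have hZx : Z x = v := by simp [Z]
  have hZZ := hZ.inner hZ
  have hne : (Inner.inner ℝ (Z x) (Z x) : ℝ) ≠ 0 := by rw [hZx]; exact inner_self_ne_zero.mpr hv
  have hnum : SmoothFnAt (n := n) (fun y => Inner.inner ℝ
      ((VectorField.mlieBracket (𝓡 n) Y (f • Z) - f • VectorField.mlieBracket (𝓡 n) Y Z) y)
      (Z y)) x :=
    ((hY.mlieBracket (.smul hf hZ)).sub (.smul hf (hY.mlieBracket hZ))).inner hZ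
  have hq := ContMDiffAt.div₀ hnum hZZ hne
  refine hq.congr_of_eventuallyEq ?_
  have hne' := hZZ.continuousAt.eventually_ne hne
  filter_upwards [hne', hZ.eventually_diffFieldAt, SmoothFnAt.eventually_mdifferentiableAt hf]
    with y h1 h2 h3
  rw [Pi.div_apply, eq_div_iff h1, mvfderiv_apply_eq_bracket h3 h2]
  rfl

/-- `[X, Y] f = X (Y f) - Y (X f)`. -/
theorem mvfderiv_mlieBracket {f : M → ℝ} {X Y : Π x : M, TangentSpace (𝓡 n) x} {x : M}
    (hf : SmoothFnAt (n := n) f x) (hX : SmoothFieldAt X x) (hY : SmoothFieldAt Y x) :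
    mvfderiv (𝓡 n) f x (mlieBracket (𝓡 n) X Y x)
      = mvfderiv (𝓡 n) (fun y => mvfderiv (𝓡 n) f y (Y y)) x (X x)
        - mvfderiv (𝓡 n) (fun y => mvfderiv (𝓡 n) f y (X y)) x (Y x) := by
  by_cases h0 : n = 0
  · rw [eq_zero_of_dim_zero h0 (X x), eq_zero_of_dim_zero h0 (Y x),
      eq_zero_of_dim_zero h0 (mlieBracket (𝓡 n) X Y x)]
    simp
  obtain ⟨v, hv⟩ := exists_tangent_ne_zero h0 x
  set Z := FiberBundle.extend (EuclideanSpace ℝ (Fin n)) v with hZdef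
  have hZ : SmoothFieldAt Z x := smoothFieldAt_extend v
  have hZx : Z x = v := by simp [Z]
  have two : minSmoothness ℝ 2 ≤ (∞ : WithTop ℕ∞) := by simpa using two_le_infty
  have : IsManifold (𝓡 n) (minSmoothness ℝ 3) M :=
    IsManifold.of_le (n := ∞) (by simpa using three_le_infty)
  -- Expanding `[X, [Y, fZ]]` by Leibniz isolates `X(Yf) v`. The Jacobi identities for `fZ` and for
  -- `Z` then differ exactly by a multiple of `v = Z x`, and `v ≠ 0` allows the coefficients to be
  -- compared.
  have key : ∀ {X Y : Π x : M, TangentSpace (𝓡 n) x}, SmoothFieldAt X x → SmoothFieldAt Y x →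
      mlieBracket (𝓡 n) X (mlieBracket (𝓡 n) Y (f • Z)) x
        = mvfderiv (𝓡 n) (fun y => mvfderiv (𝓡 n) f y (Y y)) x (X x) • v
          + mvfderiv (𝓡 n) f x (Y x) • mlieBracket (𝓡 n) X Z x
          + (mvfderiv (𝓡 n) f x (X x) • mlieBracket (𝓡 n) Y Z x
          + f x • mlieBracket (𝓡 n) X (mlieBracket (𝓡 n) Y Z) x) := by
    intro X Y hX hY
    have hYf := SmoothFnAt.mvfderiv_apply hf hY
    have e : mlieBracket (𝓡 n) Y (f • Z) =ᶠ[nhds x]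
        (fun y => mvfderiv (𝓡 n) f y (Y y)) • Z + f • mlieBracket (𝓡 n) Y Z := by
      filter_upwards [hZ.eventually_diffFieldAt, SmoothFnAt.eventually_mdifferentiableAt hf]
        with y h2 h3
      rw [mlieBracket_smul_right h3 h2]
      rfl
    rw [Filter.EventuallyEq.mlieBracket_vectorField_eq (Filter.EventuallyEq.refl _ X) e,
      mlieBracket_add_right (SmoothFieldAt.smul hYf hZ).diffFieldAt
        (SmoothFieldAt.smul hf (hY.mlieBracket hZ)).diffFieldAt,
      mlieBracket_smul_right hYf.mdifferentiableAt hZ.diffFieldAt,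
      mlieBracket_smul_right hf.mdifferentiableAt (hY.mlieBracket hZ).diffFieldAt, hZx]
  have jac : ∀ {W : Π x : M, TangentSpace (𝓡 n) x}, SmoothFieldAt W x →
      mlieBracket (𝓡 n) X (mlieBracket (𝓡 n) Y W) x
        = mlieBracket (𝓡 n) (mlieBracket (𝓡 n) X Y) W x
          + mlieBracket (𝓡 n) Y (mlieBracket (𝓡 n) X W) x := fun hW =>
    leibniz_identity_mlieBracket_apply (hX.of_le two) (hY.of_le two) (hW.of_le two)
  have j1 := jac (.smul hf hZ)
  have j2 := jac hZ
  rw [key hX hY, key hY hX, mlieBracket_smul_right hf.mdifferentiableAt hZ.diffFieldAt, hZx,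
    j2] at j1
  refine smul_left_injective ℝ hv ?_
  simp only [sub_smul]
  rw [smul_add] at j1
  rw [eq_sub_iff_add_eq]
  have j3 := sub_eq_zero.mpr j1
  rw [← sub_eq_zero, ← neg_eq_zero, ← j3]
  abel

theorem leviCivita_congr {Y Y' : Π x : M, TangentSpace (𝓡 n) x} {x : M}
    (hY : DiffFieldAt Y x) (h : ∀ᶠ y in nhds x, Y' y = Y y) :
    leviCivita n M Y' x = leviCivita n M Y x := by
  refine (leviCivita n M).isCovariantDerivativeOnUniv.congr_of_eventuallyEq ?_ hY ?_ ?_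
  · exact hY.congr_of_eventuallyEq (by filter_upwards [h] with y hy; rw [hy])
  · exact Filter.univ_mem
  · exact h

theorem leviCivita_add {Y Y' : Π x : M, TangentSpace (𝓡 n) x} {x : M}
    (hY : DiffFieldAt Y x) (hY' : DiffFieldAt Y' x) :
    leviCivita n M (Y + Y') x = leviCivita n M Y x + leviCivita n M Y' x :=
  (leviCivita n M).isCovariantDerivativeOnUniv.add hY hY'

theorem leviCivita_smul {f : M → ℝ} {Y : Π x : M, TangentSpace (𝓡 n) x} {x : M}
    (hf : MDifferentiableAt (𝓡 n) 𝓘(ℝ, ℝ) f x) (hY : DiffFieldAt Y x) (u : TangentSpace (𝓡 n) x) :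
    leviCivita n M (f • Y) x u = f x • leviCivita n M Y x u + mvfderiv (𝓡 n) f x u • Y x := by
  rw [(leviCivita n M).isCovariantDerivativeOnUniv.leibniz hY hf]
  simp

theorem leviCivita_sub_swap {X Y : Π x : M, TangentSpace (𝓡 n) x} {x : M}
    (hX : DiffFieldAt X x) (hY : DiffFieldAt Y x) :
    mlieBracket (𝓡 n) X Y x = leviCivita n M Y x (X x) - leviCivita n M X x (Y x) :=
  ((CovariantDerivative.torsion_eq_zero_iff _).mp leviCivita_torsion hX hY).symm

theorem smoothFnAt_koszul {X Y Z : Π x : M, TangentSpace (𝓡 n) x} {x : M}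
    (hX : SmoothFieldAt X x) (hY : SmoothFieldAt Y x) (hZ : SmoothFieldAt Z x) :
    SmoothFnAt (n := n) (koszul X Y Z) x := by
  have h1 := SmoothFnAt.mvfderiv_apply (hY.inner hZ) hX
  have h2 := SmoothFnAt.mvfderiv_apply (hX.inner hZ) hY
  have h3 := SmoothFnAt.mvfderiv_apply (hX.inner hY) hZ
  have h4 := (hX.mlieBracket hY).inner hZ
  have h5 := (hX.mlieBracket hZ).inner hY
  have h6 := (hY.mlieBracket hZ).inner hX
  exact contMDiffAt_const.mul (((((h1.add h2).sub h3).add h4).sub h5).sub h6)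

end SmoothFields

/-- The trace of a bilinear map does not depend on the orthonormal basis. This moves sums over
`stdOrthonormalBasis`, which is chosen pointwise, to smooth frames; the index types may differ. -/
theorem OrthonormalBasis.sum_bilin_eq {ι κ V W : Type*} [Fintype ι] [Fintype κ]
    [NormedAddCommGroup V] [InnerProductSpace ℝ V] [AddCommGroup W] [Module ℝ W]
    (b : OrthonormalBasis ι ℝ V) (c : OrthonormalBasis κ ℝ V) (B : V →ₗ[ℝ] V →ₗ[ℝ] W) :
    ∑ i, B (b i) (b i) = ∑ k, B (c k) (c k) := by
  classical
  have h1 : ∀ i, B (b i) (b i)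
      = ∑ k, ∑ l, ((inner ℝ (c k) (b i) : ℝ) * inner ℝ (b i) (c l)) • B (c k) (c l) := by
    intro i
    conv_lhs => rw [← c.sum_repr' (b i)]
    simp only [map_sum, map_smul, LinearMap.sum_apply, LinearMap.smul_apply, Finset.smul_sum,
      smul_smul]
    rw [Finset.sum_comm]
    refine Finset.sum_congr rfl fun k _ => Finset.sum_congr rfl fun l _ => ?_
    rw [real_inner_comm (b i) (c l), mul_comm]
  simp only [h1]
  rw [Finset.sum_comm]
  refine Finset.sum_congr rfl fun k _ => ?_
  rw [Finset.sum_comm]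
  simp only [← Finset.sum_smul, b.sum_inner_mul_inner, c.inner_eq_ite]
  simp

/-! ### Orthonormal frames, tensoriality of the curvature, and the structure equations. -/

section Frames

open VectorField

variable {n : ℕ} {M : Type*} [TopologicalSpace M] [ChartedSpace (EuclideanSpace ℝ (Fin n)) M]
  [IsManifold (𝓡 n) ∞ M] [RiemannianBundle (fun x : M => TangentSpace (𝓡 n) x)]

theorem finrank_tangentSpace (x : M) : Module.finrank ℝ (TangentSpace (𝓡 n) x) = n :=
  finrank_euclideanSpace_fin (𝕜 := ℝ) (n := n)

/-- `s` is a smooth orthonormal frame over the open set `U`. -/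
structure IsOrthoFrameOn (s : Fin n → Π y : M, TangentSpace (𝓡 n) y) (U : Set M) : Prop where
  isOpen : IsOpen U
  smooth : ∀ i, ∀ y ∈ U, SmoothFieldAt (s i) y
  orthonormal : ∀ y ∈ U, Orthonormal ℝ fun i => s i y

namespace IsOrthoFrameOn

variable {s : Fin n → Π y : M, TangentSpace (𝓡 n) y} {U : Set M} (F : IsOrthoFrameOn s U) {x : M}
  (hx : x ∈ U)

/-- The orthonormal basis of `T_x M` formed by the frame at `x`. -/
noncomputable def basis : OrthonormalBasis (Fin n) ℝ (TangentSpace (𝓡 n) x) :=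
  OrthonormalBasis.mk (F.orthonormal x hx)
    ((F.orthonormal x hx).linearIndependent.span_eq_top_of_card_eq_finrank'
      (by rw [finrank_tangentSpace, Fintype.card_fin])).ge

@[simp]
theorem basis_apply (i : Fin n) : F.basis hx i = s i x := by
  simp [basis]

include F hx in
theorem inner_eq (i j : Fin n) : (inner ℝ (s i x) (s j x) : ℝ) = if i = j then 1 else 0 := by
  simpa using (F.basis hx).inner_eq_ite i j

include F hx in
theorem sum_inner_smul (v : TangentSpace (𝓡 n) x) : ∑ i, (inner ℝ (s i x) v : ℝ) • s i x = v := by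
  simpa using (F.basis hx).sum_repr' v

include F hx in
theorem sum_inner_mul_inner (v w : TangentSpace (𝓡 n) x) :
    ∑ i, (inner ℝ (s i x) v : ℝ) * inner ℝ (s i x) w = inner ℝ v w := by
  simpa [real_inner_comm] using (F.basis hx).sum_inner_mul_inner v w

include F hx in
theorem eventually_mem : ∀ᶠ y in nhds x, y ∈ U := F.isOpen.mem_nhds hx

variable [IsContMDiffRiemannianBundle (𝓡 n) ∞ (EuclideanSpace ℝ (Fin n))
    (fun x : M => TangentSpace (𝓡 n) x)]

include F hx in
theorem smoothFieldAt_of_coeff {X : Π y : M, TangentSpace (𝓡 n) y}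
    (h : ∀ i, SmoothFnAt (n := n) (fun y => inner ℝ (s i y) (X y)) x) : SmoothFieldAt X x := by
  have : SmoothFieldAt (∑ i, (fun y => (inner ℝ (s i y) (X y) : ℝ)) • s i) x :=
    SmoothFieldAt.sum fun i _ => .smul (h i) (F.smooth i x hx)
  refine this.congr ?_
  filter_upwards [F.eventually_mem hx] with y hy
  simpa using (F.sum_inner_smul hy (X y)).symm

include F hx in
-- The frame components of `∇_X Y` are Koszul expressions with smooth entries.
theorem smoothFieldAt_leviCivita {X Y : Π y : M, TangentSpace (𝓡 n) y}
    (hX : SmoothFieldAt X x) (hY : SmoothFieldAt Y x) :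
    SmoothFieldAt (fun y => leviCivita n M Y y (X y)) x := by
  refine F.smoothFieldAt_of_coeff hx fun i => ?_
  refine ContMDiffAt.congr_of_eventuallyEq (smoothFnAt_koszul hX hY (F.smooth i x hx)) ?_
  filter_upwards [F.eventually_mem hx, hX.eventually_diffFieldAt, hY.eventually_diffFieldAt]
    with y hy h1 h2
  rw [real_inner_comm, inner_leviCivita h1 h2 (F.smooth i y hy).diffFieldAt]

end IsOrthoFrameOn

variable [IsContMDiffRiemannianBundle (𝓡 n) ∞ (EuclideanSpace ℝ (Fin n))
    (fun x : M => TangentSpace (𝓡 n) x)]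

theorem mvfderiv_inner {Y Z : Π x : M, TangentSpace (𝓡 n) x} {x : M}
    (hY : DiffFieldAt Y x) (hZ : DiffFieldAt Z x) (u : TangentSpace (𝓡 n) x) :
    mvfderiv (𝓡 n) (fun y => inner ℝ (Y y) (Z y)) x u
      = inner ℝ (leviCivita n M Y x u) (Z x) + inner ℝ (Y x) (leviCivita n M Z x u) := by
  simpa using leviCivita_metric (diffFieldAt_extend u) hY hZ

/-- An operation on vector fields near `x` which is linear over smooth functions. -/
structure IsSmoothTensorialAt {W : Type*} [AddCommGroup W] [Module ℝ W] (x : M)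
    (Φ : (Π y : M, TangentSpace (𝓡 n) y) → W) : Prop where
  congr : ∀ {X Y : Π y : M, TangentSpace (𝓡 n) y}, SmoothFieldAt X x →
    (∀ᶠ y in nhds x, Y y = X y) → Φ Y = Φ X
  add : ∀ {X Y : Π y : M, TangentSpace (𝓡 n) y}, SmoothFieldAt X x → SmoothFieldAt Y x →
    Φ (X + Y) = Φ X + Φ Y
  smul : ∀ {f : M → ℝ} {X : Π y : M, TangentSpace (𝓡 n) y}, SmoothFnAt (n := n) f x →
    SmoothFieldAt X x → Φ (f • X) = f x • Φ X

namespace IsSmoothTensorialAt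

variable {W : Type*} [AddCommGroup W] [Module ℝ W] {x : M}
  {Φ : (Π y : M, TangentSpace (𝓡 n) y) → W}

theorem zero (h : IsSmoothTensorialAt x Φ) : Φ 0 = 0 := by
  have h0 : SmoothFieldAt (0 : Π y : M, TangentSpace (𝓡 n) y) x :=
    contMDiffAt_zeroSection (𝕜 := ℝ) (IB := 𝓡 n) (F := EuclideanSpace ℝ (Fin n))
      (fun y : M => TangentSpace (𝓡 n) y)
  have := h.smul (f := fun _ => 0) contMDiffAt_const h0
  rw [zero_smul] at this
  rw [← this]
  congr 1
  ext1 y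
  simp

theorem sum (h : IsSmoothTensorialAt x Φ) {ι : Type*} (t : Finset ι)
    {X : ι → Π y : M, TangentSpace (𝓡 n) y} (hX : ∀ i ∈ t, SmoothFieldAt (X i) x) :
    Φ (∑ i ∈ t, X i) = ∑ i ∈ t, Φ (X i) := by
  classical
  induction t using Finset.induction_on with
  | empty => simpa using h.zero
  | insert a t ha ih =>
    rw [Finset.sum_insert ha, Finset.sum_insert ha, h.add (hX a (by simp))
      (SmoothFieldAt.sum fun i hi => hX i (by simp [hi])), ih fun i hi => hX i (by simp [hi])]

/-- By locality the field may be replaced by its expansion in the frame, and linearity over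
functions pulls out the coefficients. -/
theorem eq_sum (h : IsSmoothTensorialAt x Φ) {s : Fin n → Π y : M, TangentSpace (𝓡 n) y}
    {U : Set M} (F : IsOrthoFrameOn s U) (hx : x ∈ U) {X : Π y : M, TangentSpace (𝓡 n) y}
    (hX : SmoothFieldAt X x) : Φ X = ∑ i, (inner ℝ (s i x) (X x) : ℝ) • Φ (s i) := by
  have hc : ∀ i, SmoothFnAt (n := n) (fun y => inner ℝ (s i y) (X y)) x := fun i =>
    (F.smooth i x hx).inner hX
  have e : ∀ᶠ y in nhds x, X y = (∑ i, (fun y => (inner ℝ (s i y) (X y) : ℝ)) • s i) y := by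
    filter_upwards [F.eventually_mem hx] with y hy
    simpa using (F.sum_inner_smul hy (X y)).symm
  rw [h.congr (SmoothFieldAt.sum fun i _ => .smul (hc i) (F.smooth i x hx)) e,
    h.sum _ fun i _ => .smul (hc i) (F.smooth i x hx)]
  exact Finset.sum_congr rfl fun i _ => h.smul (hc i) (F.smooth i x hx)

end IsSmoothTensorialAt

/-- `R(X,Y)Z = ∇_X ∇_Y Z - ∇_Y ∇_X Z - ∇_[X,Y] Z` for vector fields `X, Y, Z`. -/
noncomputable def curvatureField (X Y Z : Π y : M, TangentSpace (𝓡 n) y) (x : M) :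
    TangentSpace (𝓡 n) x :=
  leviCivita n M (fun y => leviCivita n M Z y (Y y)) x (X x)
    - leviCivita n M (fun y => leviCivita n M Z y (X y)) x (Y x)
    - leviCivita n M Z x (mlieBracket (𝓡 n) X Y x)

theorem riemannCurvature_eq (x : M) (u v w : TangentSpace (𝓡 n) x) :
    riemannCurvature x u v w = curvatureField
      (FiberBundle.extend (EuclideanSpace ℝ (Fin n)) u)
      (FiberBundle.extend (EuclideanSpace ℝ (Fin n)) v)
      (FiberBundle.extend (EuclideanSpace ℝ (Fin n)) w) x := by
  simp [riemannCurvature, curvatureField]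

theorem curvatureField_swap (X Y Z : Π y : M, TangentSpace (𝓡 n) y) (x : M) :
    curvatureField X Y Z x = - curvatureField Y X Z x := by
  simp only [curvatureField]
  rw [mlieBracket_swap_apply, map_neg]
  abel

section

variable {s : Fin n → Π y : M, TangentSpace (𝓡 n) y} {U : Set M} (F : IsOrthoFrameOn s U) {x : M}
  (hx : x ∈ U) {X Y Z : Π y : M, TangentSpace (𝓡 n) y}

include F hx

/-- The term `-(Yf) ∇_X Z` coming from `∇_Y (f ∇_X Z)` is cancelled by the term of `∇_[fX,Y] Z` in
which `[fX, Y]` differentiates `f`. The frame is needed only to know that `∇_X Z` is differentiable.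
-/
theorem isSmoothTensorialAt_curvatureField_left (hZ : SmoothFieldAt Z x) :
    IsSmoothTensorialAt x (fun X => curvatureField X Y Z x) where
  congr {X X'} hX h := by
    have e : ∀ᶠ y in nhds x, leviCivita n M Z y (X' y) = leviCivita n M Z y (X y) := by
      filter_upwards [h] with y hy
      rw [hy]
    simp only [curvatureField]
    rw [leviCivita_congr (F.smoothFieldAt_leviCivita hx hX hZ).diffFieldAt e,
      h.self_of_nhds, Filter.EventuallyEq.mlieBracket_vectorField_eq h (Filter.EventuallyEq.refl _ Y)]
  add {X X'} hX hX' := by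
    have e : (fun y => leviCivita n M Z y ((X + X') y))
        = (fun y => leviCivita n M Z y (X y)) + fun y => leviCivita n M Z y (X' y) := by
      ext1 y
      simp
    simp only [curvatureField]
    rw [e, leviCivita_add (F.smoothFieldAt_leviCivita hx hX hZ).diffFieldAt
      (F.smoothFieldAt_leviCivita hx hX' hZ).diffFieldAt,
      mlieBracket_add_left hX.diffFieldAt hX'.diffFieldAt]
    simp only [Pi.add_apply, map_add, add_apply]
    abel
  smul {f X} hf hX := by
    have e : (fun y => leviCivita n M Z y ((f • X) y))
        = f • (fun y => leviCivita n M Z y (X y)) := by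
      ext1 y
      simp
    simp only [curvatureField]
    rw [e, leviCivita_smul hf.mdifferentiableAt
      (F.smoothFieldAt_leviCivita hx hX hZ).diffFieldAt,
      mlieBracket_smul_left hf.mdifferentiableAt hX.diffFieldAt]
    simp only [Pi.smul_apply', map_add, map_smul, neg_smul, map_neg, smul_sub]
    abel

theorem isSmoothTensorialAt_curvatureField_mid (hZ : SmoothFieldAt Z x) :
    IsSmoothTensorialAt x (fun Y => curvatureField X Y Z x) where
  congr hY h := by
    simp only [curvatureField_swap X]
    rw [(isSmoothTensorialAt_curvatureField_left F hx hZ).congr hY h]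
  add hY hY' := by
    simp only [curvatureField_swap X]
    rw [(isSmoothTensorialAt_curvatureField_left F hx hZ).add hY hY', neg_add]
  smul hf hY := by
    simp only [curvatureField_swap X]
    rw [(isSmoothTensorialAt_curvatureField_left F hx hZ).smul hf hY, smul_neg]

theorem isSmoothTensorialAt_curvatureField_right (hX : SmoothFieldAt X x)
    (hY : SmoothFieldAt Y x) : IsSmoothTensorialAt x (fun Z => curvatureField X Y Z x) where
  congr {Z Z'} hZ h := by
    have e : ∀ W : Π y : M, TangentSpace (𝓡 n) y, ∀ᶠ y in nhds x,
        leviCivita n M Z' y (W y) = leviCivita n M Z y (W y) := by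
      intro W
      filter_upwards [h.eventually_nhds, hZ.eventually_diffFieldAt] with y hy hy'
      rw [leviCivita_congr hy' hy]
    simp only [curvatureField]
    rw [leviCivita_congr (F.smoothFieldAt_leviCivita hx hX hZ).diffFieldAt (e X),
      leviCivita_congr (F.smoothFieldAt_leviCivita hx hY hZ).diffFieldAt (e Y),
      leviCivita_congr hZ.diffFieldAt h]
  add {Z Z'} hZ hZ' := by
    have e : ∀ {W : Π y : M, TangentSpace (𝓡 n) y}, SmoothFieldAt W x →
        leviCivita n M (fun y => leviCivita n M (Z + Z') y (W y)) x
          = leviCivita n M (fun y => leviCivita n M Z y (W y)) x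
            + leviCivita n M (fun y => leviCivita n M Z' y (W y)) x := by
      intro W hW
      rw [← leviCivita_add (F.smoothFieldAt_leviCivita hx hW hZ).diffFieldAt
        (F.smoothFieldAt_leviCivita hx hW hZ').diffFieldAt]
      refine leviCivita_congr ((F.smoothFieldAt_leviCivita hx hW hZ).add
        (F.smoothFieldAt_leviCivita hx hW hZ')).diffFieldAt ?_
      filter_upwards [hZ.eventually_diffFieldAt, hZ'.eventually_diffFieldAt] with y h1 h2
      rw [leviCivita_add h1 h2]
      rfl
    simp only [curvatureField]
    rw [e hX, e hY, leviCivita_add hZ.diffFieldAt hZ'.diffFieldAt]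
    simp only [add_apply]
    abel
  smul {f Z} hf hZ := by
    -- In the second derivative of `fZ`, the mixed first-order terms are symmetric in the two
    -- directions and cancel. What remains is `(X(Yf) - Y(Xf) - [X,Y]f) Z = 0`.
    have e : ∀ {W : Π y : M, TangentSpace (𝓡 n) y}, SmoothFieldAt W x →
        ∀ u, leviCivita n M (fun y => leviCivita n M (f • Z) y (W y)) x u
          = f x • leviCivita n M (fun y => leviCivita n M Z y (W y)) x u
            + mvfderiv (𝓡 n) f x u • leviCivita n M Z x (W x)
            + (mvfderiv (𝓡 n) f x (W x) • leviCivita n M Z x u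
            + mvfderiv (𝓡 n) (fun y => mvfderiv (𝓡 n) f y (W y)) x u • Z x) := by
      intro W hW u
      have h1 := F.smoothFieldAt_leviCivita hx hW hZ
      have h2 := SmoothFnAt.mvfderiv_apply hf hW
      rw [leviCivita_congr (Y := f • (fun y => leviCivita n M Z y (W y))
          + (fun y => mvfderiv (𝓡 n) f y (W y)) • Z)
          ((SmoothFieldAt.smul hf h1).add (SmoothFieldAt.smul h2 hZ)).diffFieldAt,
        leviCivita_add (SmoothFieldAt.smul hf h1).diffFieldAt
          (SmoothFieldAt.smul h2 hZ).diffFieldAt, add_apply,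
        leviCivita_smul hf.mdifferentiableAt h1.diffFieldAt,
        leviCivita_smul h2.mdifferentiableAt hZ.diffFieldAt]
      filter_upwards [hZ.eventually_diffFieldAt, SmoothFnAt.eventually_mdifferentiableAt hf]
        with y h1 h2
      rw [leviCivita_smul h2 h1]
      rfl
    simp only [curvatureField]
    rw [e hX, e hY, leviCivita_smul hf.mdifferentiableAt hZ.diffFieldAt,
      mvfderiv_mlieBracket hf hX hY]
    simp only [smul_sub, sub_smul]
    abel

/-- Tensoriality removes the arbitrary extensions in the definition of the curvature: they are
replaced, one slot at a time, by the fields of a frame. -/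
theorem riemannCurvature_eq_sum (u v w : TangentSpace (𝓡 n) x) :
    riemannCurvature x u v w = ∑ k, ∑ l, ∑ j,
      (inner ℝ (s k x) u * inner ℝ (s l x) v * inner ℝ (s j x) w : ℝ)
        • curvatureField (s k) (s l) (s j) x := by
  rw [riemannCurvature_eq,
    (isSmoothTensorialAt_curvatureField_left F hx
      (smoothFieldAt_extend w)).eq_sum F hx (smoothFieldAt_extend u)]
  refine Finset.sum_congr rfl fun k _ => ?_
  rw [(isSmoothTensorialAt_curvatureField_mid F hx
      (smoothFieldAt_extend w)).eq_sum F hx (smoothFieldAt_extend v), Finset.smul_sum]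
  refine Finset.sum_congr rfl fun l _ => ?_
  rw [(isSmoothTensorialAt_curvatureField_right F hx (F.smooth k x hx)
      (F.smooth l x hx)).eq_sum F hx (smoothFieldAt_extend w), Finset.smul_sum, Finset.smul_sum]
  refine Finset.sum_congr rfl fun j _ => ?_
  simp only [FiberBundle.extend_apply_self, smul_smul, mul_assoc]

end

/-- The matrix `(g(s_i, ∇_u s_j))_ij` of the connection form in the frame `s`. -/
noncomputable def connectionMatrix (s : Fin n → Π y : M, TangentSpace (𝓡 n) y) (x : M) :
    TangentSpace (𝓡 n) x →ₗ[ℝ] Matrix (Fin n) (Fin n) ℝ where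
  toFun u := Matrix.of fun i j => inner ℝ (s i x) (leviCivita n M (s j) x u)
  map_add' u v := by ext i j; simp [inner_add_right]
  map_smul' c u := by ext i j; simp [real_inner_smul_right]

theorem connectionMatrix_apply (s : Fin n → Π y : M, TangentSpace (𝓡 n) y) (x : M)
    (u : TangentSpace (𝓡 n) x) (i j : Fin n) :
    connectionMatrix s x u i j = inner ℝ (s i x) (leviCivita n M (s j) x u) := rfl

namespace IsOrthoFrameOn

variable {s : Fin n → Π y : M, TangentSpace (𝓡 n) y} {U : Set M} (F : IsOrthoFrameOn s U) {x : M}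
  (hx : x ∈ U)

include F hx

/-- Differentiate the constants `g(s_i, s_j)`. -/
theorem connectionMatrix_skew (u : TangentSpace (𝓡 n) x) (i j : Fin n) :
    connectionMatrix s x u i j = - connectionMatrix s x u j i := by
  have h := mvfderiv_inner (F.smooth i x hx).diffFieldAt (F.smooth j x hx).diffFieldAt u
  have e : (fun y => (inner ℝ (s i y) (s j y) : ℝ)) =ᶠ[nhds x]
      fun _ => if i = j then 1 else 0 := by
    filter_upwards [F.eventually_mem hx] with y hy
    exact F.inner_eq hy i j
  have e' : mvfderiv (𝓡 n) (fun y => (inner ℝ (s i y) (s j y) : ℝ)) x u = 0 := by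
    have h1 : mfderiv (𝓡 n) 𝓘(ℝ, ℝ) (fun y => (inner ℝ (s i y) (s j y) : ℝ)) x
        = mfderiv (𝓡 n) 𝓘(ℝ, ℝ) (fun _ : M => if i = j then (1 : ℝ) else 0) x := e.mfderiv_eq
    have h2 := mvfderiv_const (I := 𝓡 n) (if i = j then (1 : ℝ) else 0) (x := x)
    have h3 : mvfderiv (𝓡 n) (fun y => (inner ℝ (s i y) (s j y) : ℝ)) x
        = mvfderiv (𝓡 n) (fun _ : M => if i = j then (1 : ℝ) else 0) x := by
      unfold mvfderiv
      rw [e.self_of_nhds, h1]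
    rw [h3, h2]
    rfl
  rw [e', real_inner_comm] at h
  simp only [connectionMatrix_apply]
  linarith

theorem smoothFnAt_connectionMatrix {X : Π y : M, TangentSpace (𝓡 n) y} (hX : SmoothFieldAt X x)
    (i j : Fin n) : SmoothFnAt (n := n) (fun y => connectionMatrix s y (X y) i j) x :=
  (F.smooth i x hx).inner (F.smoothFieldAt_leviCivita hx hX (F.smooth j x hx))

/-- Differentiating `g(s_a, ∇_{s_l} s_b)` along `s_k` gives the wanted term plus `g(∇_{s_k} s_a,
∇_{s_l} s_b)`. Skewness of the connection matrix turns the latter into minus a matrix product. -/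
theorem inner_leviCivita_leviCivita (k l a b : Fin n) :
    inner ℝ (s a x) (leviCivita n M (fun y => leviCivita n M (s b) y (s l y)) x (s k x))
      = mvfderiv (𝓡 n) (fun y => connectionMatrix s y (s l y) a b) x (s k x)
        + ∑ c, connectionMatrix s x (s k x) a c * connectionMatrix s x (s l x) c b := by
  have h := mvfderiv_inner (F.smooth a x hx).diffFieldAt
    (F.smoothFieldAt_leviCivita hx (F.smooth l x hx) (F.smooth b x hx)).diffFieldAt (s k x)
  rw [← F.sum_inner_mul_inner hx (leviCivita n M (s a) x (s k x))] at h
  have e : ∑ c, connectionMatrix s x (s k x) a c * connectionMatrix s x (s l x) c b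
      = - ∑ c, (inner ℝ (s c x) (leviCivita n M (s a) x (s k x)) : ℝ)
        * inner ℝ (s c x) (leviCivita n M (s b) x (s l x)) := by
    rw [← Finset.sum_neg_distrib]
    refine Finset.sum_congr rfl fun c _ => ?_
    rw [F.connectionMatrix_skew hx _ a c]
    simp only [connectionMatrix_apply]
    ring
  rw [e]
  simp only [connectionMatrix_apply]
  linarith

theorem inner_mlieBracket (k l m : Fin n) :
    inner ℝ (s m x) (mlieBracket (𝓡 n) (s k) (s l) x)
      = connectionMatrix s x (s k x) m l - connectionMatrix s x (s l x) m k := by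
  rw [leviCivita_sub_swap (F.smooth k x hx).diffFieldAt (F.smooth l x hx).diffFieldAt,
    inner_sub_right]
  rfl

/-- Cartan's second structure equation evaluated on frame vectors. The middle sum is the connection
form on `[s_k, s_l]`, expanded by means of vanishing torsion. -/
theorem inner_curvatureField (k l a b : Fin n) :
    inner ℝ (s a x) (curvatureField (s k) (s l) (s b) x)
      = mvfderiv (𝓡 n) (fun y => connectionMatrix s y (s l y) a b) x (s k x)
        - mvfderiv (𝓡 n) (fun y => connectionMatrix s y (s k y) a b) x (s l x)
        - ∑ m, (connectionMatrix s x (s k x) m l - connectionMatrix s x (s l x) m k)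
            * connectionMatrix s x (s m x) a b
        + (connectionMatrix s x (s k x) * connectionMatrix s x (s l x)
            - connectionMatrix s x (s l x) * connectionMatrix s x (s k x)) a b := by
  have h : inner ℝ (s a x) (leviCivita n M (s b) x (mlieBracket (𝓡 n) (s k) (s l) x))
      = ∑ m, (connectionMatrix s x (s k x) m l - connectionMatrix s x (s l x) m k)
            * connectionMatrix s x (s m x) a b := by
    conv_lhs => rw [← F.sum_inner_smul hx (mlieBracket (𝓡 n) (s k) (s l) x)]
    simp only [map_sum, map_smul, inner_sum, real_inner_smul_right, F.inner_mlieBracket hx]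
    rfl
  rw [curvatureField, inner_sub_right, inner_sub_right, h, F.inner_leviCivita_leviCivita hx,
    F.inner_leviCivita_leviCivita hx, Matrix.sub_apply, Matrix.mul_apply, Matrix.mul_apply]
  ring

end IsOrthoFrameOn

end Frames

/-! ### The splitting into `𝔤` and its orthogonal complement, and its invariance under `G` and under
brackets with `𝔤`. -/

section StructureGroupAlgebra

variable {n : ℕ}

theorem traceForm_apply (A B : Matrix (Fin n) (Fin n) ℝ) :
    traceForm n A B = (A.transpose * B).trace := rfl

theorem traceForm_comm (A B : Matrix (Fin n) (Fin n) ℝ) : traceForm n A B = traceForm n B A := by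
  rw [traceForm_apply, traceForm_apply, ← Matrix.trace_transpose, Matrix.transpose_mul,
    Matrix.transpose_transpose]

theorem eq_zero_of_traceForm_self {A : Matrix (Fin n) (Fin n) ℝ} (h : traceForm n A A = 0) :
    A = 0 := by
  have h : (A.conjTranspose * A).trace = 0 := by
    simpa [traceForm, Matrix.conjTranspose_eq_transpose_of_trivial] using h
  exact Matrix.trace_conjTranspose_mul_self_eq_zero_iff.mp h

theorem transpose_mul_self_of_specialOrthogonal (a : Matrix.specialOrthogonalGroup (Fin n) ℝ) :
    (a : Matrix (Fin n) (Fin n) ℝ).transpose * (a : Matrix (Fin n) (Fin n) ℝ) = 1 := by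
  have h := (Matrix.mem_specialOrthogonalGroup_iff.mp a.2).1
  have h2 := (Matrix.mem_orthogonalGroup_iff' (Fin n) ℝ).mp h
  simpa [Matrix.star_eq_conjTranspose, Matrix.conjTranspose_eq_transpose_of_trivial] using! h2

theorem mul_transpose_self_of_specialOrthogonal (a : Matrix.specialOrthogonalGroup (Fin n) ℝ) :
    (a : Matrix (Fin n) (Fin n) ℝ) * (a : Matrix (Fin n) (Fin n) ℝ).transpose = 1 :=
  mul_eq_one_comm.mp (transpose_mul_self_of_specialOrthogonal a)

theorem coe_inv_specialOrthogonal (a : Matrix.specialOrthogonalGroup (Fin n) ℝ) :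
    ((a⁻¹ : Matrix.specialOrthogonalGroup (Fin n) ℝ) : Matrix (Fin n) (Fin n) ℝ)
      = (a : Matrix (Fin n) (Fin n) ℝ).transpose := by
  have h : ((a⁻¹ * a : Matrix.specialOrthogonalGroup (Fin n) ℝ) : Matrix (Fin n) (Fin n) ℝ) = 1 := by
    rw [inv_mul_cancel]
    rfl
  rw [Submonoid.coe_mul] at h
  calc _ = ((a⁻¹ : Matrix.specialOrthogonalGroup (Fin n) ℝ) : Matrix (Fin n) (Fin n) ℝ)
        * ((a : Matrix (Fin n) (Fin n) ℝ) * (a : Matrix (Fin n) (Fin n) ℝ).transpose) := by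
        rw [mul_transpose_self_of_specialOrthogonal, mul_one]
    _ = _ := by rw [← mul_assoc, h, one_mul]

/-- Entrywise derivative of a product of matrices. -/
theorem hasDerivAt_matrix_mul {f g : ℝ → Matrix (Fin n) (Fin n) ℝ}
    {f' g' : Matrix (Fin n) (Fin n) ℝ} {t : ℝ}
    (hf : ∀ i j, HasDerivAt (fun s => f s i j) (f' i j) t)
    (hg : ∀ i j, HasDerivAt (fun s => g s i j) (g' i j) t) (i j : Fin n) :
    HasDerivAt (fun s => (f s * g s) i j) ((f' * g t + f t * g') i j) t := by
  have h := HasDerivAt.fun_sum (u := Finset.univ) (fun k _ => (hf i k).fun_mul (hg k j))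
  simpa [Matrix.mul_apply, Finset.sum_add_distrib] using h

theorem hasDerivAt_traceForm (A : Matrix (Fin n) (Fin n) ℝ) {g : ℝ → Matrix (Fin n) (Fin n) ℝ}
    {g' : Matrix (Fin n) (Fin n) ℝ} {t : ℝ}
    (hg : ∀ i j, HasDerivAt (fun s => g s i j) (g' i j) t) :
    HasDerivAt (fun s => traceForm n A (g s)) (traceForm n A g') t := by
  have h := HasDerivAt.fun_sum (u := Finset.univ) (fun k _ =>
    hasDerivAt_matrix_mul (f := fun _ => A.transpose) (f' := 0) (t := t)
      (fun i j => by simpa using hasDerivAt_const t _) hg k k)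
  simpa [traceForm_apply, Matrix.trace] using h

variable {G : Subgroup (Matrix.specialOrthogonalGroup (Fin n) ℝ)}

/-- Differentiate `γᵀ γ = 1` at `0`. -/
theorem transpose_of_mem_lieAlgebraOf {A : Matrix (Fin n) (Fin n) ℝ} (hA : A ∈ lieAlgebraOf G) :
    A.transpose = -A := by
  obtain ⟨γ, -, h0, hγ⟩ := hA
  have h1 : ∀ i j, HasDerivAt (fun t => ((γ t : Matrix (Fin n) (Fin n) ℝ).transpose) i j)
      (A.transpose i j) 0 := fun i j => hγ j i
  ext i j
  have h2 := hasDerivAt_matrix_mul h1 hγ i j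
  simp only [transpose_mul_self_of_specialOrthogonal, h0, OneMemClass.coe_one,
    Matrix.transpose_one, one_mul, mul_one] at h2
  have h3 := h2.unique (hasDerivAt_const (0 : ℝ) ((1 : Matrix (Fin n) (Fin n) ℝ) i j))
  rw [Matrix.add_apply] at h3
  rw [Matrix.neg_apply]
  linarith

theorem conj_mem_lieAlgebraOf {A : Matrix (Fin n) (Fin n) ℝ} (hA : A ∈ lieAlgebraOf G)
    {a : Matrix.specialOrthogonalGroup (Fin n) ℝ} (ha : a ∈ G) :
    (a : Matrix (Fin n) (Fin n) ℝ) * A * (a : Matrix (Fin n) (Fin n) ℝ).transpose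
      ∈ lieAlgebraOf G := by
  obtain ⟨γ, hγG, h0, hγ⟩ := hA
  refine ⟨fun t => a * γ t * a⁻¹, fun t => G.mul_mem (G.mul_mem ha (hγG t)) (G.inv_mem ha),
    by simp [h0], fun i j => ?_⟩
  have h1 := hasDerivAt_matrix_mul (f := fun _ => (a : Matrix (Fin n) (Fin n) ℝ)) (f' := 0)
    (t := 0) (fun i j => by simpa using hasDerivAt_const (0 : ℝ) _) hγ
  have h2 := hasDerivAt_matrix_mul (g := fun _ => (a : Matrix (Fin n) (Fin n) ℝ).transpose)
    (g' := 0) h1 (fun i j => by simpa using hasDerivAt_const (0 : ℝ) _) i j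
  simpa [coe_inv_specialOrthogonal] using h2

theorem liePart_mem (A : Matrix (Fin n) (Fin n) ℝ) : liePart G A ∈ lieAlgebraOf G :=
  Submodule.projection_apply_mem _ _

theorem liePart_add_lieOrthPart (A : Matrix (Fin n) (Fin n) ℝ) :
    liePart G A + lieOrthPart G A = A := by
  simp [lieOrthPart]

theorem lieOrthPart_mem (A : Matrix (Fin n) (Fin n) ℝ) :
    lieOrthPart G A ∈ (traceForm n).orthogonal (lieAlgebraOf G) :=
  Submodule.sub_projection_mem _ A

theorem liePart_of_mem {A : Matrix (Fin n) (Fin n) ℝ} (hA : A ∈ lieAlgebraOf G) :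
    liePart G A = A :=
  Submodule.projection_apply_of_mem_left _ hA

theorem liePart_of_mem_orthogonal {A : Matrix (Fin n) (Fin n) ℝ}
    (hA : A ∈ (traceForm n).orthogonal (lieAlgebraOf G)) : liePart G A = 0 :=
  (Submodule.projection_apply_eq_zero_iff _).mpr hA

theorem lieOrthPart_of_mem {A : Matrix (Fin n) (Fin n) ℝ} (hA : A ∈ lieAlgebraOf G) :
    lieOrthPart G A = 0 := by
  simp [lieOrthPart, liePart_of_mem hA]

theorem lieOrthPart_of_mem_orthogonal {A : Matrix (Fin n) (Fin n) ℝ}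
    (hA : A ∈ (traceForm n).orthogonal (lieAlgebraOf G)) : lieOrthPart G A = A := by
  simp [lieOrthPart, liePart_of_mem_orthogonal hA]

/-- Definiteness of the trace form gives `𝔤^⊥⊥ = 𝔤`. Membership in `𝔤` thus becomes a family of
linear equations, which survive differentiation. -/
theorem mem_lieAlgebraOf_of_forall {A : Matrix (Fin n) (Fin n) ℝ}
    (h : ∀ B ∈ (traceForm n).orthogonal (lieAlgebraOf G), traceForm n B A = 0) :
    A ∈ lieAlgebraOf G := by
  have h1 := h _ (lieOrthPart_mem A)
  have h2 : traceForm n (lieOrthPart G A) (liePart G A) = 0 := by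
    rw [traceForm_comm]
    exact lieOrthPart_mem A _ (liePart_mem A)
  rw [← liePart_add_lieOrthPart (G := G) A] at h1
  rw [map_add (traceForm n _), liePart_add_lieOrthPart, h2, zero_add] at h1
  have h3 := eq_zero_of_traceForm_self h1
  rw [← liePart_add_lieOrthPart (G := G) A, h3, add_zero]
  exact liePart_mem A

/-- For a curve `γ` in `G` with velocity `A`, the curve `γ B γᵀ` stays in `𝔤`, and its velocity at
`0` is `[A, B]`. Pairing with any `D` in the orthogonal complement gives the zero function, whose
derivative vanishes. No exponential map enters. -/
theorem bracket_mem_lieAlgebraOf {A B : Matrix (Fin n) (Fin n) ℝ} (hA : A ∈ lieAlgebraOf G)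
    (hB : B ∈ lieAlgebraOf G) : A * B - B * A ∈ lieAlgebraOf G := by
  have hA' := transpose_of_mem_lieAlgebraOf hA
  refine mem_lieAlgebraOf_of_forall fun D hD => ?_
  obtain ⟨γ, hγG, h0, hγ⟩ := hA
  have h1 := hasDerivAt_matrix_mul (g := fun _ => B) (g' := 0) hγ
    (fun i j => by simpa using hasDerivAt_const (0 : ℝ) _)
  have h2 := hasDerivAt_matrix_mul
    (g := fun t => (γ t : Matrix (Fin n) (Fin n) ℝ).transpose) (g' := A.transpose) h1
    (fun i j => hγ j i)
  have h3 := hasDerivAt_traceForm D h2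
  have h4 : (fun t => traceForm n D ((γ t : Matrix (Fin n) (Fin n) ℝ) * B
      * (γ t : Matrix (Fin n) (Fin n) ℝ).transpose)) = fun _ => 0 := by
    ext1 t
    rw [traceForm_comm]
    exact hD _ (conj_mem_lieAlgebraOf hB (hγG t))
  rw [h4] at h3
  have h5 := h3.unique (hasDerivAt_const (0 : ℝ) (0 : ℝ))
  rw [← h5]
  congr 1
  simp [h0, hA', sub_eq_add_neg]

/-- The trace form is `ad`-invariant on skew matrices, so `⟨D, [B, A]⟩ = ⟨[D, B], A⟩`, and `[D, B]`
lies in `𝔤`. -/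
theorem bracket_mem_orthogonal {A B : Matrix (Fin n) (Fin n) ℝ} (hB : B ∈ lieAlgebraOf G)
    (hA : A ∈ (traceForm n).orthogonal (lieAlgebraOf G)) :
    B * A - A * B ∈ (traceForm n).orthogonal (lieAlgebraOf G) := by
  intro D hD
  have h := hA _ (bracket_mem_lieAlgebraOf hD hB)
  show traceForm n D (B * A - A * B) = 0
  have h' : traceForm n (D * B - B * D) A = 0 := h
  rw [← h', traceForm_apply, traceForm_apply, Matrix.transpose_sub, Matrix.transpose_mul,
    Matrix.transpose_mul, transpose_of_mem_lieAlgebraOf hD, transpose_of_mem_lieAlgebraOf hB]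
  simp only [Matrix.mul_sub, Matrix.sub_mul, Matrix.neg_mul, Matrix.mul_neg, neg_neg,
    Matrix.trace_sub, Matrix.trace_neg]
  rw [← Matrix.mul_assoc D A B, Matrix.trace_mul_comm (D * A) B]
  simp only [Matrix.mul_assoc]
  ring

/-- Conjugation by elements of `G` preserves `𝔤` and is an isometry of the trace form. It therefore
preserves the complement too and commutes with the projection. -/
theorem liePart_conj (A : Matrix (Fin n) (Fin n) ℝ)
    {a : Matrix.specialOrthogonalGroup (Fin n) ℝ} (ha : a ∈ G) :
    liePart G ((a : Matrix (Fin n) (Fin n) ℝ).transpose * A * (a : Matrix (Fin n) (Fin n) ℝ))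
      = (a : Matrix (Fin n) (Fin n) ℝ).transpose * liePart G A
        * (a : Matrix (Fin n) (Fin n) ℝ) := by
  have h1 := conj_mem_lieAlgebraOf (liePart_mem (G := G) A) (G.inv_mem ha)
  rw [coe_inv_specialOrthogonal, Matrix.transpose_transpose] at h1
  have h2 : (a : Matrix (Fin n) (Fin n) ℝ).transpose * lieOrthPart G A
      * (a : Matrix (Fin n) (Fin n) ℝ) ∈ (traceForm n).orthogonal (lieAlgebraOf G) := by
    intro D hD
    have h := lieOrthPart_mem A _ (conj_mem_lieAlgebraOf hD ha)
    show traceForm n D _ = 0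
    rw [← show traceForm n _ _ = 0 from h, traceForm_apply, traceForm_apply,
      ← Matrix.mul_assoc, Matrix.trace_mul_comm]
    simp [Matrix.mul_assoc]
  conv_lhs => rw [← liePart_add_lieOrthPart (G := G) A]
  rw [Matrix.mul_add, Matrix.add_mul, map_add, liePart_of_mem h1, liePart_of_mem_orthogonal h2,
    add_zero]

theorem liePart_skew {A : Matrix (Fin n) (Fin n) ℝ} (i j : Fin n) :
    liePart G A i j = - liePart G A j i := by
  have h := transpose_of_mem_lieAlgebraOf (liePart_mem (G := G) A)
  have := congr_fun (congr_fun h j) i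
  simpa using this

/-- The complement is taken among all matrices and so contains the symmetric ones. On skew input the
projection stays within `𝔰𝔬(n)`, because `𝔤` consists of skew matrices. -/
theorem lieOrthPart_skew {A : Matrix (Fin n) (Fin n) ℝ} (hA : ∀ i j, A i j = - A j i)
    (i j : Fin n) : lieOrthPart G A i j = - lieOrthPart G A j i := by
  simp only [lieOrthPart, LinearMap.sub_apply, LinearMap.id_apply, Matrix.sub_apply]
  rw [hA i j, liePart_skew i j]
  ring

end StructureGroupAlgebra

/-! ### The connection `∇^G` and the intrinsic torsion in an arbitrary section of `P`. -/

section TorsionInFrame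

variable {n : ℕ} {M : Type*} [TopologicalSpace M] [ChartedSpace (EuclideanSpace ℝ (Fin n)) M]

/-- A straight line in the chart. It turns derivatives on `M` into one-variable ones, as required by
the description of `𝔤` through velocities, and later by Jacobi's formula for determinants. -/
theorem exists_curve (x : M) (u : TangentSpace (𝓡 n) x) :
    ∃ c : ℝ → M, c 0 = x ∧ ContinuousAt c 0 ∧ ∀ f : M → ℝ,
      MDifferentiableAt (𝓡 n) 𝓘(ℝ, ℝ) f x →
        HasDerivAt (fun t => f (c t)) (mvfderiv (𝓡 n) f x u) 0 := by
  let u' : EuclideanSpace ℝ (Fin n) := u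
  have hl : HasDerivAt (fun t : ℝ => extChartAt (𝓡 n) x x + t • u') u' 0 := by
    simpa using ((hasDerivAt_id (0 : ℝ)).smul_const u').const_add (extChartAt (𝓡 n) x x)
  refine ⟨fun t => (extChartAt (𝓡 n) x).symm (extChartAt (𝓡 n) x x + t • u'), by simp, ?_, ?_⟩
  · refine ContinuousAt.comp (g := (extChartAt (𝓡 n) x).symm) ?_ hl.continuousAt
    simpa using continuousAt_extChartAt_symm (I := 𝓡 n) x
  · intro f hf
    rw [hf.mvfderiv]
    have h := hf.differentiableWithinAt_writtenInExtChartAt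
    simp only [ModelWithCorners.range_eq_univ] at h ⊢
    let w : EuclideanSpace ℝ (Fin n) → ℝ := writtenInExtChartAt (𝓡 n) 𝓘(ℝ, ℝ) x f
    have hw : HasFDerivAt w (fderivWithin ℝ w Set.univ (extChartAt (𝓡 n) x x))
        (extChartAt (𝓡 n) x x + (0 : ℝ) • u') := by
      rw [zero_smul, add_zero]
      exact h.hasFDerivWithinAt.hasFDerivAt (by simp)
    exact hw.comp_hasDerivAt (0 : ℝ) hl

/-- The Maurer-Cartan form `a⁻¹ da` of a `G`-valued map has values in `𝔤`: along a curve `c`, it is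
the velocity of `a(x)⁻¹ a(c(t))`, which passes through `1`. -/
theorem transpose_mul_mvfderiv_mem_lieAlgebraOf
    {G : Subgroup (Matrix.specialOrthogonalGroup (Fin n) ℝ)} {x : M}
    {a : M → Matrix (Fin n) (Fin n) ℝ}
    (ha : ∀ᶠ y in nhds x, ∃ b ∈ G, (b : Matrix (Fin n) (Fin n) ℝ) = a y)
    (hd : ∀ i j, MDifferentiableAt (𝓡 n) 𝓘(ℝ, ℝ) (fun y => a y i j) x)
    (u : TangentSpace (𝓡 n) x) :
    (a x).transpose * Matrix.of (fun i j => mvfderiv (𝓡 n) (fun y => a y i j) x u)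
      ∈ lieAlgebraOf G := by
  classical
  obtain ⟨c, hc0, hc, hcd⟩ := exists_curve x u
  have hg : ∃ g : M → Matrix.specialOrthogonalGroup (Fin n) ℝ, (∀ y, g y ∈ G) ∧
      ∀ᶠ y in nhds x, (g y : Matrix (Fin n) (Fin n) ℝ) = a y := by
    -- The map `a` is `G`-valued only near `x`, while the definition of `𝔤` asks for curves in `G`
    -- at all times. The default value `1` elsewhere does not affect the derivative.
    refine ⟨fun y => if h : ∃ b ∈ G, (b : Matrix (Fin n) (Fin n) ℝ) = a y then h.choose else 1,
      fun y => ?_, ?_⟩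
    · by_cases h : ∃ b ∈ G, (b : Matrix (Fin n) (Fin n) ℝ) = a y
      · simp only [h, dif_pos]; exact h.choose_spec.1
      · simp only [h, not_false_eq_true, dif_neg]; exact G.one_mem
    · filter_upwards [ha] with y h
      simp only [h, dif_pos]
      exact h.choose_spec.2
  obtain ⟨g, hgG, hga⟩ := hg
  refine ⟨fun t => (g x)⁻¹ * g (c t), fun t => G.mul_mem (G.inv_mem (hgG x)) (hgG _),
    by simp [hc0], fun i j => ?_⟩
  have h1 : ∀ i j, HasDerivAt (fun t => (g (c t) : Matrix (Fin n) (Fin n) ℝ) i j)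
      (mvfderiv (𝓡 n) (fun y => a y i j) x u) 0 := by
    intro i j
    refine (hcd _ (hd i j)).congr_of_eventuallyEq ?_
    have : Filter.Tendsto c (nhds 0) (nhds x) := by simpa [ContinuousAt, hc0] using hc
    filter_upwards [this.eventually hga] with t ht
    rw [ht]
  have h2 := hasDerivAt_matrix_mul (f := fun _ => (a x).transpose) (f' := 0) (t := 0)
    (g' := Matrix.of fun i j => mvfderiv (𝓡 n) (fun y => a y i j) x u)
    (fun i j => by simpa using hasDerivAt_const (0 : ℝ) _) h1 i j
  simpa [coe_inv_specialOrthogonal, hga.self_of_nhds] using h2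

variable [IsManifold (𝓡 n) ∞ M] [RiemannianBundle (fun x : M => TangentSpace (𝓡 n) x)]
  {o : TangentOrientation n M} {G : Subgroup (Matrix.specialOrthogonalGroup (Fin n) ℝ)}
  (P : GStructure o G)

theorem GStructure.isOrthoFrameOn_localFrame (x : M) :
    IsOrthoFrameOn (P.localFrame x) (P.nhd x) where
  isOpen := P.isOpen_nhd x
  smooth i _ hy := (P.contMDiffOn_localFrame x i).contMDiffAt ((P.isOpen_nhd x).mem_nhds hy)
  orthonormal y hy := P.orthonormal y _ (P.localFrame_mem x y hy)

variable [IsContMDiffRiemannianBundle (𝓡 n) ∞ (EuclideanSpace ℝ (Fin n))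
    (fun x : M => TangentSpace (𝓡 n) x)]
  {s : Fin n → Π y : M, TangentSpace (𝓡 n) y} {U : Set M} (F : IsOrthoFrameOn s U)
  (hs : ∀ y ∈ U, (fun i => s i y) ∈ P.frames y) {x : M} (hx : x ∈ U)

include F hs hx

/-- The defining formula of `∇^G` at `x` uses the section `t = P.localFrame x`, and here `s` is any
other section of `P`. They differ by a `G`-valued `a`, and both `a⁻¹ da ∈ 𝔤` and
`Ad(G)`-equivariance of the projection are needed. -/
theorem GStructure.inner_connection_frame (u : TangentSpace (𝓡 n) x) (i j : Fin n) :
    inner ℝ (s i x) (P.connection (s j) x u) = liePart G (connectionMatrix s x u) i j := by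
  set t := P.localFrame x with ht
  have T := P.isOrthoFrameOn_localFrame x
  have hxt := P.mem_nhd x
  let a : M → Matrix (Fin n) (Fin n) ℝ := fun y => Matrix.of fun i j => inner ℝ (t i y) (s j y)
  let da : Matrix (Fin n) (Fin n) ℝ := Matrix.of fun i j => mvfderiv (𝓡 n) (fun y => a y i j) x u
  have hmem : ∀ᶠ y in nhds x, ∃ b ∈ G, (b : Matrix (Fin n) (Fin n) ℝ) = a y := by
    filter_upwards [F.eventually_mem hx, T.eventually_mem hxt] with y hyU hyV
    obtain ⟨b, hb, hb'⟩ := (P.mem_frames_iff y _ (P.localFrame_mem x y hyV) _).mp (hs y hyU)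
    refine ⟨b, hb, ?_⟩
    ext i j
    simp only [a, Matrix.of_apply, hb' j, inner_sum, real_inner_smul_right]
    simp [t, T.inner_eq hyV]
  have hda : (a x).transpose * da ∈ lieAlgebraOf G :=
    transpose_mul_mvfderiv_mem_lieAlgebraOf hmem (fun i j =>
      mdiffAt_inner (T.smooth i x hxt).diffFieldAt (F.smooth j x hx).diffFieldAt) u
  obtain ⟨b, hb, hba⟩ := hmem.self_of_nhds
  -- Metric compatibility applied to `a_ij = g(t_i, s_j)`; the minus sign is the skewness of the
  -- connection matrix of `t`.
  have hd : da = a x * connectionMatrix s x u - connectionMatrix t x u * a x := by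
    ext i j
    simp only [da, a, Matrix.of_apply, Matrix.sub_apply, Matrix.mul_apply]
    rw [mvfderiv_inner (T.smooth i x hxt).diffFieldAt (F.smooth j x hx).diffFieldAt,
      ← F.sum_inner_mul_inner hx (t i x), ← T.sum_inner_mul_inner hxt _ (s j x),
      add_comm, sub_eq_add_neg, ← Finset.sum_neg_distrib]
    congr 1
    · exact Finset.sum_congr rfl fun k _ => by
        rw [real_inner_comm]; rfl
    · exact Finset.sum_congr rfl fun k _ => by
        rw [T.connectionMatrix_skew hxt u i k, neg_mul, neg_neg]; rfl
  have hbb := transpose_mul_self_of_specialOrthogonal b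
  rw [hba] at hbb
  -- The gauge transformation rule `ω_s = a⁻¹ da + a⁻¹ ω_t a`. Its first summand lies in `𝔤`, so
  -- taking `𝔤`-parts preserves the shape of the rule.
  have hω : connectionMatrix s x u
      = (a x).transpose * da + (a x).transpose * connectionMatrix t x u * a x := by
    rw [hd, Matrix.mul_sub, ← Matrix.mul_assoc, hbb, one_mul, Matrix.mul_assoc,
      sub_add_cancel]
  have hl : liePart G (connectionMatrix s x u)
      = (a x).transpose * (da + liePart G (connectionMatrix t x u) * a x) := by
    have hc := liePart_conj (connectionMatrix t x u) hb
    rw [hba] at hc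
    rw [hω, map_add, liePart_of_mem hda, hc, Matrix.mul_add, Matrix.mul_assoc (a x).transpose]
  have hP : P.connection (s j) x u
      = ∑ k, (da + liePart G (connectionMatrix t x u) * a x) k j • t k x := rfl
  rw [hP, hl]
  simp only [inner_sum, real_inner_smul_right, Matrix.mul_apply, Matrix.transpose_apply]
  refine Finset.sum_congr rfl fun k _ => ?_
  rw [real_inner_comm, mul_comm]
  rfl

/-- In a section of `P`, `∇^G` has matrix `ω_𝔤` and `∇` has matrix `ω`; their difference is `-ω_𝔤⊥`.
-/
theorem GStructure.inner_torsion_frame (u : TangentSpace (𝓡 n) x) (i j : Fin n) :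
    inner ℝ (s i x) (P.torsion x u (s j x)) = - lieOrthPart G (connectionMatrix s x u) i j := by
  have h : P.torsion x u (s j x) = P.connection (s j) x u - leviCivita n M (s j) x u := by
    have := P.connection.isCovariantDerivativeOnUniv.difference_apply
      (leviCivita n M).isCovariantDerivativeOnUniv (x := x) (Set.mem_univ _)
      (F.smooth j x hx).diffFieldAt
    exact congrArg (fun L => L u) this
  rw [h, inner_sub_right, P.inner_connection_frame F hs hx, ← connectionMatrix_apply]
  simp [lieOrthPart]

end TorsionInFrame

/-! ### The index identity among quadratic contractions of the connection matrices. -/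

section TripleSums

variable {n : ℕ}

/-- The algebraic identity behind the divergence formula: `A k` and `B k` are the `𝔤^⊥`- and
`𝔤`-components of the connection form in the direction of the `k`-th frame vector. -/
theorem connection_sum_identity {A B : Fin n → Matrix (Fin n) (Fin n) ℝ}
    (hA : ∀ k i j, A k i j = - A k j i) (hB : ∀ k i j, B k i j = - B k j i) :
    (∑ i, ∑ c, (A i + B i) c i * ∑ k, A k c k)
      = 1 / 2 * (∑ k, ∑ l, ∑ m, ((A k + B k) m l - (A l + B l) m k) * A m k l)
        - 1 / 2 * (∑ k, ∑ l, ((B k * A l - A l * B k) k l + (A k * B l - B l * A k) k l))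
        + ∑ c, (∑ k, A k c k) ^ 2 - ∑ k, ∑ l, ∑ m, A k m l * A l m k := by
  let S : (Fin n → Fin n → Fin n → ℝ) → ℝ := fun f => ∑ k, ∑ l, ∑ m, f k l m
  have S12 : ∀ f, S f = S fun k l m => f l k m := fun f => Finset.sum_comm
  have S23 : ∀ f, S f = S fun k l m => f k m l := fun f =>
    Finset.sum_congr rfl fun k _ => Finset.sum_comm
  have Sadd : ∀ f g, S (fun k l m => f k l m + g k l m) = S f + S g := fun f g => by
    simp only [S, Finset.sum_add_distrib]
  have Sneg : ∀ f, S (fun k l m => - f k l m) = - S f := fun f => by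
    simp only [S, Finset.sum_neg_distrib]
  -- Every sum reduces to these four contractions by renaming indices and skewness. The left side is
  -- `Q + T`; on the right the two halved sums are `W - V` and `T + V`, so the mixed contraction `V`
  -- cancels, as does `W` against the last term.
  let T := S fun k l m => B k m k * A l m l
  let Q := S fun k l m => A k m k * A l m l
  let W := S fun k l m => A k m l * A l m k
  let V := S fun k l m => B k m l * A l k m
  have e1 : (∑ i, ∑ c, (A i + B i) c i * ∑ k, A k c k) = Q + T := by
    rw [← Sadd, S23]
    simp only [S, Matrix.add_apply, Finset.mul_sum, add_mul]
  have e2 : (∑ c, (∑ k, A k c k) ^ 2) = Q := by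
    simp only [Q, S, pow_two, Finset.sum_mul_sum]
    rw [Finset.sum_comm]
    exact Finset.sum_congr rfl fun k _ => Finset.sum_comm
  have e3 : (∑ k, ∑ l, ∑ m, A k m l * A l m k) = W := rfl
  have e4 : S (fun k l m => A k m l * A m k l) = W := by
    rw [S23]
    refine Finset.sum_congr rfl fun k _ => Finset.sum_congr rfl fun l _ =>
      Finset.sum_congr rfl fun m _ => ?_
    beta_reduce
    rw [hA k l m, hA l k m]; ring
  have e5 : S (fun k l m => B k m l * A m k l) = - V := by
    rw [S23, ← Sneg]
    refine Finset.sum_congr rfl fun k _ => Finset.sum_congr rfl fun l _ =>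
      Finset.sum_congr rfl fun m _ => ?_
    beta_reduce
    rw [hB k l m]; ring
  have e6 : (∑ k, ∑ l, ∑ m, ((A k + B k) m l - (A l + B l) m k) * A m k l)
      = 2 * (W - V) := by
    have h1 : (∑ k, ∑ l, ∑ m, ((A k + B k) m l - (A l + B l) m k) * A m k l)
        = S (fun k l m => (A k m l * A m k l + B k m l * A m k l))
          + S (fun k l m => (A l m k * A m l k + B l m k * A m l k)) := by
      rw [← Sadd]
      refine Finset.sum_congr rfl fun k _ => Finset.sum_congr rfl fun l _ =>
        Finset.sum_congr rfl fun m _ => ?_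
      beta_reduce
      rw [hA m l k]
      simp only [Matrix.add_apply]; ring
    rw [h1, S12 (fun k l m => (A l m k * A m l k + B l m k * A m l k)), Sadd, e4, e5]
    ring
  have e7 : (∑ k, ∑ l, ((B k * A l - A l * B k) k l + (A k * B l - B l * A k) k l))
      = 2 * (-T - V) := by
    have h1 : (∑ k, ∑ l, ((B k * A l - A l * B k) k l + (A k * B l - B l * A k) k l))
        = S (fun k l m => B k m k * - A l m l + - (B k m l * A l k m))
          + S (fun k l m => B l m l * - A k m k + - (B l m k * A k l m)) := by
      rw [← Sadd]
      simp only [S, Matrix.sub_apply, Matrix.mul_apply, ← Finset.sum_sub_distrib,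
        ← Finset.sum_add_distrib]
      refine Finset.sum_congr rfl fun k _ => Finset.sum_congr rfl fun l _ =>
        Finset.sum_congr rfl fun m _ => ?_
      rw [hB k k m, hA k k m, hB l k m, hA k m l]; ring
    rw [h1, ← S12 (fun k l m => B k m k * - A l m l + - (B k m l * A l k m)), Sadd, Sneg]
    simp only [mul_neg, Sneg]
    change -T + -V + (-T + -V) = _
    ring
  rw [e1, e2, e3, e6, e7]
  ring

end TripleSums

/-! ### Expressing divergence, curvature and contracted endomorphisms in a frame. -/

section FrameExpressions

open VectorField

/-- Expanding each `s k` in the basis `e` shows that the double contraction may be evaluated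
directly in the frame where the matrices are written. -/
theorem sum_sum_orthPart_aux {n : ℕ} {ι V : Type*} [Fintype ι] [NormedAddCommGroup V]
    [InnerProductSpace ℝ V] (s : OrthonormalBasis (Fin n) ℝ V) (e : OrthonormalBasis ι ℝ V)
    (L : V →ₗ[ℝ] V →ₗ[ℝ] Matrix (Fin n) (Fin n) ℝ) :
    ∑ i, ∑ j, ∑ a, ∑ b, L (e i) (e j) a b * inner ℝ (s b) (e j) * inner ℝ (s a) (e i)
      = ∑ k, ∑ l, L (s k) (s l) k l := by
  have h1 : ∀ k l, L (s k) (s l) k l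
      = ∑ i, ∑ j, L (e i) (e j) k l * inner ℝ (s l) (e j) * inner ℝ (s k) (e i) := by
    intro k l
    conv_lhs => rw [← e.sum_repr' (s k), ← e.sum_repr' (s l)]
    simp only [map_sum, map_smul, LinearMap.sum_apply, LinearMap.smul_apply, Matrix.sum_apply,
      Matrix.smul_apply, smul_eq_mul, Finset.mul_sum]
    rw [Finset.sum_comm]
    refine Finset.sum_congr rfl fun i _ => Finset.sum_congr rfl fun j _ => ?_
    rw [real_inner_comm (s k) (e i), real_inner_comm (s l) (e j)]
    ring
  simp only [h1]
  calc _ = ∑ i, ∑ a, ∑ j, ∑ b, L (e i) (e j) a b * inner ℝ (s b) (e j) * inner ℝ (s a) (e i) :=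
        Finset.sum_congr rfl fun i _ => Finset.sum_comm
    _ = ∑ a, ∑ i, ∑ j, ∑ b, L (e i) (e j) a b * inner ℝ (s b) (e j) * inner ℝ (s a) (e i) :=
        Finset.sum_comm
    _ = ∑ a, ∑ i, ∑ b, ∑ j, L (e i) (e j) a b * inner ℝ (s b) (e j) * inner ℝ (s a) (e i) :=
        Finset.sum_congr rfl fun a _ => Finset.sum_congr rfl fun i _ => Finset.sum_comm
    _ = _ := Finset.sum_congr rfl fun a _ => Finset.sum_comm

variable {n : ℕ} {M : Type*} [TopologicalSpace M] [ChartedSpace (EuclideanSpace ℝ (Fin n)) M]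
  [IsManifold (𝓡 n) ∞ M]

theorem smoothFnAt_finset_sum {ι : Type*} {t : Finset ι} {f : ι → M → ℝ} {x : M}
    (hf : ∀ i ∈ t, SmoothFnAt (n := n) (f i) x) :
    SmoothFnAt (n := n) (fun y => ∑ i ∈ t, f i y) x :=
  ContMDiffAt.sum hf

theorem mvfderiv_finset_sum {ι : Type*} {t : Finset ι} {f : ι → M → ℝ} {x : M}
    (hf : ∀ i ∈ t, SmoothFnAt (n := n) (f i) x) (u : TangentSpace (𝓡 n) x) :
    mvfderiv (𝓡 n) (fun y => ∑ i ∈ t, f i y) x u = ∑ i ∈ t, mvfderiv (𝓡 n) (f i) x u := by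
  obtain ⟨c, -, -, hc⟩ := exists_curve x u
  exact (hc _ (smoothFnAt_finset_sum hf).mdifferentiableAt).unique
    (HasDerivAt.fun_sum fun i hi => hc _ (hf i hi).mdifferentiableAt)

theorem mvfderiv_congr {f g : M → ℝ} {x : M} (h : f =ᶠ[nhds x] g) :
    mvfderiv (𝓡 n) f x = mvfderiv (𝓡 n) g x := by
  have h1 : mfderiv (𝓡 n) 𝓘(ℝ, ℝ) f x = mfderiv (𝓡 n) 𝓘(ℝ, ℝ) g x := h.mfderiv_eq
  unfold mvfderiv
  rw [h.self_of_nhds, h1]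

theorem mvfderiv_const_mul {f : M → ℝ} {x : M} (c : ℝ) (hf : SmoothFnAt (n := n) f x)
    (u : TangentSpace (𝓡 n) x) :
    mvfderiv (𝓡 n) (fun y => c * f y) x u = c * mvfderiv (𝓡 n) f x u := by
  obtain ⟨γ, -, -, hγ⟩ := exists_curve x u
  exact (hγ _ (SmoothFnAt.mdifferentiableAt (contMDiffAt_const.mul hf))).unique
    ((hγ _ hf.mdifferentiableAt).const_mul c)

theorem linearMap_matrix_apply (L : Matrix (Fin n) (Fin n) ℝ →ₗ[ℝ] Matrix (Fin n) (Fin n) ℝ)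
    (A : Matrix (Fin n) (Fin n) ℝ) (i j : Fin n) :
    L A i j = ∑ a, ∑ b, L (Matrix.single a b 1) i j * A a b := by
  conv_lhs => rw [Matrix.matrix_eq_sum_single A]
  simp only [map_sum, Matrix.sum_apply]
  refine Finset.sum_congr rfl fun a _ => Finset.sum_congr rfl fun b _ => ?_
  have : Matrix.single a b (A a b) = A a b • Matrix.single a b (1 : ℝ) := by simp
  rw [this, map_smul, Matrix.smul_apply, smul_eq_mul, mul_comm]

theorem smoothFnAt_linearMap_matrix
    (L : Matrix (Fin n) (Fin n) ℝ →ₗ[ℝ] Matrix (Fin n) (Fin n) ℝ)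
    {a : M → Matrix (Fin n) (Fin n) ℝ} {x : M}
    (ha : ∀ i j, SmoothFnAt (n := n) (fun y => a y i j) x) (i j : Fin n) :
    SmoothFnAt (n := n) (fun y => L (a y) i j) x := by
  rw [show (fun y => L (a y) i j) = _ from funext fun y => linearMap_matrix_apply L (a y) i j]
  exact smoothFnAt_finset_sum fun k _ => smoothFnAt_finset_sum fun l _ =>
    contMDiffAt_const.mul (ha k l)

/-- Applied to the projection onto the `𝔤^⊥`-part, whose coefficients are constant, this lets
differentiation pass through it. -/
theorem mvfderiv_linearMap_matrix
    (L : Matrix (Fin n) (Fin n) ℝ →ₗ[ℝ] Matrix (Fin n) (Fin n) ℝ)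
    {a : M → Matrix (Fin n) (Fin n) ℝ} {x : M}
    (ha : ∀ i j, SmoothFnAt (n := n) (fun y => a y i j) x) (i j : Fin n)
    (u : TangentSpace (𝓡 n) x) :
    mvfderiv (𝓡 n) (fun y => L (a y) i j) x u
      = L (Matrix.of fun k l => mvfderiv (𝓡 n) (fun y => a y k l) x u) i j := by
  rw [show (fun y => L (a y) i j) = _ from funext fun y => linearMap_matrix_apply L (a y) i j,
    linearMap_matrix_apply L (Matrix.of _)]
  have h : ∀ k l, SmoothFnAt (n := n) (fun y => L (Matrix.single k l 1) i j * a y k l) x :=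
    fun k l => contMDiffAt_const.mul (ha k l)
  rw [mvfderiv_finset_sum fun k _ => smoothFnAt_finset_sum fun l _ => h k l]
  refine Finset.sum_congr rfl fun k _ => ?_
  rw [mvfderiv_finset_sum fun l _ => h k l]
  exact Finset.sum_congr rfl fun l _ => mvfderiv_const_mul _ (ha k l) u

variable [RiemannianBundle (fun x : M => TangentSpace (𝓡 n) x)]
  [IsContMDiffRiemannianBundle (𝓡 n) ∞ (EuclideanSpace ℝ (Fin n))
    (fun x : M => TangentSpace (𝓡 n) x)]
  {s : Fin n → Π y : M, TangentSpace (𝓡 n) y} {U : Set M} (F : IsOrthoFrameOn s U) {x : M}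
  (hx : x ∈ U)

include F hx

theorem divergence_eq_sum (X : Π y : M, TangentSpace (𝓡 n) y) :
    divergence X x = ∑ i, inner ℝ (s i x) (leviCivita n M X x (s i x)) := by
  rw [divergence, LinearMap.trace_eq_sum_inner _ (F.basis hx)]
  simp

theorem smoothFnAt_divergence {X : Π y : M, TangentSpace (𝓡 n) y} (hX : SmoothFieldAt X x) :
    SmoothFnAt (n := n) (divergence X) x := by
  have h : SmoothFnAt (n := n)
      (fun y => ∑ i, (inner ℝ (s i y) (leviCivita n M X y (s i y)) : ℝ)) x :=
    smoothFnAt_finset_sum fun i _ => (F.smooth i x hx).inner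
      (F.smoothFieldAt_leviCivita hx (F.smooth i x hx) hX)
  refine ContMDiffAt.congr_of_eventuallyEq h ?_
  filter_upwards [F.eventually_mem hx] with y hy
  exact divergence_eq_sum F hy X

/-- Each summand is `g(s_i, ∇_{s_i} X) = s_i g(s_i, X) - g(∇_{s_i} s_i, X)`. -/
theorem divergence_eq_sum_coeff {X : Π y : M, TangentSpace (𝓡 n) y} (hX : SmoothFieldAt X x) :
    divergence X x = (∑ i, mvfderiv (𝓡 n) (fun y => inner ℝ (s i y) (X y)) x (s i x))
      - ∑ i, ∑ c, connectionMatrix s x (s i x) c i * inner ℝ (s c x) (X x) := by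
  rw [divergence_eq_sum F hx, ← Finset.sum_sub_distrib]
  refine Finset.sum_congr rfl fun i _ => ?_
  rw [mvfderiv_inner (F.smooth i x hx).diffFieldAt hX.diffFieldAt,
    ← F.sum_inner_mul_inner hx (leviCivita n M (s i) x (s i x))]
  simp only [connectionMatrix_apply]
  ring

/-- The Riemann curvature tensor at `x`, as a bilinear map in its first two arguments. -/
theorem exists_linearMap_riemannCurvature :
    ∃ R : TangentSpace (𝓡 n) x →ₗ[ℝ] TangentSpace (𝓡 n) x →ₗ[ℝ]
      (TangentSpace (𝓡 n) x → TangentSpace (𝓡 n) x), ∀ u v, R u v = riemannCurvature x u v := by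
  refine ⟨LinearMap.mk₂ ℝ (riemannCurvature x) ?_ ?_ ?_ ?_, fun u v => rfl⟩
  · intro u u' v
    ext1 w
    simp only [riemannCurvature_eq_sum F hx, Pi.add_apply, inner_add_right, add_mul, add_smul,
      Finset.sum_add_distrib]
  · intro c u v
    ext1 w
    simp only [riemannCurvature_eq_sum F hx, Pi.smul_apply, real_inner_smul_right, mul_assoc,
      mul_smul, Finset.smul_sum]
  · intro u v v'
    ext1 w
    simp only [riemannCurvature_eq_sum F hx, Pi.add_apply, inner_add_right, mul_add, add_mul,
      add_smul, Finset.sum_add_distrib]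
  · intro c u v
    ext1 w
    simp only [riemannCurvature_eq_sum F hx, Pi.smul_apply, real_inner_smul_right, Finset.smul_sum,
      smul_smul]
    refine Finset.sum_congr rfl fun k _ => Finset.sum_congr rfl fun l _ =>
      Finset.sum_congr rfl fun j _ => ?_
    congr 1
    ring

theorem riemannCurvature_frame (k l j : Fin n) :
    riemannCurvature x (s k x) (s l x) (s j x) = curvatureField (s k) (s l) (s j) x := by
  rw [riemannCurvature_eq_sum F hx]
  simp [F.inner_eq hx]

end FrameExpressions

/-! ### The quantities attached to the intrinsic torsion, in a section of `P`. -/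

section PointwiseIdentity

open VectorField

variable {n : ℕ} {M : Type*} [TopologicalSpace M] [ChartedSpace (EuclideanSpace ℝ (Fin n)) M]
  [IsManifold (𝓡 n) ∞ M] [RiemannianBundle (fun x : M => TangentSpace (𝓡 n) x)]
  [IsContMDiffRiemannianBundle (𝓡 n) ∞ (EuclideanSpace ℝ (Fin n))
    (fun x : M => TangentSpace (𝓡 n) x)]
  {o : TangentOrientation n M} {G : Subgroup (Matrix.specialOrthogonalGroup (Fin n) ℝ)}
  (P : GStructure o G)

/-- The torsion as a bilinear map. -/
noncomputable def GStructure.torsionBilin (x : M) : TangentSpace (𝓡 n) x →ₗ[ℝ]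
    TangentSpace (𝓡 n) x →ₗ[ℝ] TangentSpace (𝓡 n) x :=
  LinearMap.mk₂ ℝ (fun u v => P.torsion x u v) (by simp) (by simp) (by simp) (by simp)

/-- Common to `s_𝔤⊥` and `s^alt_𝔤⊥`. The values of `R` need only be functions, because `orthPart`
reads an endomorphism solely on the frame vectors. -/
theorem GStructure.sum_sum_inner_orthPart (x : M)
    (R : TangentSpace (𝓡 n) x →ₗ[ℝ] TangentSpace (𝓡 n) x →ₗ[ℝ]
      (TangentSpace (𝓡 n) x → TangentSpace (𝓡 n) x)) :
    (∑ i, ∑ j, inner ℝ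
      (P.orthPart x (R (stdOrthonormalBasis ℝ (TangentSpace (𝓡 n) x) i)
          (stdOrthonormalBasis ℝ (TangentSpace (𝓡 n) x) j))
        (stdOrthonormalBasis ℝ (TangentSpace (𝓡 n) x) j))
      (stdOrthonormalBasis ℝ (TangentSpace (𝓡 n) x) i))
    = ∑ k, ∑ l, lieOrthPart G (Matrix.of fun a b => inner ℝ (P.localFrame x a x)
        (R (P.localFrame x k x) (P.localFrame x l x) (P.localFrame x b x))) k l := by
  let L : TangentSpace (𝓡 n) x →ₗ[ℝ] TangentSpace (𝓡 n) x →ₗ[ℝ] Matrix (Fin n) (Fin n) ℝ :=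
    LinearMap.mk₂ ℝ (fun u v => lieOrthPart G (Matrix.of fun a b =>
      inner ℝ (P.localFrame x a x) (R u v (P.localFrame x b x))))
      (fun u u' v => by
        rw [← map_add]; congr 1; ext a b; simp [inner_add_right])
      (fun c u v => by
        rw [← map_smul]; congr 1; ext a b; simp [real_inner_smul_right])
      (fun u v v' => by
        rw [← map_add]; congr 1; ext a b; simp [inner_add_right])
      (fun c u v => by
        rw [← map_smul]; congr 1; ext a b; simp [real_inner_smul_right])
  have h := sum_sum_orthPart_aux ((P.isOrthoFrameOn_localFrame x).basis (P.mem_nhd x))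
    (stdOrthonormalBasis ℝ (TangentSpace (𝓡 n) x)) L
  simp only [IsOrthoFrameOn.basis_apply] at h
  refine Eq.trans ?_ h
  refine Finset.sum_congr rfl fun i _ => Finset.sum_congr rfl fun j _ => ?_
  simp only [GStructure.orthPart, sum_apply, smul_apply,
    ContinuousLinearMap.smulRight_apply, innerSL_apply_apply, sum_inner, real_inner_smul_left,
    ← mul_assoc]
  rfl

variable {s : Fin n → Π y : M, TangentSpace (𝓡 n) y} {U : Set M} (F : IsOrthoFrameOn s U)
  (hs : ∀ y ∈ U, (fun i => s i y) ∈ P.frames y) {x : M} (hx : x ∈ U)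

include F hs hx

theorem GStructure.inner_charField_frame (c : Fin n) :
    inner ℝ (s c x) (P.charField x)
      = - ∑ k, lieOrthPart G (connectionMatrix s x (s k x)) c k := by
  have h := (stdOrthonormalBasis ℝ (TangentSpace (𝓡 n) x)).sum_bilin_eq (F.basis hx)
    (P.torsionBilin x)
  have h' : P.charField x = ∑ k, P.torsion x (s k x) (s k x) := by
    refine Eq.trans h ?_
    simp only [IsOrthoFrameOn.basis_apply]
    rfl
  rw [h', inner_sum, ← Finset.sum_neg_distrib]
  exact Finset.sum_congr rfl fun k _ => P.inner_torsion_frame F hs hx _ _ _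

theorem GStructure.smoothFnAt_lieOrthPart_frame (k a b : Fin n) :
    SmoothFnAt (n := n) (fun y => lieOrthPart G (connectionMatrix s y (s k y)) a b) x :=
  smoothFnAt_linearMap_matrix _ (F.smoothFnAt_connectionMatrix hx (F.smooth k x hx)) a b

theorem GStructure.smoothFieldAt_charField : SmoothFieldAt P.charField x := by
  refine F.smoothFieldAt_of_coeff hx fun c => ?_
  have h : SmoothFnAt (n := n)
      (fun y => - ∑ k, lieOrthPart G (connectionMatrix s y (s k y)) c k) x :=
    (smoothFnAt_finset_sum fun k _ => P.smoothFnAt_lieOrthPart_frame F hs hx k c k).neg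
  refine ContMDiffAt.congr_of_eventuallyEq h ?_
  filter_upwards [F.eventually_mem hx] with y hy
  exact P.inner_charField_frame F hs hy c

/-- Polarization gives `|(v - w)/2|² - |(v + w)/2|² = -g(v, w)`, so only `-∑ g(ξ_{e_i} e_j, ξ_{e_j}
e_i)` survives. -/
theorem GStructure.tensorNormSq_sub_frame :
    GStructure.tensorNormSq (P.torsionAlt x) - GStructure.tensorNormSq (P.torsionSym x)
      = - ∑ k, ∑ l, ∑ m, lieOrthPart G (connectionMatrix s x (s k x)) m l
          * lieOrthPart G (connectionMatrix s x (s l x)) m k := by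
  set e := stdOrthonormalBasis ℝ (TangentSpace (𝓡 n) x) with he
  have h1 : ∀ v w : TangentSpace (𝓡 n) x,
      ‖(1 / 2 : ℝ) • (v - w)‖ ^ 2 - ‖(1 / 2 : ℝ) • (v + w)‖ ^ 2 = - inner ℝ v w := by
    intro v w
    rw [norm_smul, norm_smul, mul_pow, mul_pow, norm_sub_sq_real, norm_add_sq_real]
    norm_num
    ring
  -- The sum is quadratic in each basis vector separately, so the basis is changed in `j` with the
  -- other vector fixed, and then in `i`.
  have h2 : ∀ u, ∑ j, (inner ℝ (P.torsion x u (e j)) (P.torsion x (e j) u) : ℝ)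
      = ∑ l, inner ℝ (P.torsion x u (s l x)) (P.torsion x (s l x) u) := by
    intro u
    have := e.sum_bilin_eq (F.basis hx) (LinearMap.mk₂ ℝ
      (fun v w => (inner ℝ (P.torsion x u v) (P.torsion x w u) : ℝ))
      (by simp [inner_add_left]) (by simp [real_inner_smul_left])
      (by simp [inner_add_right]) (by simp [real_inner_smul_right]))
    simpa using this
  have h3 : ∀ w, ∑ i, (inner ℝ (P.torsion x (e i) w) (P.torsion x w (e i)) : ℝ)
      = ∑ k, inner ℝ (P.torsion x (s k x) w) (P.torsion x w (s k x)) := by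
    intro u
    have := e.sum_bilin_eq (F.basis hx) (LinearMap.mk₂ ℝ
      (fun v w => (inner ℝ (P.torsion x v u) (P.torsion x u w) : ℝ))
      (by simp [inner_add_left]) (by simp [real_inner_smul_left])
      (by simp [inner_add_right]) (by simp [real_inner_smul_right]))
    simpa using this
  simp only [GStructure.tensorNormSq, ← Finset.sum_sub_distrib, GStructure.torsionAlt,
    GStructure.torsionSym, h1, Finset.sum_neg_distrib]
  rw [← he]
  simp only [h2]
  rw [Finset.sum_comm]
  simp only [h3]
  rw [Finset.sum_comm]
  congr 1
  refine Finset.sum_congr rfl fun k _ => Finset.sum_congr rfl fun l _ => ?_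
  rw [← F.sum_inner_mul_inner hx]
  refine Finset.sum_congr rfl fun m _ => ?_
  rw [P.inner_torsion_frame F hs hx, P.inner_torsion_frame F hs hx]
  ring

theorem GStructure.norm_charField_sq_frame :
    ‖P.charField x‖ ^ 2
      = ∑ c, (∑ k, lieOrthPart G (connectionMatrix s x (s k x)) c k) ^ 2 := by
  rw [← real_inner_self_eq_norm_sq, ← F.sum_inner_mul_inner hx]
  refine Finset.sum_congr rfl fun c _ => ?_
  rw [P.inner_charField_frame F hs hx]
  ring

theorem GStructure.divergence_charField_frame :
    divergence P.charField x
      = - (∑ k, ∑ l, lieOrthPart G (Matrix.of fun a b =>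
          mvfderiv (𝓡 n) (fun y => connectionMatrix s y (s l y) a b) x (s k x)) k l)
        + ∑ i, ∑ c, connectionMatrix s x (s i x) c i
          * ∑ k, lieOrthPart G (connectionMatrix s x (s k x)) c k := by
  rw [divergence_eq_sum_coeff F hx (P.smoothFieldAt_charField F hs hx)]
  simp only [P.inner_charField_frame F hs hx, mul_neg, Finset.sum_neg_distrib, sub_neg_eq_add]
  congr 1
  rw [← Finset.sum_neg_distrib]
  refine Finset.sum_congr rfl fun i _ => ?_
  -- The component formula must hold near `x` in one fixed section before it can be differentiated;
  -- here independence of the section is used.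
  have e : (fun y => (inner ℝ (s i y) (P.charField y) : ℝ)) =ᶠ[nhds x]
      fun y => ∑ k, -1 * lieOrthPart G (connectionMatrix s y (s k y)) i k := by
    filter_upwards [F.eventually_mem hx] with y hy
    rw [P.inner_charField_frame F hs hy, ← Finset.mul_sum, neg_one_mul]
  have hsm := P.smoothFnAt_lieOrthPart_frame F hs hx
  have hsm' : ∀ k, SmoothFnAt (n := n)
      (fun y => -1 * lieOrthPart G (connectionMatrix s y (s k y)) i k) x := fun k =>
    contMDiffAt_const.mul (hsm k i k)
  rw [mvfderiv_congr e, mvfderiv_finset_sum fun k _ => hsm' k, ← Finset.sum_neg_distrib]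
  refine Finset.sum_congr rfl fun k _ => ?_
  rw [mvfderiv_const_mul _ (hsm k i k), neg_one_mul,
    mvfderiv_linearMap_matrix _ (F.smoothFnAt_connectionMatrix hx (F.smooth k x hx))]

end PointwiseIdentity

/-! ### The pointwise divergence formula. -/

section MainIdentity

open VectorField

variable {n : ℕ} {M : Type*} [TopologicalSpace M] [ChartedSpace (EuclideanSpace ℝ (Fin n)) M]
  [IsManifold (𝓡 n) ∞ M] [RiemannianBundle (fun x : M => TangentSpace (𝓡 n) x)]
  [IsContMDiffRiemannianBundle (𝓡 n) ∞ (EuclideanSpace ℝ (Fin n))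
    (fun x : M => TangentSpace (𝓡 n) x)]
  {o : TangentOrientation n M} {G : Subgroup (Matrix.specialOrthogonalGroup (Fin n) ℝ)}
  (P : GStructure o G)

theorem GStructure.contMDiff_charField : ContMDiff (𝓡 n) (𝓡 n).tangent ∞
    (fun x => (⟨x, P.charField x⟩ : TangentBundle (𝓡 n) M)) := fun x =>
  P.smoothFieldAt_charField (P.isOrthoFrameOn_localFrame x) (P.localFrame_mem x) (P.mem_nhd x)

theorem GStructure.scalarOrthAlt_eq (x : M) :
    P.scalarOrthAlt x = ∑ k, ∑ l, lieOrthPart G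
      (lieOrthPart G (connectionMatrix (P.localFrame x) x (P.localFrame x k x))
        * lieOrthPart G (connectionMatrix (P.localFrame x) x (P.localFrame x l x))
      - lieOrthPart G (connectionMatrix (P.localFrame x) x (P.localFrame x l x))
        * lieOrthPart G (connectionMatrix (P.localFrame x) x (P.localFrame x k x))) k l := by
  have F := P.isOrthoFrameOn_localFrame x
  have hx := P.mem_nhd x
  have h := P.sum_sum_inner_orthPart x (LinearMap.mk₂ ℝ (P.torsionBracket x)
    (fun u u' v => by
      ext1 w; simp only [GStructure.torsionBracket, map_add, add_apply, Pi.add_apply]; abel)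
    (fun c u v => by
      ext1 w; simp only [GStructure.torsionBracket, map_smul, smul_apply, Pi.smul_apply, smul_sub])
    (fun u v v' => by
      ext1 w; simp only [GStructure.torsionBracket, map_add, add_apply, Pi.add_apply]; abel)
    (fun c u v => by
      ext1 w; simp only [GStructure.torsionBracket, map_smul, smul_apply, Pi.smul_apply, smul_sub]))
  refine Eq.trans h ?_
  refine Finset.sum_congr rfl fun k _ => Finset.sum_congr rfl fun l _ => ?_
  refine congrArg (fun A => lieOrthPart G A k l) ?_
  ext a b
  -- Composition of the `ξ`'s is the product of the matrices `-A_k` and `-A_l`, so the signs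
  -- disappear.
  have hc : ∀ k l, (inner ℝ (P.localFrame x a x) (P.torsion x (P.localFrame x k x)
      (P.torsion x (P.localFrame x l x) (P.localFrame x b x))) : ℝ)
      = (lieOrthPart G (connectionMatrix (P.localFrame x) x (P.localFrame x k x))
        * lieOrthPart G (connectionMatrix (P.localFrame x) x (P.localFrame x l x))) a b := by
    intro k l
    conv_lhs => rw [← F.sum_inner_smul hx
      (P.torsion x (P.localFrame x l x) (P.localFrame x b x))]
    simp only [map_sum, map_smul, inner_sum, real_inner_smul_right,
      P.inner_torsion_frame F (P.localFrame_mem x) hx, Matrix.mul_apply]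
    exact Finset.sum_congr rfl fun c _ => by ring
  simp only [LinearMap.mk₂_apply, GStructure.torsionBracket, Matrix.of_apply, inner_sub_right, hc,
    Matrix.sub_apply]

theorem GStructure.scalarOrth_eq (x : M) :
    P.scalarOrth x = ∑ k, ∑ l, lieOrthPart G (Matrix.of fun a b =>
      inner ℝ (P.localFrame x a x) (curvatureField (P.localFrame x k) (P.localFrame x l)
        (P.localFrame x b) x)) k l := by
  have F := P.isOrthoFrameOn_localFrame x
  have hx := P.mem_nhd x
  obtain ⟨R, hR⟩ := exists_linearMap_riemannCurvature F hx
  have h := P.sum_sum_inner_orthPart x R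
  simp only [hR, riemannCurvature_frame F hx] at h
  exact h

/-- Of the four brackets of components, `[𝔤, 𝔤]` is killed and the mixed ones already lie in the
complement. Nothing is known about `[𝔤^⊥, 𝔤^⊥]`, so there the projection stays. -/
theorem lieOrthPart_bracket (A B : Matrix (Fin n) (Fin n) ℝ) :
    lieOrthPart G (A * B - B * A)
      = (liePart G A * lieOrthPart G B - lieOrthPart G B * liePart G A)
        + (lieOrthPart G A * liePart G B - liePart G B * lieOrthPart G A)
        + lieOrthPart G (lieOrthPart G A * lieOrthPart G B - lieOrthPart G B * lieOrthPart G A) := by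
  have h1 := lieOrthPart_of_mem (bracket_mem_lieAlgebraOf (liePart_mem (G := G) A)
    (liePart_mem (G := G) B))
  have h2 := lieOrthPart_of_mem_orthogonal (bracket_mem_orthogonal (liePart_mem (G := G) A)
    (lieOrthPart_mem (G := G) B))
  have h3 := lieOrthPart_of_mem_orthogonal (bracket_mem_orthogonal (liePart_mem (G := G) B)
    (lieOrthPart_mem (G := G) A))
  have e : A * B - B * A
      = (liePart G A * liePart G B - liePart G B * liePart G A)
        + (liePart G A * lieOrthPart G B - lieOrthPart G B * liePart G A)
        - (liePart G B * lieOrthPart G A - lieOrthPart G A * liePart G B)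
        + (lieOrthPart G A * lieOrthPart G B - lieOrthPart G B * lieOrthPart G A) := by
    conv_lhs => rw [← liePart_add_lieOrthPart (G := G) A, ← liePart_add_lieOrthPart (G := G) B]
    noncomm_ring
  conv_lhs => rw [e]
  rw [map_add, map_sub, map_add, h1, h2, h3]
  abel

theorem GStructure.divergence_charField (x : M) :
    divergence P.charField x
      = 1 / 2 * P.scalarOrthAlt x - 1 / 2 * P.scalarOrth x + ‖P.charField x‖ ^ 2
        + GStructure.tensorNormSq (P.torsionAlt x) - GStructure.tensorNormSq (P.torsionSym x) := by
  have F := P.isOrthoFrameOn_localFrame x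
  have hs := P.localFrame_mem x
  have hx := P.mem_nhd x
  set s := P.localFrame x with hsdef
  set Γ : Fin n → Matrix (Fin n) (Fin n) ℝ := fun k => connectionMatrix s x (s k x) with hΓ
  set D : Fin n → Fin n → Matrix (Fin n) (Fin n) ℝ := fun k l => Matrix.of fun a b =>
    mvfderiv (𝓡 n) (fun y => connectionMatrix s y (s l y) a b) x (s k x) with hD
  have hΓskew : ∀ k i j, Γ k i j = - Γ k j i := fun k => F.connectionMatrix_skew hx _
  have hDskew : ∀ k l i j, D k l i j = - D k l j i := by
    intro k l i j
    have e : (fun y => connectionMatrix s y (s l y) i j) =ᶠ[nhds x]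
        fun y => -1 * connectionMatrix s y (s l y) j i := by
      filter_upwards [F.eventually_mem hx] with y hy
      rw [F.connectionMatrix_skew hy, neg_one_mul]
    simp only [hD, Matrix.of_apply]
    rw [mvfderiv_congr e, mvfderiv_const_mul _
      (F.smoothFnAt_connectionMatrix hx (F.smooth l x hx) j i), neg_one_mul]
  -- The structure equation in matrix form, so that the projection can be applied to it as a linear
  -- map.
  have hcurv : ∀ k l, (Matrix.of fun a b => (inner ℝ (s a x) (curvatureField (s k) (s l)
      (s b) x) : ℝ)) = D k l - D l k - ∑ m, (Γ k m l - Γ l m k) • Γ m + (Γ k * Γ l - Γ l * Γ k) := by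
    intro k l
    ext a b
    rw [Matrix.of_apply, F.inner_curvatureField hx]
    simp only [Matrix.add_apply, Matrix.sub_apply, Matrix.sum_apply, Matrix.smul_apply, smul_eq_mul]
    rfl
  have hid := connection_sum_identity (A := fun k => lieOrthPart G (Γ k))
    (B := fun k => liePart G (Γ k)) (fun k => lieOrthPart_skew (hΓskew k))
    (fun k => liePart_skew)
  have hΓ' : ∀ k, lieOrthPart G (Γ k) + liePart G (Γ k) = Γ k := fun k => by
    rw [add_comm, liePart_add_lieOrthPart]
  simp only [hΓ'] at hid
  -- Exchanging the names of `k` and `l` and using skewness flips the sign. This accounts for the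
  -- factor 2 in `hdiff`, hence for the factor 1/2 in the formula.
  have hDD : ∑ k, ∑ l, lieOrthPart G (D l k) k l = - ∑ k, ∑ l, lieOrthPart G (D k l) k l := by
    rw [Finset.sum_comm, ← Finset.sum_neg_distrib]
    refine Finset.sum_congr rfl fun k _ => ?_
    rw [← Finset.sum_neg_distrib]
    exact Finset.sum_congr rfl fun l _ => lieOrthPart_skew (hDskew k l) l k
  have hdiff : P.scalarOrth x - P.scalarOrthAlt x
      = 2 * (∑ k, ∑ l, lieOrthPart G (D k l) k l)
        - (∑ k, ∑ l, ∑ m, (Γ k m l - Γ l m k) * lieOrthPart G (Γ m) k l)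
        + (∑ k, ∑ l, ((liePart G (Γ k) * lieOrthPart G (Γ l)
            - lieOrthPart G (Γ l) * liePart G (Γ k)) k l
          + (lieOrthPart G (Γ k) * liePart G (Γ l)
            - liePart G (Γ l) * lieOrthPart G (Γ k)) k l)) := by
    have hterm : ∀ k l, lieOrthPart G (Matrix.of fun a b => (inner ℝ (s a x)
        (curvatureField (s k) (s l) (s b) x) : ℝ)) k l
        - lieOrthPart G (lieOrthPart G (Γ k) * lieOrthPart G (Γ l)
          - lieOrthPart G (Γ l) * lieOrthPart G (Γ k)) k l
        = lieOrthPart G (D k l) k l - lieOrthPart G (D l k) k l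
          - (∑ m, (Γ k m l - Γ l m k) * lieOrthPart G (Γ m) k l)
          + ((liePart G (Γ k) * lieOrthPart G (Γ l)
            - lieOrthPart G (Γ l) * liePart G (Γ k)) k l
          + (lieOrthPart G (Γ k) * liePart G (Γ l)
            - liePart G (Γ l) * lieOrthPart G (Γ k)) k l) := by
      intro k l
      rw [hcurv, map_add, map_sub, map_sub, map_sum, lieOrthPart_bracket]
      simp only [map_smul, Matrix.add_apply, Matrix.sub_apply, Matrix.sum_apply, Matrix.smul_apply,
        smul_eq_mul]
      ring
    rw [P.scalarOrth_eq, P.scalarOrthAlt_eq, ← hsdef, ← Finset.sum_sub_distrib]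
    simp only [← Finset.sum_sub_distrib (f := fun _ : Fin n => (_ : ℝ))]
    rw [Finset.sum_congr rfl fun k _ => Finset.sum_congr rfl fun l _ => hterm k l]
    simp only [Finset.sum_add_distrib, Finset.sum_sub_distrib (f := fun _ : Fin n => (_ : ℝ)), hDD]
    ring
  have hnorm := P.tensorNormSq_sub_frame F hs hx
  have hdiv := P.divergence_charField_frame F hs hx
  have hchi := P.norm_charField_sq_frame F hs hx
  -- The derivative sum is eliminated between `hdiv` and `hdiff`; the quadratic remainder is `hid`.
  linarith [hid, hdiff, hnorm, hdiv, hchi]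

/-- The function `|χ|² + |ξ^alt|² - |ξ^sym|²` is smooth. -/
theorem GStructure.smoothFnAt_quadratic (x : M) :
    SmoothFnAt (n := n) (fun x => ‖P.charField x‖ ^ 2
      + GStructure.tensorNormSq (P.torsionAlt x) - GStructure.tensorNormSq (P.torsionSym x)) x := by
  have F := P.isOrthoFrameOn_localFrame x
  have hs := P.localFrame_mem x
  have hx := P.mem_nhd x
  have h := P.smoothFnAt_lieOrthPart_frame F hs hx
  -- The orthonormal bases in `tensorNormSq` carry no regularity in the point, so smoothness is read
  -- off from the frame expression.
  have h1 : SmoothFnAt (n := n) (fun y => (inner ℝ (P.charField y) (P.charField y) : ℝ)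
      - ∑ k, ∑ l, ∑ m,
        lieOrthPart G (connectionMatrix (P.localFrame x) y (P.localFrame x k y)) m l
          * lieOrthPart G (connectionMatrix (P.localFrame x) y (P.localFrame x l y)) m k) x :=
    ContMDiffAt.sub (SmoothFieldAt.inner (P.contMDiff_charField x) (P.contMDiff_charField x))
      (smoothFnAt_finset_sum fun k _ => smoothFnAt_finset_sum fun l _ =>
        smoothFnAt_finset_sum fun m _ => (h k m l).mul (h l m k))
  refine ContMDiffAt.congr_of_eventuallyEq h1 ?_
  filter_upwards [F.eventually_mem hx] with y hy
  rw [add_sub_assoc, P.tensorNormSq_sub_frame F hs hy, real_inner_self_eq_norm_sq, sub_eq_add_neg]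

-- `P` serves here only as a source of smooth local orthonormal frames.
include P in
theorem GStructure.smoothFnAt_divergence (x : M) {X : Π y : M, TangentSpace (𝓡 n) y}
    (hX : SmoothFieldAt X x) : SmoothFnAt (n := n) (divergence X) x :=
  _root_.smoothFnAt_divergence (P.isOrthoFrameOn_localFrame x) (P.mem_nhd x) hX

end MainIdentity

/-! ### Coordinate vector fields and the Riemannian density of a chart. -/

section ChartFields

open VectorField

variable {n : ℕ} {M : Type*} [TopologicalSpace M] [ChartedSpace (EuclideanSpace ℝ (Fin n)) M]
  [IsManifold (𝓡 n) ∞ M]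

theorem isManifold_one : IsManifold (𝓡 n) 1 M :=
  IsManifold.of_le (n := ∞) (by exact_mod_cast le_top)

theorem range_model : Set.range (𝓡 n) = Set.univ := by simp

variable (x : M)

/-- The vector field on the domain of the chart `φ` at `x` corresponding to the constant
field `v`. -/
noncomputable def chartField (v : EuclideanSpace ℝ (Fin n)) (p : M) : TangentSpace (𝓡 n) p :=
  (mfderiv (𝓡 n) (𝓡 n) (extChartAt (𝓡 n) x) p).inverse v

variable {x}

theorem smoothFieldAt_const (v y : EuclideanSpace ℝ (Fin n)) :
    SmoothFieldAt (n := n) (fun _ : EuclideanSpace ℝ (Fin n) => v) y := by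
  exact contMDiffAt_vectorSpace_iff_contDiffAt.mpr contDiffAt_const

theorem smoothFieldAt_chartField (v : EuclideanSpace ℝ (Fin n)) {p : M}
    (hp : p ∈ (extChartAt (𝓡 n) x).source) : SmoothFieldAt (chartField x v) p := by
  have := isManifold_one (n := n) (M := M)
  exact ContMDiffAt.mpullback_vectorField_preimage (n := ∞) (m := ∞) (I' := 𝓡 n)
    (f := extChartAt (𝓡 n) x) (V := fun _ => v) (smoothFieldAt_const v _)
    (contMDiffAt_extChartAt' (by simpa using hp)) (isInvertible_mfderiv_extChartAt hp) (by simp)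

/-- The bracket is natural under pullback, and constant fields on Euclidean space commute. -/
theorem mlieBracket_chartField (v w : EuclideanSpace ℝ (Fin n)) {p : M}
    (hp : p ∈ (extChartAt (𝓡 n) x).source) :
    mlieBracket (𝓡 n) (chartField x v) (chartField x w) p = 0 := by
  have : IsManifold (𝓡 n) (minSmoothness ℝ 2) M :=
    IsManifold.of_le (n := ∞) (by simpa using two_le_infty)
  have h := mpullback_mlieBracket (I := 𝓡 n) (I' := 𝓡 n) (n := ∞) (f := extChartAt (𝓡 n) x)
    (V := fun _ => v) (W := fun _ => w) (x₀ := p)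
    (smoothFieldAt_const v _).diffFieldAt (smoothFieldAt_const w _).diffFieldAt
    (contMDiffAt_extChartAt' (by simpa using hp)) (by simpa using two_le_infty)
  refine h.symm.trans ?_
  have : mlieBracket (𝓡 n) (fun _ : EuclideanSpace ℝ (Fin n) => v) (fun _ => w) = 0 := by
    have e := mlieBracketWithin_eq_lieBracketWithin (𝕜 := ℝ) (s := Set.univ)
      (V := fun _ : EuclideanSpace ℝ (Fin n) => v) (W := fun _ => w)
    refine (mlieBracketWithin_univ (I := 𝓡 n)).symm.trans (e.trans ?_)
    ext1 y
    simp only [lieBracketWithin, fderivWithin_const_apply]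
    simp
    rfl
  rw [this, mpullback_zero]
  rfl

theorem mfderiv_symm_eq_chartField {y : EuclideanSpace ℝ (Fin n)}
    (hy : y ∈ (extChartAt (𝓡 n) x).target) (v : EuclideanSpace ℝ (Fin n)) :
    mfderiv (𝓡 n) (𝓡 n) (extChartAt (𝓡 n) x).symm y v
      = chartField x v ((extChartAt (𝓡 n) x).symm y) := by
  have := isManifold_one (n := n) (M := M)
  have h := mfderiv_extChartAt_comp_mfderivWithin_extChartAt_symm (I := 𝓡 n) hy
  rw [range_model, mfderivWithin_univ] at h
  have hinv := isInvertible_mfderiv_extChartAt (I := 𝓡 n) ((extChartAt (𝓡 n) x).map_target hy)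
  have hv := congr($h v)
  rw [chartField]
  obtain ⟨e, he⟩ := hinv
  rw [← he] at hv ⊢
  rw [ContinuousLinearMap.inverse_equiv]
  exact (e.symm_apply_eq.mpr hv.symm).symm

theorem coordField_eq_chartField {y : EuclideanSpace ℝ (Fin n)}
    (hy : y ∈ (extChartAt (𝓡 n) x).target) (i : Fin n) :
    coordField x y i
      = chartField x (EuclideanSpace.single i 1) ((extChartAt (𝓡 n) x).symm y) :=
  mfderiv_symm_eq_chartField hy _

theorem linearIndependent_chartField {p : M} (hp : p ∈ (extChartAt (𝓡 n) x).source) :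
    LinearIndependent ℝ fun i : Fin n => chartField x (EuclideanSpace.single i 1) p := by
  have := isManifold_one (n := n) (M := M)
  obtain ⟨e, he⟩ := isInvertible_mfderiv_extChartAt (I := 𝓡 n) hp
  let e' : EuclideanSpace ℝ (Fin n) ≃L[ℝ] TangentSpace (𝓡 n) p := e.symm
  have h := (EuclideanSpace.basisFun (Fin n) ℝ).toBasis.linearIndependent.map'
    (e'.toLinearEquiv : EuclideanSpace ℝ (Fin n) →ₗ[ℝ] TangentSpace (𝓡 n) p)
    (LinearMap.ker_eq_bot.mpr e'.injective)
  have h' : (fun i : Fin n => chartField x (EuclideanSpace.single i 1) p)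
      = e' ∘ (EuclideanSpace.basisFun (Fin n) ℝ).toBasis := by
    ext1 i
    rw [Function.comp_apply, OrthonormalBasis.coe_toBasis, EuclideanSpace.basisFun_apply,
      chartField, ← he, ContinuousLinearMap.inverse_equiv]
    rfl
  rw [h']
  exact h

variable [RiemannianBundle (fun x : M => TangentSpace (𝓡 n) x)]

variable (n x) in
/-- The Gram matrix of the coordinate fields of the chart at `x`, as a function on `M`. -/
noncomputable def chartGram (p : M) : Matrix (Fin n) (Fin n) ℝ :=
  Matrix.of fun i j => inner ℝ (chartField x (EuclideanSpace.single i 1) p)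
    (chartField x (EuclideanSpace.single j 1) p)

theorem gramMatrix_eq_chartGram {y : EuclideanSpace ℝ (Fin n)}
    (hy : y ∈ (extChartAt (𝓡 n) x).target) :
    gramMatrix x y = chartGram n x ((extChartAt (𝓡 n) x).symm y) := by
  simp only [gramMatrix, chartGram, coordField_eq_chartField hy]

theorem posDef_chartGram {p : M} (hp : p ∈ (extChartAt (𝓡 n) x).source) :
    (chartGram n x p).PosDef :=
  Matrix.posDef_gram_of_linearIndependent (𝕜 := ℝ) (linearIndependent_chartField hp)

theorem det_chartGram_pos {p : M} (hp : p ∈ (extChartAt (𝓡 n) x).source) :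
    0 < (chartGram n x p).det :=
  (posDef_chartGram hp).det_pos

variable (n x) in
/-- The density `√(det g_ij)` of the chart at `x`, as a function on `M`. -/
noncomputable def chartDensity (p : M) : ℝ := √(chartGram n x p).det

theorem sqrt_det_gramMatrix {y : EuclideanSpace ℝ (Fin n)}
    (hy : y ∈ (extChartAt (𝓡 n) x).target) :
    √(gramMatrix x y).det = chartDensity n x ((extChartAt (𝓡 n) x).symm y) := by
  rw [gramMatrix_eq_chartGram hy, chartDensity]

variable [IsContMDiffRiemannianBundle (𝓡 n) ∞ (EuclideanSpace ℝ (Fin n))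
    (fun x : M => TangentSpace (𝓡 n) x)]

theorem smoothFnAt_chartGram {p : M} (hp : p ∈ (extChartAt (𝓡 n) x).source) (i j : Fin n) :
    SmoothFnAt (n := n) (fun p => chartGram n x p i j) p :=
  (smoothFieldAt_chartField _ hp).inner (smoothFieldAt_chartField _ hp)

theorem smoothFnAt_det_chartGram {p : M} (hp : p ∈ (extChartAt (𝓡 n) x).source) :
    SmoothFnAt (n := n) (fun p => (chartGram n x p).det) p := by
  simp only [Matrix.det_apply']
  exact smoothFnAt_finset_sum fun σ _ => contMDiffAt_const.mul
    (contMDiffAt_finsetProd fun i _ => smoothFnAt_chartGram hp _ _)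

theorem smoothFnAt_chartDensity {p : M} (hp : p ∈ (extChartAt (𝓡 n) x).source) :
    SmoothFnAt (n := n) (chartDensity n x) p :=
  (Real.contDiffAt_sqrt (det_chartGram_pos hp).ne').contMDiffAt.comp p (smoothFnAt_det_chartGram hp)

end ChartFields

/-! ### The Riemannian volume measure: independence of the chart, local finiteness, integration in a
chart. -/

section ChartVolume

open MeasureTheory

variable {n : ℕ} {M : Type*} [TopologicalSpace M] [ChartedSpace (EuclideanSpace ℝ (Fin n)) M]
  [IsManifold (𝓡 n) ∞ M] {x z : M}

theorem isOpen_extChartAt_target' (x : M) : IsOpen (extChartAt (𝓡 n) x).target :=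
  isOpen_extChartAt_target x

theorem mdifferentiableAt_extChartAt_symm {y : EuclideanSpace ℝ (Fin n)}
    (hy : y ∈ (extChartAt (𝓡 n) x).target) :
    MDifferentiableAt (𝓡 n) (𝓡 n) (extChartAt (𝓡 n) x).symm y :=
  ((contMDiffOn_extChartAt_symm (I := 𝓡 n) (n := ∞) x).contMDiffAt
    ((isOpen_extChartAt_target' x).mem_nhds hy)).mdifferentiableAt (by simp)

theorem mdifferentiableAt_extChartAt_of_mem {p : M} (hp : p ∈ (extChartAt (𝓡 n) x).source) :
    MDifferentiableAt (𝓡 n) (𝓡 n) (extChartAt (𝓡 n) x) p :=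
  (contMDiffAt_extChartAt' (I := 𝓡 n) (n := ∞) (by simpa using hp)).mdifferentiableAt (by simp)

theorem differentiableAt_transition {y : EuclideanSpace ℝ (Fin n)}
    (hy : y ∈ (extChartAt (𝓡 n) x).target)
    (hz : (extChartAt (𝓡 n) x).symm y ∈ (extChartAt (𝓡 n) z).source) :
    DifferentiableAt ℝ (extChartAt (𝓡 n) z ∘ (extChartAt (𝓡 n) x).symm) y :=
  mdifferentiableAt_iff_differentiableAt.mp
    ((mdifferentiableAt_extChartAt_of_mem hz).comp y (mdifferentiableAt_extChartAt_symm hy))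

theorem chartField_mfderiv {p : M} (hp : p ∈ (extChartAt (𝓡 n) x).source)
    (u : TangentSpace (𝓡 n) p) :
    chartField x (mfderiv (𝓡 n) (𝓡 n) (extChartAt (𝓡 n) x) p u) p = u := by
  have := isManifold_one (n := n) (M := M)
  obtain ⟨e, he⟩ := isInvertible_mfderiv_extChartAt (I := 𝓡 n) hp
  have h : (mfderiv (𝓡 n) (𝓡 n) (extChartAt (𝓡 n) x) p).inverse
      (mfderiv (𝓡 n) (𝓡 n) (extChartAt (𝓡 n) x) p u) = u := by
    rw [← he, ContinuousLinearMap.inverse_equiv]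
    exact e.symm_apply_apply u
  exact h

theorem chartField_transition {y : EuclideanSpace ℝ (Fin n)}
    (hy : y ∈ (extChartAt (𝓡 n) x).target)
    (hz : (extChartAt (𝓡 n) x).symm y ∈ (extChartAt (𝓡 n) z).source)
    (v : EuclideanSpace ℝ (Fin n)) :
    chartField x v ((extChartAt (𝓡 n) x).symm y)
      = chartField z (fderiv ℝ (extChartAt (𝓡 n) z ∘ (extChartAt (𝓡 n) x).symm) y v)
        ((extChartAt (𝓡 n) x).symm y) := by
  have := isManifold_one (n := n) (M := M)
  have h := mfderiv_comp y (mdifferentiableAt_extChartAt_of_mem hz)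
    (mdifferentiableAt_extChartAt_symm hy)
  rw [mfderiv_eq_fderiv] at h
  have hv : fderiv ℝ (extChartAt (𝓡 n) z ∘ (extChartAt (𝓡 n) x).symm) y v
      = mfderiv (𝓡 n) (𝓡 n) (extChartAt (𝓡 n) z) ((extChartAt (𝓡 n) x).symm y)
        (mfderiv (𝓡 n) (𝓡 n) (extChartAt (𝓡 n) x).symm y v) := congr($h v)
  rw [hv, mfderiv_symm_eq_chartField hy]
  exact (chartField_mfderiv hz _).symm

theorem chartField_eq_sum (v : EuclideanSpace ℝ (Fin n)) (p : M) :
    chartField x v p = ∑ i, v i • chartField x (EuclideanSpace.single i 1) p := by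
  have h : v = ∑ i, v i • EuclideanSpace.single i (1 : ℝ) := by
    simpa using ((EuclideanSpace.basisFun (Fin n) ℝ).sum_repr v).symm
  conv_lhs => rw [h]
  simp only [chartField]
  exact (map_sum _ _ _).trans (Finset.sum_congr rfl fun i _ => map_smul _ _ _)

variable [RiemannianBundle (fun x : M => TangentSpace (𝓡 n) x)]

/-- With `B` the Jacobian matrix of the transition map, the Gram matrices are related by `Bᵀ g B`;
take square roots of determinants. -/
theorem chartDensity_transition {y : EuclideanSpace ℝ (Fin n)}
    (hy : y ∈ (extChartAt (𝓡 n) x).target)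
    (hz : (extChartAt (𝓡 n) x).symm y ∈ (extChartAt (𝓡 n) z).source) :
    chartDensity n x ((extChartAt (𝓡 n) x).symm y)
      = |(fderiv ℝ (extChartAt (𝓡 n) z ∘ (extChartAt (𝓡 n) x).symm) y).det|
        * chartDensity n z ((extChartAt (𝓡 n) x).symm y) := by
  set A := fderiv ℝ (extChartAt (𝓡 n) z ∘ (extChartAt (𝓡 n) x).symm) y with hA
  set p := (extChartAt (𝓡 n) x).symm y
  let b := (EuclideanSpace.basisFun (Fin n) ℝ).toBasis
  let B : Matrix (Fin n) (Fin n) ℝ := LinearMap.toMatrix b b A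
  have hB : ∀ k i, B k i = A (EuclideanSpace.single i 1) k := by
    intro k i
    simp [B, b, LinearMap.toMatrix_apply]
  have hdet : B.det = A.det := by
    rw [LinearMap.det_toMatrix]
  have hgram : chartGram n x p = B.transpose * chartGram n z p * B := by
    ext i j
    have hf : ∀ i, chartField x (EuclideanSpace.single i 1) p
        = ∑ k, B k i • chartField z (EuclideanSpace.single k 1) p := by
      intro i
      rw [chartField_transition hy hz, chartField_eq_sum]
      simp only [hB, hA]
      rfl
    rw [chartGram, Matrix.of_apply, hf, hf]
    simp only [sum_inner, inner_sum, real_inner_smul_left, real_inner_smul_right,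
      Matrix.mul_apply, Matrix.transpose_apply, chartGram, Matrix.of_apply, Finset.sum_mul]
    exact Finset.sum_congr rfl fun k _ => Finset.sum_congr rfl fun l _ => by ring
  rw [chartDensity, chartDensity, hgram, Matrix.det_mul, Matrix.det_mul, Matrix.det_transpose, hdet,
    show A.det * (chartGram n z p).det * A.det = A.det ^ 2 * (chartGram n z p).det by ring,
    Real.sqrt_mul (sq_nonneg _), Real.sqrt_sq_eq_abs]

variable [MeasurableSpace M] [BorelSpace M]

theorem aemeasurable_extChartAt_symm (x : M) :
    AEMeasurable (extChartAt (𝓡 n) x).symm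
      ((volume : Measure (EuclideanSpace ℝ (Fin n))).restrict (extChartAt (𝓡 n) x).target) :=
  (continuousOn_extChartAt_symm x).aemeasurable (isOpen_extChartAt_target' x).measurableSet

theorem measurableSet_target_inter_preimage (x : M) {A : Set M} (hA : MeasurableSet A) :
    MeasurableSet ((extChartAt (𝓡 n) x).target ∩ (extChartAt (𝓡 n) x).symm ⁻¹' A) := by
  have h := (continuousOn_extChartAt_symm (I := 𝓡 n) x).domRestrict.measurable hA
  have := (MeasurableEmbedding.subtype_coe (isOpen_extChartAt_target' (n := n) x).measurableSet)
    |>.measurableSet_image.mpr h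
  convert this using 1
  ext y
  simp [and_comm]

theorem chartVolume_apply (x : M) {A : Set M} (hA : MeasurableSet A) :
    chartVolume (n := n) x A
      = ∫⁻ y in (extChartAt (𝓡 n) x).target ∩ (extChartAt (𝓡 n) x).symm ⁻¹' A,
        ENNReal.ofReal (chartDensity n x ((extChartAt (𝓡 n) x).symm y)) := by
  have hac := withDensity_absolutelyContinuous
    ((volume : Measure (EuclideanSpace ℝ (Fin n))).restrict (extChartAt (𝓡 n) x).target)
    (fun y => ENNReal.ofReal √(gramMatrix x y).det)
  have hT := (isOpen_extChartAt_target' (n := n) x).measurableSet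
  rw [chartVolume, Measure.map_apply_of_aemeasurable ((aemeasurable_extChartAt_symm x).mono_ac hac)
    hA, withDensity_apply', Measure.restrict_restrict', Set.inter_comm]
  · refine setLIntegral_congr_fun (measurableSet_target_inter_preimage x hA) fun y hy => ?_
    rw [sqrt_det_gramMatrix hy.1]
  · exact hT

theorem chartVolume_inter_source (x : M) {A : Set M} (hA : MeasurableSet A) :
    chartVolume (n := n) x (A ∩ (extChartAt (𝓡 n) x).source) = chartVolume (n := n) x A := by
  rw [chartVolume_apply x hA,
    chartVolume_apply x (hA.inter (isOpen_extChartAt_source x).measurableSet)]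
  congr 2
  ext y
  simp only [Set.mem_inter_iff, Set.mem_preimage]
  exact ⟨fun h => ⟨h.1, h.2.1⟩, fun h => ⟨h.1, h.2, (extChartAt (𝓡 n) x).map_target h.1⟩⟩

/-- The change of variables formula for the transition map, whose Jacobian is exactly the ratio of
the densities. -/
theorem chartVolume_eq_of_subset {A : Set M} (hA : MeasurableSet A)
    (hx : A ⊆ (extChartAt (𝓡 n) x).source) (hz : A ⊆ (extChartAt (𝓡 n) z).source) :
    chartVolume (n := n) x A = chartVolume (n := n) z A := by
  set D := (extChartAt (𝓡 n) x).target ∩ (extChartAt (𝓡 n) x).symm ⁻¹' A with hD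
  set τ := extChartAt (𝓡 n) z ∘ (extChartAt (𝓡 n) x).symm with hτ
  have himage : (extChartAt (𝓡 n) z).target ∩ (extChartAt (𝓡 n) z).symm ⁻¹' A = τ '' D := by
    ext w
    constructor
    · rintro ⟨hw, hwA⟩
      refine ⟨extChartAt (𝓡 n) x ((extChartAt (𝓡 n) z).symm w),
        ⟨(extChartAt (𝓡 n) x).map_source (hx hwA), ?_⟩, ?_⟩
      · rw [Set.mem_preimage, (extChartAt (𝓡 n) x).left_inv (hx hwA)]
        exact hwA
      · rw [hτ, Function.comp_apply, (extChartAt (𝓡 n) x).left_inv (hx hwA),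
          (extChartAt (𝓡 n) z).right_inv hw]
    · rintro ⟨y, ⟨hy, hyA⟩, rfl⟩
      refine ⟨(extChartAt (𝓡 n) z).map_source (hz hyA), ?_⟩
      rw [Set.mem_preimage, hτ, Function.comp_apply, (extChartAt (𝓡 n) z).left_inv (hz hyA)]
      exact hyA
  have hinj : Set.InjOn τ D := by
    intro y hy w hw h
    exact (extChartAt (𝓡 n) x).symm.injOn hy.1 hw.1
      ((extChartAt (𝓡 n) z).injOn (hz hy.2) (hz hw.2) h)
  have hDm : MeasurableSet D := measurableSet_target_inter_preimage x hA
  rw [chartVolume_apply x hA, chartVolume_apply z hA, himage,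
    lintegral_image_eq_lintegral_abs_det_fderiv_mul _ hDm (f' := fderiv ℝ τ)
      (fun y hy => (differentiableAt_transition hy.1 (hz hy.2)).hasFDerivAt.hasFDerivWithinAt) hinj]
  refine setLIntegral_congr_fun hDm fun y hy => ?_
  rw [chartDensity_transition hy.1 (hz hy.2), ENNReal.ofReal_mul (abs_nonneg _), hτ,
    Function.comp_apply, (extChartAt (𝓡 n) z).left_inv (hz hy.2)]

theorem riemannianVolume_apply_of_subset {A : Set M} (hA : MeasurableSet A)
    (hx : A ⊆ (extChartAt (𝓡 n) x).source) :
    riemannianVolume n M A = chartVolume (n := n) x A := by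
  have hS := (isOpen_extChartAt_source (I := 𝓡 n) x).measurableSet
  refine le_antisymm ?_ (Measure.le_iff'.mp (le_iSup (chartVolume (n := n)) x) A)
  set S := (extChartAt (𝓡 n) x).source
  -- An upper bound for the supremum that is the measure of the chart at `x` on `S` and the supremum
  -- itself off `S`. Every chart measure lies below it, since on `S` it agrees with that of `x`
  -- wherever both charts are defined and vanishes elsewhere.
  have hle : riemannianVolume n M
      ≤ (chartVolume (n := n) x).restrict S + (riemannianVolume n M).restrict Sᶜ := by
    refine iSup_le fun z => Measure.le_iff.mpr fun B hB => ?_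
    rw [Measure.add_apply, Measure.restrict_apply hB, Measure.restrict_apply hB,
      ← measure_inter_add_sdiff B hS]
    refine add_le_add ?_ ?_
    · have hzS := (isOpen_extChartAt_source (I := 𝓡 n) z).measurableSet
      rw [← chartVolume_inter_source z (hB.inter hS), ← chartVolume_eq_of_subset
        ((hB.inter hS).inter hzS) (x := x) (fun y hy => hy.1.2) (fun y hy => hy.2)]
      exact measure_mono Set.inter_subset_left
    · exact Measure.le_iff'.mp (le_iSup (chartVolume (n := n)) z) (B ∩ Sᶜ)
  have h := Measure.le_iff.mp hle A hA
  rw [Measure.add_apply, Measure.restrict_apply hA, Measure.restrict_apply hA,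
    Set.inter_eq_left.mpr hx, (Set.disjoint_compl_right_iff_subset.mpr hx).inter_eq, measure_empty,
    add_zero] at h
  exact h

theorem riemannianVolume_restrict_source (x : M) :
    (riemannianVolume n M).restrict (extChartAt (𝓡 n) x).source = chartVolume (n := n) x := by
  ext A hA
  have hS := (isOpen_extChartAt_source (I := 𝓡 n) x).measurableSet
  rw [Measure.restrict_apply hA, riemannianVolume_apply_of_subset (hA.inter hS)
    Set.inter_subset_right, chartVolume_inter_source x hA]

variable [IsContMDiffRiemannianBundle (𝓡 n) ∞ (EuclideanSpace ℝ (Fin n))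
    (fun x : M => TangentSpace (𝓡 n) x)]

theorem contDiffOn_comp_symm {f : M → ℝ}
    (hf : ∀ p ∈ (extChartAt (𝓡 n) x).source, SmoothFnAt (n := n) f p) :
    ContDiffOn ℝ ∞ (f ∘ (extChartAt (𝓡 n) x).symm) (extChartAt (𝓡 n) x).target := by
  rw [← contMDiffOn_iff_contDiffOn]
  intro y hy
  exact ((hf _ ((extChartAt (𝓡 n) x).map_target hy)).comp y
    ((contMDiffOn_extChartAt_symm (I := 𝓡 n) (n := ∞) x).contMDiffAt
      ((isOpen_extChartAt_target' x).mem_nhds hy))).contMDiffWithinAt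

theorem contDiffOn_chartDensity (x : M) :
    ContDiffOn ℝ ∞ (chartDensity n x ∘ (extChartAt (𝓡 n) x).symm) (extChartAt (𝓡 n) x).target :=
  contDiffOn_comp_symm fun _ hp => smoothFnAt_chartDensity hp

/-- A closed coordinate ball inside the chart target is compact, so the continuous density is
bounded on it. -/
theorem isLocallyFiniteMeasure_riemannianVolume :
    IsLocallyFiniteMeasure (riemannianVolume n M) := by
  refine ⟨fun x => ?_⟩
  have hT := (isOpen_extChartAt_target' (n := n) x).mem_nhds (mem_extChartAt_target x)
  obtain ⟨r, hr, hrT⟩ := Metric.nhds_basis_closedBall.mem_iff.mp hT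
  set K := Metric.closedBall (extChartAt (𝓡 n) x x) r with hK
  set A := (extChartAt (𝓡 n) x).source ∩ extChartAt (𝓡 n) x ⁻¹' Metric.ball (extChartAt (𝓡 n) x x) r
  have hA : IsOpen A := isOpen_extChartAt_preimage' x Metric.isOpen_ball
  refine ⟨A, hA.mem_nhds ⟨mem_extChartAt_source x, Metric.mem_ball_self hr⟩, ?_⟩
  rw [riemannianVolume_apply_of_subset hA.measurableSet Set.inter_subset_left,
    chartVolume_apply x hA.measurableSet]
  have hsub : (extChartAt (𝓡 n) x).target ∩ (extChartAt (𝓡 n) x).symm ⁻¹' A ⊆ K := by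
    rintro y ⟨hy, -, hyA⟩
    rw [Set.mem_preimage, (extChartAt (𝓡 n) x).right_inv hy] at hyA
    exact Metric.ball_subset_closedBall hyA
  have hcpt : IsCompact K := isCompact_closedBall _ _
  have hcont := ((contDiffOn_chartDensity (n := n) x).continuousOn.mono hrT)
  obtain ⟨C, hC⟩ := hcpt.bddAbove_image hcont
  calc _ ≤ ∫⁻ y in K, ENNReal.ofReal (chartDensity n x ((extChartAt (𝓡 n) x).symm y)) :=
        lintegral_mono_set hsub
    _ ≤ ∫⁻ y in K, ENNReal.ofReal C :=
        setLIntegral_mono measurable_const fun y hy =>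
          ENNReal.ofReal_le_ofReal (hC (Set.mem_image_of_mem _ hy))
    _ < ⊤ := by
        rw [setLIntegral_const]
        exact ENNReal.mul_lt_top ENNReal.ofReal_lt_top hcpt.measure_lt_top

theorem integral_riemannianVolume_of_chart {f : M → ℝ} (hf : Continuous f)
    (h0 : ∀ p ∉ (extChartAt (𝓡 n) x).source, f p = 0) :
    ∫ p, f p ∂(riemannianVolume n M)
      = ∫ y in (extChartAt (𝓡 n) x).target, chartDensity n x ((extChartAt (𝓡 n) x).symm y)
        * f ((extChartAt (𝓡 n) x).symm y) := by
  have hT := (isOpen_extChartAt_target' (n := n) x).measurableSet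
  have hae : AEMeasurable (fun y => ENNReal.ofReal √(gramMatrix x y).det)
      ((volume : Measure (EuclideanSpace ℝ (Fin n))).restrict (extChartAt (𝓡 n) x).target) := by
    refine AEMeasurable.ennreal_ofReal ?_
    refine ContinuousOn.aemeasurable ?_ hT
    exact (contDiffOn_chartDensity (n := n) x).continuousOn.congr
      fun y hy => sqrt_det_gramMatrix hy
  rw [← setIntegral_eq_integral_of_forall_compl_eq_zero h0, riemannianVolume_restrict_source,
    chartVolume, integral_map ((aemeasurable_extChartAt_symm x).mono_ac
      (withDensity_absolutelyContinuous _ _)) hf.aestronglyMeasurable,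
    integral_withDensity_eq_integral_toReal_smul₀ hae (by simp)]
  refine setIntegral_congr_fun hT fun y hy => ?_
  rw [smul_eq_mul, ENNReal.toReal_ofReal (Real.sqrt_nonneg _), sqrt_det_gramMatrix hy]

end ChartVolume

/-- Jacobi's formula for the derivative of a determinant. -/
theorem hasDerivAt_det {m : Type*} [Fintype m] [DecidableEq m] {A : ℝ → Matrix m m ℝ}
    {A' : Matrix m m ℝ} {t : ℝ} (h : ∀ i j, HasDerivAt (fun s => A s i j) (A' i j) t) :
    HasDerivAt (fun s => (A s).det) ((A t).adjugate * A').trace t := by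
  have h1 : HasDerivAt (fun s => (A s).det) (∑ σ : Equiv.Perm m,
      ((Equiv.Perm.sign σ : ℤ) : ℝ) * ∑ i, (∏ j ∈ Finset.univ.erase i, A t (σ j) j) • A' (σ i) i)
      t := by
    simp only [Matrix.det_apply']
    exact HasDerivAt.fun_sum fun σ _ =>
      (HasDerivAt.fun_finsetProd fun i _ => h (σ i) i).const_mul _
  convert h1 using 1
  -- Cramer's rule: the diagonal entry is the determinant with column `i` replaced by its
  -- derivative, matching the product rule term by term.
  have h2 : ∀ i, ((A t).adjugate * A') i i = ((A t).updateCol i fun j => A' j i).det := by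
    intro i
    rw [← Matrix.cramer_apply, Matrix.cramer_eq_adjugate_mulVec, Matrix.mul_apply]
    rfl
  simp only [Matrix.trace, Matrix.diag_apply, h2, Finset.mul_sum]
  rw [Finset.sum_comm]
  refine Finset.sum_congr rfl fun i _ => ?_
  rw [Matrix.det_apply']
  refine Finset.sum_congr rfl fun σ _ => ?_
  rw [← Finset.mul_prod_erase _ _ (Finset.mem_univ i), Matrix.updateCol_self, smul_eq_mul,
    mul_comm (A' (σ i) i)]
  congr 2
  refine Finset.prod_congr rfl fun j hj => ?_
  rw [Matrix.updateCol_ne (Finset.ne_of_mem_erase hj)]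

/-! ### The coordinate formula for the divergence. -/

section LocalDivergence

variable {n : ℕ} {M : Type*} [TopologicalSpace M] [ChartedSpace (EuclideanSpace ℝ (Fin n)) M]
  [IsManifold (𝓡 n) ∞ M] [RiemannianBundle (fun x : M => TangentSpace (𝓡 n) x)]
  [IsContMDiffRiemannianBundle (𝓡 n) ∞ (EuclideanSpace ℝ (Fin n))
    (fun x : M => TangentSpace (𝓡 n) x)] {x : M}

theorem divergence_congr {X Y : Π y : M, TangentSpace (𝓡 n) y} {p : M} (hX : DiffFieldAt X p)
    (h : ∀ᶠ y in nhds p, Y y = X y) : divergence Y p = divergence X p := by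
  rw [divergence, divergence, leviCivita_congr hX h]

theorem divergence_zero (p : M) : divergence (0 : Π y : M, TangentSpace (𝓡 n) y) p = 0 := by
  rw [divergence, CovariantDerivative.zero]
  simp

theorem divergence_add {X Y : Π y : M, TangentSpace (𝓡 n) y} {p : M} (hX : DiffFieldAt X p)
    (hY : DiffFieldAt Y p) : divergence (X + Y) p = divergence X p + divergence Y p := by
  rw [divergence, leviCivita_add hX hY, ContinuousLinearMap.toLinearMap_add, map_add]
  rfl

theorem divergence_finset_sum {ι : Type*} (t : Finset ι) {X : ι → Π y : M, TangentSpace (𝓡 n) y}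
    {p : M} (hX : ∀ i ∈ t, SmoothFieldAt (X i) p) :
    divergence (∑ i ∈ t, X i) p = ∑ i ∈ t, divergence (X i) p := by
  classical
  induction t using Finset.induction_on with
  | empty => simpa using divergence_zero p
  | insert i t hi ih =>
    have ht : ∀ j ∈ t, SmoothFieldAt (X j) p := fun j hj => hX j (Finset.mem_insert_of_mem hj)
    rw [Finset.sum_insert hi, Finset.sum_insert hi, divergence_add
      (hX i (Finset.mem_insert_self i t)).diffFieldAt (SmoothFieldAt.sum ht).diffFieldAt, ih ht]

theorem divergence_smul {f : M → ℝ} {X : Π y : M, TangentSpace (𝓡 n) y} {p : M}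
    (hf : MDifferentiableAt (𝓡 n) 𝓘(ℝ, ℝ) f p) (hX : DiffFieldAt X p) :
    divergence (f • X) p = f p * divergence X p + mvfderiv (𝓡 n) f p (X p) := by
  have h : (leviCivita n M (f • X) p : TangentSpace (𝓡 n) p →ₗ[ℝ] TangentSpace (𝓡 n) p)
      = f p • (leviCivita n M X p : TangentSpace (𝓡 n) p →ₗ[ℝ] TangentSpace (𝓡 n) p)
        + (mvfderiv (𝓡 n) f p : TangentSpace (𝓡 n) p →ₗ[ℝ] ℝ).smulRight (X p) := by
    ext u
    exact leviCivita_smul hf hX u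
  rw [divergence, h, map_add, map_smul, LinearMap.trace_smulRight]
  rfl

/-- Let `L` be the matrix of `u ↦ ∇_u ∂_i`. Since coordinate fields commute, `∇_{∂_i} ∂_j = ∇_{∂_j}
∂_i`, so `∂_i g = Lᵀ g + g L`. Jacobi's formula gives `∂_i det g = 2 det g · tr L`, and `tr L` is
the divergence of `∂_i`. -/
theorem mvfderiv_chartDensity {p : M} (hp : p ∈ (extChartAt (𝓡 n) x).source) (i : Fin n) :
    mvfderiv (𝓡 n) (chartDensity n x) p (chartField x (EuclideanSpace.single i 1) p)
      = chartDensity n x p * divergence (chartField x (EuclideanSpace.single i 1)) p := by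
  set C : Fin n → Π q : M, TangentSpace (𝓡 n) q :=
    fun j => chartField x (EuclideanSpace.single j 1) with hC
  have hCs : ∀ j, SmoothFieldAt (C j) p := fun j => smoothFieldAt_chartField _ hp
  have hli : LinearIndependent ℝ fun j => C j p := linearIndependent_chartField hp
  let b : Module.Basis (Fin n) ℝ (TangentSpace (𝓡 n) p) := Module.Basis.mk hli
    (hli.span_eq_top_of_card_eq_finrank' (by rw [finrank_tangentSpace, Fintype.card_fin])).ge
  have hb : ∀ j, b j = C j p := fun j => by simp [b]
  let L := LinearMap.toMatrix b b
    (leviCivita n M (C i) p : TangentSpace (𝓡 n) p →ₗ[ℝ] TangentSpace (𝓡 n) p)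
  have hdiv : divergence (C i) p = L.trace := LinearMap.trace_eq_matrix_trace ℝ b _
  have hL : ∀ j, leviCivita n M (C i) p (C j p) = ∑ m, L m j • C m p := by
    intro j
    conv_lhs => rw [← b.sum_repr (leviCivita n M (C i) p (C j p))]
    simp only [L, LinearMap.toMatrix_apply, hb]
    rfl
  have hswap : ∀ j, leviCivita n M (C j) p (C i p) = ∑ m, L m j • C m p := by
    intro j
    have h := leviCivita_sub_swap (hCs i).diffFieldAt (hCs j).diffFieldAt
    rw [mlieBracket_chartField _ _ hp] at h
    rw [← hL, ← sub_eq_zero, ← h]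
  set g := chartGram n x p with hg
  have hdg : ∀ j k, mvfderiv (𝓡 n) (fun q => chartGram n x q j k) p (C i p)
      = (L.transpose * g + g * L) j k := by
    intro j k
    change mvfderiv (𝓡 n) (fun q => (inner ℝ (C j q) (C k q) : ℝ)) p (C i p) = _
    rw [mvfderiv_inner (hCs j).diffFieldAt (hCs k).diffFieldAt, hswap, hswap]
    simp only [sum_inner, inner_sum, real_inner_smul_left, real_inner_smul_right,
      Matrix.add_apply, Matrix.mul_apply, Matrix.transpose_apply]
    congr 1
    exact Finset.sum_congr rfl fun m _ => mul_comm _ _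
  obtain ⟨c, hc0, -, hc⟩ := exists_curve p (C i p)
  have hpos := det_chartGram_pos (n := n) hp
  have hdet := hasDerivAt_det (A := fun t => chartGram n x (c t)) (t := 0)
    (fun j k => by simpa only [hdg] using hc _ (smoothFnAt_chartGram hp j k).mdifferentiableAt)
  have htr : (g.adjugate * (L.transpose * g + g * L)).trace = 2 * g.det * L.trace := by
    rw [mul_add, Matrix.trace_add, ← mul_assoc, Matrix.trace_mul_comm, ← mul_assoc, ← mul_assoc,
      Matrix.mul_adjugate, Matrix.adjugate_mul, Matrix.smul_mul, Matrix.smul_mul, one_mul, one_mul,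
      Matrix.trace_smul, Matrix.trace_smul, Matrix.trace_transpose, smul_eq_mul]
    ring
  simp only [hc0] at hdet
  rw [← hg, htr] at hdet
  have hsqrt := hdet.sqrt (by simp only [hc0]; exact hpos.ne')
  rw [(hc _ (smoothFnAt_chartDensity hp).mdifferentiableAt).unique hsqrt, hdiv]
  simp only [hc0, chartDensity]
  have hs := Real.mul_self_sqrt hpos.le
  have hs0 := (Real.sqrt_pos.mpr hpos).ne'
  rw [← hg] at hs hs0 ⊢
  field_simp
  rw [pow_two, hs, mul_comm]

variable (n x) in
/-- The `i`-th component, in the chart at `x`, of a vector field. -/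
noncomputable def chartCoeff (X : Π y : M, TangentSpace (𝓡 n) y) (i : Fin n) (p : M) : ℝ :=
  mvfderiv (𝓡 n) (fun q => extChartAt (𝓡 n) x q i) p (X p)

theorem smoothFnAt_coord {p : M} (hp : p ∈ (extChartAt (𝓡 n) x).source) (i : Fin n) :
    SmoothFnAt (n := n) (fun q => extChartAt (𝓡 n) x q i) p :=
  (EuclideanSpace.proj (𝕜 := ℝ) i).contDiff.contDiffAt.contMDiffAt.comp p
    (contMDiffAt_extChartAt' (I := 𝓡 n) (n := ∞) (by simpa using hp))

theorem smoothFnAt_chartCoeff {X : Π y : M, TangentSpace (𝓡 n) y} {p : M}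
    (hp : p ∈ (extChartAt (𝓡 n) x).source) (hX : SmoothFieldAt X p) (i : Fin n) :
    SmoothFnAt (n := n) (chartCoeff n x X i) p :=
  (smoothFnAt_coord hp i).mvfderiv_apply hX

theorem sum_chartCoeff_smul (X : Π y : M, TangentSpace (𝓡 n) y) {p : M}
    (hp : p ∈ (extChartAt (𝓡 n) x).source) :
    ∑ i, chartCoeff n x X i p • chartField x (EuclideanSpace.single i 1) p = X p := by
  let w : EuclideanSpace ℝ (Fin n) := mfderiv (𝓡 n) (𝓡 n) (extChartAt (𝓡 n) x) p (X p)
  have h : ∀ i, chartCoeff n x X i p = w i := by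
    intro i
    let pr : EuclideanSpace ℝ (Fin n) →L[ℝ] ℝ := EuclideanSpace.proj i
    have h := mfderiv_comp p (I := 𝓡 n) (I' := 𝓡 n) (I'' := 𝓘(ℝ, ℝ)) (g := pr)
      pr.differentiableAt.mdifferentiableAt (mdifferentiableAt_extChartAt_of_mem hp)
    rw [mfderiv_eq_fderiv, ContinuousLinearMap.fderiv] at h
    exact congr($h (X p))
  simp only [h]
  rw [← chartField_eq_sum]
  exact chartField_mfderiv hp (X p)

/-- Write `X = ∑ X^i ∂_i` near the point and apply the product rule to each summand; the derivative
of the density supplies the term with `div ∂_i`. -/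
theorem chartDensity_mul_divergence {X : Π y : M, TangentSpace (𝓡 n) y} {p : M}
    (hp : p ∈ (extChartAt (𝓡 n) x).source) (hX : SmoothFieldAt X p) :
    chartDensity n x p * divergence X p
      = ∑ i, mvfderiv (𝓡 n) (fun q => chartDensity n x q * chartCoeff n x X i q) p
        (chartField x (EuclideanSpace.single i 1) p) := by
  have hC : ∀ j, SmoothFieldAt (chartField x (EuclideanSpace.single j 1)) p :=
    fun j => smoothFieldAt_chartField _ hp
  have ha := smoothFnAt_chartCoeff hp hX
  have hs : ∀ i, SmoothFieldAt (chartCoeff n x X i • chartField x (EuclideanSpace.single i 1)) p :=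
    fun i => (hC i).smul (ha i)
  have hsum : divergence X p
      = divergence (∑ i, chartCoeff n x X i • chartField x (EuclideanSpace.single i 1)) p := by
    refine divergence_congr (SmoothFieldAt.sum fun i _ => hs i).diffFieldAt ?_
    filter_upwards [(isOpen_extChartAt_source (I := 𝓡 n) x).mem_nhds hp] with q hq
    rw [Finset.sum_apply]
    exact (sum_chartCoeff_smul X hq).symm
  rw [hsum, divergence_finset_sum _ fun i _ => hs i, Finset.mul_sum]
  refine Finset.sum_congr rfl fun i _ => ?_
  rw [divergence_smul (ha i).mdifferentiableAt (hC i).diffFieldAt]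
  have := mvfderiv_mul (smoothFnAt_chartDensity (n := n) hp).mdifferentiableAt
    (ha i).mdifferentiableAt
  have h2 := congr($this (chartField x (EuclideanSpace.single i 1) p))
  refine Eq.trans ?_ h2.symm
  simp only [add_apply, smul_apply, smul_eq_mul, mvfderiv_chartDensity hp]
  ring

theorem fderiv_comp_symm {f : M → ℝ} {y : EuclideanSpace ℝ (Fin n)}
    (hy : y ∈ (extChartAt (𝓡 n) x).target)
    (hf : SmoothFnAt (n := n) f ((extChartAt (𝓡 n) x).symm y)) (v : EuclideanSpace ℝ (Fin n)) :
    fderiv ℝ (f ∘ (extChartAt (𝓡 n) x).symm) y v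
      = mvfderiv (𝓡 n) f ((extChartAt (𝓡 n) x).symm y)
        (chartField x v ((extChartAt (𝓡 n) x).symm y)) := by
  have h := mfderiv_comp y hf.mdifferentiableAt (mdifferentiableAt_extChartAt_symm hy)
  rw [mfderiv_eq_fderiv] at h
  rw [← mfderiv_symm_eq_chartField hy]
  exact congr($h v)

end LocalDivergence

/-- Integration by parts against the constant function 1. -/
theorem integral_fderiv_apply_eq_zero {n : ℕ} {f : EuclideanSpace ℝ (Fin n) → ℝ}
    (hf : ContDiff ℝ ∞ f) (hc : HasCompactSupport f) (v : EuclideanSpace ℝ (Fin n)) :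
    MeasureTheory.Integrable (fun y => fderiv ℝ f y v) ∧ ∫ y, fderiv ℝ f y v = 0 := by
  have hcont : Continuous fun y => fderiv ℝ f y v :=
    (hf.continuous_fderiv (by simp)).clm_apply continuous_const
  have hint : MeasureTheory.Integrable (fun y => fderiv ℝ f y v) :=
    hcont.integrable_of_hasCompactSupport (hc.fderiv_apply (𝕜 := ℝ) v)
  refine ⟨hint, ?_⟩
  have h := integral_mul_fderiv_eq_neg_fderiv_mul_of_integrable
    (μ := MeasureTheory.volume) (f := fun _ => (1 : ℝ)) (g := f) (v := v) (by simp)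
    (by simpa using hint)
    (by simpa using hf.continuous.integrable_of_hasCompactSupport hc) (fun _ _ => by fun_prop)
    (fun y _ => (hf.differentiable (by simp)) y)
  simpa using h

/-! ### The divergence theorem. -/

section DivergenceTheorem

open MeasureTheory

variable {n : ℕ} {M : Type*} [TopologicalSpace M] [T2Space M]
  [ChartedSpace (EuclideanSpace ℝ (Fin n)) M]
  [IsManifold (𝓡 n) ∞ M] [RiemannianBundle (fun x : M => TangentSpace (𝓡 n) x)]
  [IsContMDiffRiemannianBundle (𝓡 n) ∞ (EuclideanSpace ℝ (Fin n))
    (fun x : M => TangentSpace (𝓡 n) x)] [MeasurableSpace M] [BorelSpace M]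

/-- The divergence theorem for a vector field supported in the domain of a chart. -/
theorem integral_divergence_of_chart {x : M} {K : Set M} (hK : IsCompact K)
    (hKS : K ⊆ (extChartAt (𝓡 n) x).source) {X : Π y : M, TangentSpace (𝓡 n) y}
    (hX : ∀ p, SmoothFieldAt X p) (h0 : ∀ p ∉ K, X p = 0) (hcont : Continuous (divergence X)) :
    ∫ p, divergence X p ∂(riemannianVolume n M) = 0 := by
  set φ := extChartAt (𝓡 n) x with hφ
  have hTo : IsOpen φ.target := isOpen_extChartAt_target' x
  have hdiv0 : ∀ p ∉ φ.source, divergence X p = 0 := by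
    intro p hp
    rw [divergence_congr (X := 0) (mdifferentiableAt_zeroSection ..), divergence_zero]
    filter_upwards [hK.isClosed.isOpen_compl.mem_nhds (fun h => hp (hKS h))] with q hq
    exact h0 q hq
  have hK' : IsCompact (φ '' K) := hK.image_of_continuousOn
    ((continuousOn_extChartAt x).mono hKS)
  let a : Fin n → M → ℝ := fun i q => chartDensity n x q * chartCoeff n x X i q
  have ha : ∀ i, ∀ p ∈ φ.source, SmoothFnAt (n := n) (a i) p := fun i p hp =>
    (smoothFnAt_chartDensity hp).mul (smoothFnAt_chartCoeff hp (hX p) i)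
  -- Extension of `√(det g) X^i` by zero to all of Euclidean space. It is smooth because a point
  -- outside the chart target has a neighbourhood missing the compact, hence closed, set `φ '' K`.
  let F : Fin n → EuclideanSpace ℝ (Fin n) → ℝ := fun i => φ.target.indicator (a i ∘ φ.symm)
  have hF0 : ∀ i, ∀ y ∉ φ '' K, F i y = 0 := by
    intro i y hy
    by_cases hyT : y ∈ φ.target
    · have hyK : φ.symm y ∉ K := fun h => hy ⟨_, h, φ.right_inv hyT⟩
      simp only [F, Set.indicator_of_mem hyT, Function.comp_apply, a, chartCoeff]
      rw [h0 _ hyK, map_zero, mul_zero]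
    · exact Set.indicator_of_notMem hyT _
  have hFT : ∀ i, ∀ y ∈ φ.target, F i =ᶠ[nhds y] a i ∘ φ.symm := fun i y hy => by
    filter_upwards [hTo.mem_nhds hy] with w hw using Set.indicator_of_mem hw _
  have hFout : ∀ i, ∀ y ∉ φ.target, F i =ᶠ[nhds y] fun _ => 0 := fun i y hy => by
    filter_upwards [hK'.isClosed.isOpen_compl.mem_nhds (show y ∉ φ '' K from by
      rintro ⟨p, hp, rfl⟩
      exact hy (φ.map_source (hKS hp)))] with w hw using hF0 i w hw
  have hFs : ∀ i, ContDiff ℝ ∞ (F i) := by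
    intro i
    refine contDiff_iff_contDiffAt.mpr fun y => ?_
    by_cases hyT : y ∈ φ.target
    · exact ((contDiffOn_comp_symm (ha i)).contDiffAt (hTo.mem_nhds hyT)).congr_of_eventuallyEq
        (hFT i y hyT)
    · exact contDiffAt_const.congr_of_eventuallyEq (hFout i y hyT)
  have hFc : ∀ i, HasCompactSupport (F i) := fun i => HasCompactSupport.intro hK' (hF0 i)
  have hI := fun i => integral_fderiv_apply_eq_zero (hFs i) (hFc i) (EuclideanSpace.single i 1)
  rw [integral_riemannianVolume_of_chart hcont hdiv0]
  have hT : ∀ y ∈ φ.target, chartDensity n x (φ.symm y) * divergence X (φ.symm y)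
      = ∑ i, fderiv ℝ (F i) y (EuclideanSpace.single i 1) := by
    intro y hy
    have hp := φ.map_target hy
    rw [chartDensity_mul_divergence hp (hX _)]
    refine Finset.sum_congr rfl fun i _ => ?_
    rw [(hFT i y hy).fderiv_eq, fderiv_comp_symm hy (ha i _ hp)]
  rw [setIntegral_congr_fun hTo.measurableSet hT, setIntegral_eq_integral_of_forall_compl_eq_zero,
    integral_finsetSum _ fun i _ => (hI i).1]
  · exact Finset.sum_eq_zero fun i _ => (hI i).2
  · intro y hy
    refine Finset.sum_eq_zero fun i _ => ?_
    rw [(hFout i y hy).fderiv_eq]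
    simp

variable [CompactSpace M]

theorem integrable_riemannianVolume {f : M → ℝ} (hf : Continuous f) :
    Integrable f (riemannianVolume n M) := by
  have := isLocallyFiniteMeasure_riemannianVolume (n := n) (M := M)
  exact hf.integrable_of_hasCompactSupport (HasCompactSupport.of_compactSpace f)

/-- The divergence theorem on a closed manifold. -/
theorem integral_divergence_eq_zero
    (hdiv : ∀ Y : Π y : M, TangentSpace (𝓡 n) y, (∀ p, SmoothFieldAt Y p) →
      Continuous (divergence Y))
    {X : Π y : M, TangentSpace (𝓡 n) y} (hX : ∀ p, SmoothFieldAt X p) :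
    ∫ p, divergence X p ∂(riemannianVolume n M) = 0 := by
  obtain ⟨t, ht⟩ := isCompact_univ.elim_finite_subcover
    (fun x : M => (extChartAt (𝓡 n) x).source) (fun x => isOpen_extChartAt_source x)
    (fun x _ => Set.mem_iUnion.mpr ⟨x, mem_extChartAt_source x⟩)
  -- Indexing the partition by the finite subcover makes `X = ∑ ρ_i X` a finite sum, so divergence
  -- and integral pass through it directly.
  obtain ⟨ρ, hρ⟩ := SmoothPartitionOfUnity.exists_isSubordinate (𝓡 n) (s := Set.univ)
    isClosed_univ (fun x : t => (extChartAt (𝓡 n) (x : M)).source)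
    (fun x => isOpen_extChartAt_source _) (by
      intro p hp
      obtain ⟨x, hx, hpx⟩ := Set.mem_iUnion₂.mp (ht hp)
      exact Set.mem_iUnion.mpr ⟨⟨x, hx⟩, hpx⟩)
  have hs : ∀ i : t, ∀ p, SmoothFieldAt ((ρ i : M → ℝ) • X) p := fun i p =>
    SmoothFieldAt.smul ((ρ i).contMDiff p) (hX p)
  have hsum : X = ∑ i : t, (ρ i : M → ℝ) • X := by
    ext1 p
    rw [Finset.sum_apply]
    simp only [Pi.smul_apply']
    rw [← Finset.sum_smul, ← finsum_eq_sum_of_fintype, ρ.sum_eq_one (Set.mem_univ p), one_smul]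
  have h1 : ∀ p, divergence X p = ∑ i : t, divergence ((ρ i : M → ℝ) • X) p := by
    intro p
    conv_lhs => rw [hsum]
    exact divergence_finset_sum _ fun i _ => hs i p
  simp only [h1]
  rw [integral_finsetSum _ fun i _ => integrable_riemannianVolume (hdiv _ (hs i))]
  refine Finset.sum_eq_zero fun i _ => ?_
  refine integral_divergence_of_chart (isClosed_tsupport (ρ i)).isCompact (hρ i) (hs i) ?_
    (hdiv _ (hs i))
  intro p hp
  rw [Pi.smul_apply', image_eq_zero_of_notMem_tsupport hp, zero_smul]

end DivergenceTheorem

/-! ### The divergence formula and its integrated form. -/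

theorem mainTheorem1 {n : ℕ} {M : Type*} [TopologicalSpace M] [T2Space M]
    [ChartedSpace (EuclideanSpace ℝ (Fin n)) M] [IsManifold (𝓡 n) ∞ M]
    [RiemannianBundle (fun x : M => TangentSpace (𝓡 n) x)]
    [IsContMDiffRiemannianBundle (𝓡 n) ∞ (EuclideanSpace ℝ (Fin n))
      (fun x : M => TangentSpace (𝓡 n) x)]
    (o : TangentOrientation n M)
    (G : Subgroup (Matrix.specialOrthogonalGroup (Fin n) ℝ))
    (hG : IsClosed (G : Set (Matrix.specialOrthogonalGroup (Fin n) ℝ)))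
    (P : GStructure o G) :
    ContMDiff (𝓡 n) (𝓡 n).tangent ∞
      (fun x => (⟨x, P.charField x⟩ : TangentBundle (𝓡 n) M)) ∧
    (∀ x : M, divergence P.charField x
      = 1 / 2 * P.scalarOrthAlt x - 1 / 2 * P.scalarOrth x + ‖P.charField x‖ ^ 2
        + GStructure.tensorNormSq (P.torsionAlt x) - GStructure.tensorNormSq (P.torsionSym x)) ∧
    (∀ [CompactSpace M] [MeasurableSpace M] [BorelSpace M],
      MeasureTheory.Integrable (fun x => P.scalarOrth x - P.scalarOrthAlt x)
        (riemannianVolume n M) ∧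
      MeasureTheory.Integrable (fun x => ‖P.charField x‖ ^ 2
        + GStructure.tensorNormSq (P.torsionAlt x) - GStructure.tensorNormSq (P.torsionSym x))
        (riemannianVolume n M) ∧
      1 / 2 * ∫ x, (P.scalarOrth x - P.scalarOrthAlt x) ∂(riemannianVolume n M)
        = ∫ x, (‖P.charField x‖ ^ 2 + GStructure.tensorNormSq (P.torsionAlt x)
          - GStructure.tensorNormSq (P.torsionSym x)) ∂(riemannianVolume n M)) := by
  refine ⟨P.contMDiff_charField, P.divergence_charField, ?_⟩
  intro _ _ _
  have hdiv : ∀ Y : Π y : M, TangentSpace (𝓡 n) y, (∀ p, SmoothFieldAt Y p) →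
      Continuous (divergence Y) := fun Y hY =>
    continuous_iff_continuousAt.mpr fun p => (P.smoothFnAt_divergence p (hY p)).continuousAt
  have hχ : ∀ p, SmoothFieldAt P.charField p := fun p => P.contMDiff_charField p
  have hI1 := integrable_riemannianVolume (n := n) (hdiv _ hχ)
  have hI2 := integrable_riemannianVolume (n := n)
    (continuous_iff_continuousAt.mpr fun p => (P.smoothFnAt_quadratic p).continuousAt)
  have h0 := integral_divergence_eq_zero hdiv hχ
  -- The pointwise formula rewrites the curvature difference through continuous functions, so its
  -- integrability needs no regularity argument for the curvature terms.
  have he : (fun x => P.scalarOrth x - P.scalarOrthAlt x) = fun x =>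
      2 * ((‖P.charField x‖ ^ 2 + GStructure.tensorNormSq (P.torsionAlt x)
        - GStructure.tensorNormSq (P.torsionSym x)) - divergence P.charField x) := by
    ext1 x
    rw [P.divergence_charField x]
    ring
  refine ⟨?_, hI2, ?_⟩
  · rw [he]
    exact (hI2.sub hI1).const_mul 2
  · rw [he, MeasureTheory.integral_const_mul, MeasureTheory.integral_sub hI2 hI1, h0]
    ring
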